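/- **Definitions.** A flag $f$ in $\mathbb R^d$ is a nested family of subspaces $f^0\subset f^1\subset\dots\subset f^d$ of $\mathbb R^d$ with $\dim f^i=i$; flags carry the usual topology of the flag variety $\mathcal F_d$. A tuple $(f_1,\dots,f_n)$ of flags is transverse if $f_1^{m_1}\oplus\dots\oplus f_n^{m_n}=\mathbb R^d$ whenever $m_1+\dots+m_n=d$, $m_k\ge 0$. For a transverse pair $(a,b)$ let $L_i(a,b)=a^i\cap b^{d-i+1}$ ($1\le i\le d$); a basis $(e_i)$ of $\mathbb R^d$ is consistent with $(a,b)$ if $e_i\in L_i(a,b)$ for all $i$. Let $U_{\ge0}$ be the set of unipotent upper triangular real $d\times d$ matrices all of whose minors are $\ge 0$; let $U_{>0}\subset U_{\ge 0}$ be the set of those for which every minor that is nonzero at some element of $U_{\ge0}$ is positive. A transverse quadruple $(a,x,y,b)$ of flags is positive if there are a basis consistent with $(a,b)$ and linear maps $u_1,u_2$ whose matrices in this basis lie in $U_{>0}$ such that $y=u_1(b)$ and $x=u_1u_2(b)$. A matrix is totally positive if all its minors are positive. **Theorem.** (1) Let $(a,x,y,b)$ be a positive quadruple of flags in $\mathbb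 R^d$. Then any $d$ of the $2d$ lines $$L_1(a,b),\dots,L_d(a,b),\;L_1(x,y),\dots,L_d(x,y)$$ are in general position, i.e. $\mathbb R^d$ is their direct sum. Moreover, there are bases $(e_i)$ consistent with $(a,b)$ and $(f_j)$ consistent with $(x,y)$ such that the matrix $A$ defined by $f_j=\sum_i A_{ij}e_i$ is totally positive. (2) Let $S$ be a closed orientable surface of genus at least $2$, let $d\ge2$, and let $\rho:\pi_1(S)\to\mathsf{PSL}_d(\mathbb R)$ be a Hitchin representation, that is, one which can be continuously deformed, through representations, to $\tau\circ\rho_0$ with $\rho_0:\pi_1(S)\to\mathsf{PSL}_2(\mathbb R)$ discrete and faithful and $\tau:\mathsf{PSL}_2(\mathbb R)\to\mathsf{PSL}_d(\mathbb R)$ an irreducible representation (a symmetric power up to conjugation in $\mathsf{GL}_d(\mathbb R)$). Identify $\partial_\infty\pi_1(S)$ with $\mathbf P^1(\mathbb R)=\partial\mathbf H^2$ through some discrete faithful representation $\pi_1(S)\to\mathsf{PSL}_2(\mathbb R)$. Let $\xi:\partial_\infty\pi_1(S)\to\mathcal F_d$ be the limit map of $\rho$, i.e. the continuous $\rho$-equivariant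 map such that (proximality) for $\gamma\neq1$ the eigenvalues of $\rho(\gamma)$ have $d$ distinct moduli and $\xi^i(\gamma^+)$ is spanned by the eigenvectors for the $i$ eigenvalues of largest modulus, where $\gamma^+$ is the attracting fixed point of $\gamma$, and (hyperconvexity) the images of pairwise distinct points form a transverse tuple. If $z_1,z_2,z_3,z_4$ are pairwise distinct and in cyclic order (for one of the two orientations) in $\partial_\infty\pi_1(S)$, then both conclusions of (1) hold for $(a,x,y,b)=(\xi(z_1),\xi(z_2),\xi(z_3),\xi(z_4))$. -/

import Mathlib

open scoped MatrixGroups Topology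

noncomputable section

/-! ### Flags, transversality and the lines `L i (a, b)` -/

/-- A complete flag of `ℝ^d`: an increasing family of subspaces `sub i` with `dim (sub i) = i`.
The (forced) terms `sub 0 = 0` and `sub d = ℝ^d` are included for convenience. -/
@[ext]
structure FullFlag (d : ℕ) where
  sub : Fin (d + 1) → Submodule ℝ (EuclideanSpace ℝ (Fin d))
  mono : Monotone sub
  finrank_sub : ∀ i, Module.finrank ℝ (sub i) = (i : ℕ)

namespace FullFlag

/-- The usual topology of the flag variety, as a subspace of a product of Grassmannians; a
subspace is identified with the orthogonal projection onto it. -/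
instance (d : ℕ) : TopologicalSpace (FullFlag d) :=
  TopologicalSpace.induced (fun f i => (f.sub i).starProjection)
    (inferInstance : TopologicalSpace
      (Fin (d + 1) → EuclideanSpace ℝ (Fin d) →L[ℝ] EuclideanSpace ℝ (Fin d)))

/-- `g` is the image `T(f)` of the flag `f` under the linear map `T`. -/
def IsImage {d : ℕ} (T : EuclideanSpace ℝ (Fin d) →ₗ[ℝ] EuclideanSpace ℝ (Fin d))
    (f g : FullFlag d) : Prop :=
  ∀ i, g.sub i = (f.sub i).map T

/-- An `n`-tuple of flags is transverse if `f₁^{m₁} ⊕ ⋯ ⊕ fₙ^{mₙ} = ℝ^d` whenever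
`m₁ + ⋯ + mₙ = d`. -/
def IsTransverse {d n : ℕ} (f : Fin n → FullFlag d) : Prop :=
  ∀ m : Fin n → Fin (d + 1), ∑ k, (m k : ℕ) = d →
    DirectSum.IsInternal (fun k => (f k).sub (m k))

/-- `L_i(a,b) = a^i ∩ b^{d-i+1}` for `1 ≤ i ≤ d`. Here the index is shifted to `0 ≤ i < d`, so
that the line with index `i` is `a^{i+1} ∩ b^{d-i}`. -/
def line {d : ℕ} (a b : FullFlag d) (i : Fin d) : Submodule ℝ (EuclideanSpace ℝ (Fin d)) :=
  a.sub i.succ ⊓ b.sub i.rev.succ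

/-- A basis `(e_i)` is consistent with `(a,b)` if `e_i ∈ L_i(a,b)` for all `i`. -/
def IsConsistent {d : ℕ} (a b : FullFlag d)
    (e : Module.Basis (Fin d) ℝ (EuclideanSpace ℝ (Fin d))) : Prop :=
  ∀ i, e i ∈ line a b i

end FullFlag

/-! ### Total positivity -/

/-- All minors are positive. A minor is given by an increasing list `I` of rows and an increasing
list `J` of columns of the same length. -/
def Matrix.IsTotallyPositive {d : ℕ} (M : Matrix (Fin d) (Fin d) ℝ) : Prop :=
  ∀ (k : ℕ) (I J : Fin k ↪o Fin d), 0 < (M.submatrix I J).det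

/-- All minors are non-negative. -/
def Matrix.IsTotallyNonneg {d : ℕ} (M : Matrix (Fin d) (Fin d) ℝ) : Prop :=
  ∀ (k : ℕ) (I J : Fin k ↪o Fin d), 0 ≤ (M.submatrix I J).det

/-- Totally non-negative unipotent upper triangular matrices. -/
def unipotentNonneg (d : ℕ) : Set (Matrix (Fin d) (Fin d) ℝ) :=
  {M | (∀ i, M i i = 1) ∧ (∀ i j, j < i → M i j = 0) ∧ M.IsTotallyNonneg}

/-- The minor with rows `I` and columns `J` is an upper minor if it is non-zero for some totally
non-negative unipotent upper triangular matrix. -/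
def IsUpperMinor {d k : ℕ} (I J : Fin k ↪o Fin d) : Prop :=
  ∃ M ∈ unipotentNonneg d, (M.submatrix I J).det ≠ 0

/-- Totally non-negative unipotent upper triangular matrices, all of whose upper minors are
positive. -/
def unipotentPos (d : ℕ) : Set (Matrix (Fin d) (Fin d) ℝ) :=
  {M | M ∈ unipotentNonneg d ∧
    ∀ (k : ℕ) (I J : Fin k ↪o Fin d), IsUpperMinor I J → 0 < (M.submatrix I J).det}

/-- A transverse quadruple `(a,x,y,b)` of flags is positive if, for some basis `e` consistent with
`(a,b)`, there are `u₁, u₂` whose matrices in the basis `e` lie in `unipotentPos d`, such that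
`y = u₁(b)` and `x = u₁ u₂(b)`. -/
def IsPositiveQuadruple {d : ℕ} (a x y b : FullFlag d) : Prop :=
  FullFlag.IsTransverse ![a, x, y, b] ∧
  ∃ e : Module.Basis (Fin d) ℝ (EuclideanSpace ℝ (Fin d)), FullFlag.IsConsistent a b e ∧
    ∃ M₁ ∈ unipotentPos d, ∃ M₂ ∈ unipotentPos d,
      FullFlag.IsImage (Matrix.toLin e e M₁) b y ∧
      FullFlag.IsImage (Matrix.toLin e e M₁ ∘ₗ Matrix.toLin e e M₂) b x

/-! ### The conclusions -/

/-- Any `d` of the `2d` lines `L_1(a,b), …, L_d(a,b), L_1(x,y), …, L_d(x,y)` are in general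
position, that is, `ℝ^d` is their direct sum. -/
def LinesInGeneralPosition {d : ℕ} (a x y b : FullFlag d) : Prop :=
  ∀ S : Finset (Fin d ⊕ Fin d), S.card = d →
    DirectSum.IsInternal
      (fun s : S => Sum.elim (FullFlag.line a b) (FullFlag.line x y) s.1)

/-- For suitable bases `e` consistent with `(a,b)` and `f` consistent with `(x,y)`, the matrix `A`
with `f_j = ∑ i, A i j • e_i` is totally positive. -/
def HasTotallyPositiveBaseChange {d : ℕ} (a x y b : FullFlag d) : Prop :=
  ∃ e f : Module.Basis (Fin d) ℝ (EuclideanSpace ℝ (Fin d)),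
    FullFlag.IsConsistent a b e ∧ FullFlag.IsConsistent x y f ∧
      (e.toMatrix f).IsTotallyPositive

/-! ### Hitchin representations -/

/-- The fundamental group `⟨a_1, b_1, …, a_g, b_g | [a_1,b_1]⋯[a_g,b_g]⟩` of the closed orientable
surface of genus `g`; the generators `a_i`, `b_i` are `(i, false)`, `(i, true)`. -/
abbrev SurfaceGroup (g : ℕ) : Type :=
  PresentedGroup ({(List.ofFn fun i : Fin g =>
    FreeGroup.of (i, false) * FreeGroup.of (i, true) *
      (FreeGroup.of (i, false))⁻¹ * (FreeGroup.of (i, true))⁻¹).prod} : Set (FreeGroup (Fin g × Bool)))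

/-- Discrete and faithful representations into `PSL(2, ℝ)`. -/
def IsFuchsian {g : ℕ} (ρ : SurfaceGroup g →* PSL(2, ℝ)) : Prop :=
  Function.Injective ρ ∧ DiscreteTopology ρ.range

/-- The matrix of the `(d-1)`-st symmetric power of `A = !![p, q; r, s]`. On binary forms in
`e₁, e₂`, it sends `e₁^(d-1-j) e₂^j` to `(p e₁ + r e₂)^(d-1-j) (q e₁ + s e₂)^j`, and the entry
`(i, j)` is the coefficient of `e₁^(d-1-i) e₂^i` (in the code `e₁ = 1` and `e₂ = X`). -/
def symPowMatrix (d : ℕ) (A : SL(2, ℝ)) : Matrix (Fin d) (Fin d) ℝ :=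
  Matrix.of fun i j =>
    ((Polynomial.C (A 0 0) + Polynomial.C (A 1 0) * Polynomial.X) ^ (d - 1 - (j : ℕ)) *
      (Polynomial.C (A 0 1) + Polynomial.C (A 1 1) * Polynomial.X) ^ (j : ℕ)).coeff i

/-- `σ` is `τ ∘ ρ₀` for a Fuchsian representation `ρ₀` and an irreducible representation
`τ : PSL(2, ℝ) → PSL(d, ℝ)`; the latter is the symmetric power representation up to conjugation
by some `P ∈ GL(d, ℝ)`. -/
def IsDFuchsian {g d : ℕ} (σ : SurfaceGroup g →* PSL(d, ℝ)) : Prop :=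
  ∃ ρ₀ : SurfaceGroup g →* PSL(2, ℝ), IsFuchsian ρ₀ ∧ ∃ P : GL (Fin d) ℝ,
    ∀ (γ : SurfaceGroup g) (A : SL(2, ℝ)), (QuotientGroup.mk A : PSL(2, ℝ)) = ρ₀ γ →
      ∃ B : SL(d, ℝ), (QuotientGroup.mk B : PSL(d, ℝ)) = σ γ ∧
        (B : Matrix (Fin d) (Fin d) ℝ) =
          (P : Matrix (Fin d) (Fin d) ℝ) * symPowMatrix d A *
            ((P⁻¹ : GL (Fin d) ℝ) : Matrix (Fin d) (Fin d) ℝ)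

/-- Representations that can be continuously deformed to a `d`-Fuchsian representation. -/
def IsHitchin {g d : ℕ} (ρ : SurfaceGroup g →* PSL(d, ℝ)) : Prop :=
  ∃ F : unitInterval → (SurfaceGroup g →* PSL(d, ℝ)),
    (∀ γ, Continuous fun t => F t γ) ∧ F 0 = ρ ∧ IsDFuchsian (F 1)

/-! ### Limit maps

The boundary at infinity of the surface group is identified, through the action given by a Fuchsian
representation `j`, with the boundary `P¹(ℝ) = OnePoint ℝ` of the hyperbolic plane. -/

/-- `z` is an attracting fixed point of the projective transformation `A` of `P¹(ℝ)`. -/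
def IsAttractingFixedPoint (A : GL (Fin 2) ℝ) (z : OnePoint ℝ) : Prop :=
  A • z = z ∧ ∀ᶠ w in 𝓝 z, Filter.Tendsto (fun n : ℕ => A ^ n • w) Filter.atTop (𝓝 z)

/-- `B` has `d` eigenvalues of distinct modulus, and `f` is its attracting flag: `f^i` is spanned by
eigenvectors for the `i` eigenvalues of largest modulus. -/
def IsLoxodromicWithFlag {d : ℕ} (B : Matrix (Fin d) (Fin d) ℝ) (f : FullFlag d) : Prop :=
  ∃ (ev : Fin d → ℝ) (e : Module.Basis (Fin d) ℝ (EuclideanSpace ℝ (Fin d))),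
    StrictAnti (fun i => |ev i|) ∧ (∀ i, Matrix.toEuclideanLin B (e i) = ev i • e i) ∧
      ∀ i, f.sub i = Submodule.span ℝ (e '' {k | (k : ℕ) < (i : ℕ)})

/-- `ξ` is the limit map of the representation `ρ`, the boundary of the surface group being
identified with `P¹(ℝ)` through the Fuchsian representation `j`: the continuous `ρ`-equivariant
map that is proximal and hyperconvex. Elements of `PSL` act through arbitrary lifts to `SL`. -/
structure IsLimitMap {g d : ℕ} (j : SurfaceGroup g →* PSL(2, ℝ))
    (ρ : SurfaceGroup g →* PSL(d, ℝ)) (ξ : OnePoint ℝ → FullFlag d) : Prop where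
  continuous : Continuous ξ
  equivariant : ∀ (γ : SurfaceGroup g) (A : SL(2, ℝ)) (B : SL(d, ℝ)),
    (QuotientGroup.mk A : PSL(2, ℝ)) = j γ → (QuotientGroup.mk B : PSL(d, ℝ)) = ρ γ →
    ∀ z, FullFlag.IsImage (Matrix.toEuclideanLin (B : Matrix (Fin d) (Fin d) ℝ))
      (ξ z) (ξ ((A : GL (Fin 2) ℝ) • z))
  proximal : ∀ (γ : SurfaceGroup g) (A : SL(2, ℝ)) (B : SL(d, ℝ)), γ ≠ 1 →
    (QuotientGroup.mk A : PSL(2, ℝ)) = j γ → (QuotientGroup.mk B : PSL(d, ℝ)) = ρ γ →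
    ∀ z, IsAttractingFixedPoint (A : GL (Fin 2) ℝ) z →
      IsLoxodromicWithFlag (B : Matrix (Fin d) (Fin d) ℝ) (ξ z)
  hyperconvex : ∀ (n : ℕ) (z : Fin n → OnePoint ℝ), Function.Injective z →
    FullFlag.IsTransverse (fun k => ξ (z k))

/-- The four points of `P¹(ℝ)` are pairwise distinct and in cyclic order, for one of the two
orientations: a projective transformation takes them to an increasing sequence of reals. -/
def IsCyclicallyOrdered (z : Fin 4 → OnePoint ℝ) : Prop :=
  ∃ (h : GL (Fin 2) ℝ) (t : Fin 4 → ℝ), StrictMono t ∧ ∀ k, h • z k = (t k : OnePoint ℝ)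

end

/-! Choose a vector on each of the `2d` lines and list them as L_1(a,b), …, L_d(a,b), L_d(x,y), …,
L_1(x,y). Both conclusions follow once, for suitable vectors, every `d` of them, taken in this
order, have a determinant of one common sign. General position is then immediate. A minor of the
base change matrix is the determinant of the basis (e_i) with some e_i replaced by some f_j, hence
one of these determinants up to a sign, and alternating the signs of the e_i makes that sign the
same for all minors (`exists_isTotallyPositive_toMatrix`).

For sorted indices a < c < e < f the three-term Plücker relation reads [ac][ef] + [ce][af] =
[ae][cf], without minus signs. So if the four outer determinants have the common sign, then [ae] has
it if and only if [cf] does. A nested induction (`PluckerClosed.forall_subset`) deduces the sign of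
every `d`-tuple from index sets consisting of a few intervals. The determinants of the latter are
positive multiples of determinants of three blocks of frame vectors of the flags (a,b,y) or (a,y,x),
because consecutive lines of L(a,b) span steps of `a` or of `b` (`exists_isPositiveOn`). It
therefore suffices that these two triples are positive with the same sign.

For a positive quadruple, the triple determinants are, up to positive factors and a fixed sign,
minors of the two totally non-negative matrices. They are non-negative, and transversality makes
them non-zero.

For a limit map, hyperconvexity makes the determinants of blocks of sizes i, j, k at increasing
parameters, completed by lines ξ^1 at further parameters, non-zero. Increasing parameters form a
connected set, so each type (i,j,k) has a constant sign. To compare types, move a block to the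
attracting fixed point of a hyperbolic element. Along an orbit converging to this point, the line
ξ^1 approaches the next direction of the flag modulo the earlier ones, up to a sign which is
independent of the linear form used as a test and can be absorbed into the frame
(`exists_sign_of_orbit`, `exists_forall_det_cat3_pos`). -/

open scoped MatrixGroups Topology

noncomputable section

/-! ### Signed determinants and the three-term Plücker relation -/

section Plucker

variable {V : Type*} [AddCommGroup V] [Module ℝ V]

/-- Cramer's rule expands `det v • x` in the vectors `v l`. Inserted in slot `i` of `v` with `y` in
slot `j`, every term with `l` other than `i`, `j` repeats a vector and vanishes; the term `l = j` is
a transposition of two arguments. -/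
theorem Module.Basis.det_mul_det_update_update {n : Type*} [Fintype n] [DecidableEq n]
    (b : Module.Basis n ℝ V) (v : n → V) {i j : n} (hij : i ≠ j) (x y : V) :
    b.det v * b.det (Function.update (Function.update v i x) j y) =
      b.det (Function.update v i x) * b.det (Function.update v j y) -
        b.det (Function.update v j x) * b.det (Function.update v i y) := by
  have key : b.det v • x = ∑ l, b.det (Function.update v l x) • v l := by
    apply b.repr.injective
    ext m
    have h := congrFun (Matrix.mulVec_cramer (b.toMatrix v) (b.repr x)) m
    simp only [Matrix.mulVec, dotProduct, Matrix.cramer_apply, ← Module.Basis.toMatrix_update,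
      Pi.smul_apply, smul_eq_mul, ← Module.Basis.det_apply] at h
    simp only [map_smul, map_sum, Finsupp.smul_apply, Finsupp.coe_finsetSum, Finset.sum_apply,
      smul_eq_mul]
    rw [← h]
    exact Finset.sum_congr rfl fun l _ => by rw [Module.Basis.toMatrix_apply, mul_comm]
  have h1 := congrArg (fun z => b.det (Function.update (Function.update v j y) i z)) key
  simp only [AlternatingMap.map_update_smul, AlternatingMap.map_update_sum, smul_eq_mul] at h1
  rw [Function.update_comm hij, h1, Finset.sum_eq_add i j hij]
  · have h2 : Function.update (Function.update v j y) i (v i) = Function.update v j y := by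
      rw [Function.update_comm hij.symm, Function.update_eq_self]
    have h3 : b.det (Function.update (Function.update v j y) i (v j)) =
        - b.det (Function.update v i y) := by
      rw [← AlternatingMap.map_swap _ _ hij]
      congr 1
      ext l
      by_cases h : l = i
      · subst h; simp [hij.symm]
      · by_cases h' : l = j
        · subst h'; simp [hij.symm]
        · simp [h, h', Equiv.swap_apply_of_ne_of_ne]
    rw [h2, h3]; ring
  · intro l _ hl
    have : b.det (Function.update (Function.update v j y) i (v l)) = 0 :=
      AlternatingMap.map_eq_zero_of_eq _ _ (by simp [hl.1, hl.2]) hl.1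
    rw [this, mul_zero]
  · simp
  · simp

/-- The determinant of `u ∘ p`, multiplied by the Vandermonde determinant of `p`. It does not
depend on the order of the entries of `p`, and has the sign of the determinant of `u ∘ p` if `p`
is increasing. -/
def signedDet {d : ℕ} (b : Module.Basis (Fin d) ℝ V) (u : ℕ → V) (p : Fin d → ℕ) : ℝ :=
  b.det (fun i => u (p i)) * (Matrix.vandermonde fun i => (p i : ℝ)).det

theorem signedDet_comp_perm {d : ℕ} (b : Module.Basis (Fin d) ℝ V) (u : ℕ → V) (p : Fin d → ℕ)
    (σ : Equiv.Perm (Fin d)) : signedDet b u (fun i => p (σ i)) = signedDet b u p := by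
  have h1 : b.det (fun i => u (p (σ i))) = Equiv.Perm.sign σ • b.det (fun i => u (p i)) :=
    AlternatingMap.map_perm b.det (fun i => u (p i)) σ
  have h2 : (Matrix.vandermonde fun i => ((p (σ i) : ℕ) : ℝ)).det =
      Equiv.Perm.sign σ * (Matrix.vandermonde fun i => (p i : ℝ)).det :=
    Matrix.det_permute σ (Matrix.vandermonde fun i => (p i : ℝ))
  rw [signedDet, signedDet, h1, h2]
  rcases Int.units_eq_one_or (Equiv.Perm.sign σ) with h | h <;> simp [h]

theorem det_vandermonde_pos {d : ℕ} {p : Fin d → ℕ} (hp : StrictMono p) :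
    0 < (Matrix.vandermonde fun i => (p i : ℝ)).det := by
  rw [Matrix.det_vandermonde]
  refine Finset.prod_pos fun i _ => Finset.prod_pos fun j hj => ?_
  rw [sub_pos, Nat.cast_lt]
  exact hp (Finset.mem_Ioi.1 hj)

theorem det_vandermonde_cons {n : ℕ} (a : ℕ) (p : Fin n → ℕ) :
    (Matrix.vandermonde fun i => ((Fin.cons a p : Fin (n + 1) → ℕ) i : ℝ)).det =
      (∏ i, ((p i : ℝ) - a)) * (Matrix.vandermonde fun i => (p i : ℝ)).det := by
  rw [Matrix.det_vandermonde, Matrix.det_vandermonde, Fin.prod_univ_succ]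
  simp [Fin.prod_Ioi_succ]

/-- The `u i` with `i ∈ S`, in increasing order, have a determinant of the sign of `κ`. -/
def IsPositiveOn {d : ℕ} (b : Module.Basis (Fin d) ℝ V) (κ : ℝ) (u : ℕ → V) (S : Finset ℕ) :
    Prop :=
  ∀ p : Fin d → ℕ, Function.Injective p → Finset.univ.image p = S → 0 < κ * signedDet b u p

theorem signedDet_eq_of_image_eq {d : ℕ} (b : Module.Basis (Fin d) ℝ V) (u : ℕ → V)
    {p q : Fin d → ℕ} (hp : Function.Injective p) (hq : Function.Injective q)
    (hpq : Finset.univ.image q = Finset.univ.image p) : signedDet b u q = signedDet b u p := by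
  have hr : Set.range q = Set.range p := by
    have := congrArg (fun s : Finset ℕ => (s : Set ℕ)) hpq
    simpa using this
  let σ : Equiv.Perm (Fin d) :=
    ((Equiv.ofInjective q hq).trans (Equiv.setCongr hr)).trans (Equiv.ofInjective p hp).symm
  have hσ : q = fun i => p (σ i) := by
    ext i
    have := Equiv.apply_ofInjective_symm hp
      (((Equiv.ofInjective q hq).trans (Equiv.setCongr hr)) i)
    exact this.symm
  rw [hσ, signedDet_comp_perm]

theorem IsPositiveOn.of_enumeration {d : ℕ} {b : Module.Basis (Fin d) ℝ V} {κ : ℝ} {u : ℕ → V}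
    {p : Fin d → ℕ} (hp : Function.Injective p) (h : 0 < κ * signedDet b u p) :
    IsPositiveOn b κ u (Finset.univ.image p) := by
  intro q hq hpq
  rw [signedDet_eq_of_image_eq b u hp hq hpq]
  exact h

/-- The Vandermonde factor of (x, y, r) is `y - x` times a factor of `x`, a factor of `y` and one of
`r`. Hence all three products of the Plücker relation carry the same extra factor, up to positive
differences such as `(c - a) * (f - e)`, and the relation exhibits the middle product as a sum of
two positive ones. -/
theorem signedDet_plucker_pos {n : ℕ} (b : Module.Basis (Fin (n + 2)) ℝ V) (κ : ℝ) (u : ℕ → V)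
    (r : Fin n → ℕ) {a c e f : ℕ} (hac : a < c) (hce : c < e) (hef : e < f) 
    (h1 : 0 < κ * signedDet b u (Fin.cons a (Fin.cons c r)))
    (h2 : 0 < κ * signedDet b u (Fin.cons e (Fin.cons f r)))
    (h3 : 0 < κ * signedDet b u (Fin.cons a (Fin.cons f r)))
    (h4 : 0 < κ * signedDet b u (Fin.cons c (Fin.cons e r))) :
    0 < (κ * signedDet b u (Fin.cons a (Fin.cons e r))) *
      (κ * signedDet b u (Fin.cons c (Fin.cons f r))) := by
  set N : ℕ → ℕ → ℝ := fun x y => b.det (Fin.cons (u x) (Fin.cons (u y) fun i => u (r i))) with hN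
  set g : ℕ → ℝ := fun x => ∏ i, ((r i : ℝ) - x) with hg
  set W : ℝ := (Matrix.vandermonde fun i => (r i : ℝ)).det with hW
  have hs : ∀ x y, signedDet b u (Fin.cons x (Fin.cons y r)) =
      N x y * (((y : ℝ) - x) * (g x * g y * W)) := by
    intro x y
    rw [signedDet, det_vandermonde_cons, det_vandermonde_cons, Fin.prod_univ_succ]
    simp only [Fin.cons_zero, Fin.cons_succ]
    have : (fun i => u ((Fin.cons x (Fin.cons y r : Fin (n + 1) → ℕ) : Fin (n + 2) → ℕ) i)) =
        (Fin.cons (u x) (Fin.cons (u y) fun i => u (r i)) : Fin (n + 2) → V) := by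
      ext i
      refine Fin.cases ?_ (fun i => ?_) i
      · simp
      · refine Fin.cases ?_ (fun i => ?_) i <;> simp
    rw [this]
    simp only [hN, hg, hW]
    ring
  have hP : N a c * N e f = N a e * N c f - N c e * N a f := by
    have hu0 : ∀ x y z : V, Function.update (Fin.cons x (Fin.cons y fun i => u (r i)) :
        Fin (n + 2) → V) 0 z = Fin.cons z (Fin.cons y fun i => u (r i)) := by
      intro x y z; simp
    have hu1 : ∀ x y z : V, Function.update (Fin.cons x (Fin.cons y fun i => u (r i)) :
        Fin (n + 2) → V) 1 z = Fin.cons x (Fin.cons z fun i => u (r i)) := by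
      intro x y z
      rw [← Fin.succ_zero_eq_one, ← Fin.cons_update, Fin.update_cons_zero]
    have h := b.det_mul_det_update_update (Fin.cons (u a) (Fin.cons (u c) fun i => u (r i)))
      (i := 0) (j := 1) (by simp) (u e) (u f)
    simp only [hu0, hu1] at h
    have hsw : ∀ x y, N x y = - N y x := by
      intro x y
      have := AlternatingMap.map_swap b.det (Fin.cons (u y) (Fin.cons (u x) fun i => u (r i)))
        (i := 0) (j := 1) (by simp)
      rw [← this]
      simp only [hN]
      congr 1
      ext i
      refine Fin.cases ?_ (fun i => ?_) i
      · simp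
      · refine Fin.cases ?_ (fun i => ?_) i
        · simp
        · have : (Equiv.swap (0 : Fin (n + 2)) 1) i.succ.succ = i.succ.succ :=
            Equiv.swap_apply_of_ne_of_ne (by simp) (by simp [Fin.ext_iff])
          simp [this]
    have h' : N a c * N e f = N e c * N a f - N a e * N f c := h
    rw [h', hsw e c, hsw f c]; ring
  rw [hs] at h1 h2 h3 h4 ⊢
  rw [hs]
  have c1 : (0 : ℝ) < (c : ℝ) - a := by rw [sub_pos, Nat.cast_lt]; omega
  have c2 : (0 : ℝ) < (f : ℝ) - e := by rw [sub_pos, Nat.cast_lt]; omega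
  have c3 : (0 : ℝ) < (f : ℝ) - a := by rw [sub_pos, Nat.cast_lt]; omega
  have c4 : (0 : ℝ) < (e : ℝ) - c := by rw [sub_pos, Nat.cast_lt]; omega
  have c5 : (0 : ℝ) < (e : ℝ) - a := by rw [sub_pos, Nat.cast_lt]; omega
  have c6 : (0 : ℝ) < (f : ℝ) - c := by rw [sub_pos, Nat.cast_lt]; omega
  have aux : ∀ A X s : ℝ, 0 < s → 0 < κ * (A * (s * X)) → 0 < κ * X * A := by
    intro A X s hs h
    have : κ * (A * (s * X)) = s * (κ * X * A) := by ring
    rw [this] at h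
    exact pos_of_mul_pos_right h hs.le
  have k1 := mul_pos (aux _ _ _ c1 h1) (aux _ _ _ c2 h2)
  have k2 := mul_pos (aux _ _ _ c3 h3) (aux _ _ _ c4 h4)
  have k3 : 0 < (κ * κ * (g a * g e * W) * (g c * g f * W)) * (N a e * N c f) := by
    have : N a e * N c f = N a c * N e f + N c e * N a f := by rw [hP]; ring
    rw [this]
    nlinarith
  have k4 := mul_pos (mul_pos c5 c6) k3
  nlinarith

theorem IsPositiveOn.plucker {d : ℕ} {b : Module.Basis (Fin d) ℝ V} {κ : ℝ} {u : ℕ → V}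
    {T : Finset ℕ} (hT : T.card + 2 = d) {a c e f : ℕ} (hac : a < c) (hce : c < e) (hef : e < f)
    (ha : a ∉ T) (hc : c ∉ T) (he : e ∉ T) (hf : f ∉ T)
    (h1 : IsPositiveOn b κ u (insert a (insert c T)))
    (h2 : IsPositiveOn b κ u (insert e (insert f T)))
    (h3 : IsPositiveOn b κ u (insert a (insert f T)))
    (h4 : IsPositiveOn b κ u (insert c (insert e T))) :
    IsPositiveOn b κ u (insert a (insert e T)) ↔ IsPositiveOn b κ u (insert c (insert f T)) := by
  subst hT
  let r : Fin T.card → ℕ := T.orderEmbOfFin rfl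
  have hr : Finset.univ.image r = T := by
    ext x
    have : x ∈ Set.range r ↔ x ∈ (T : Set ℕ) := by rw [Finset.range_orderEmbOfFin]
    simpa using this
  have hri : Function.Injective r := (T.orderEmbOfFin rfl).injective
  have hrm : ∀ i, r i ∈ T := fun i => Finset.orderEmbOfFin_mem _ _ _
  have inj : ∀ x y, x < y → x ∉ T → y ∉ T → Function.Injective
      (Fin.cons x (Fin.cons y r) : Fin (T.card + 2) → ℕ) := by
    intro x y hxy hx hy
    rw [Fin.cons_injective_iff, Fin.cons_injective_iff]
    refine ⟨?_, ?_, hri⟩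
    · rintro ⟨i, hi⟩
      revert hi
      refine Fin.cases ?_ (fun i => ?_) i
      · simp; omega
      · simp only [Fin.cons_succ]; rintro rfl; exact hx (hrm i)
    · rintro ⟨i, rfl⟩; exact hy (hrm i)
  have img : ∀ x y, Finset.univ.image (Fin.cons x (Fin.cons y r) : Fin (T.card + 2) → ℕ) =
      insert x (insert y T) := by
    intro x y
    ext z
    have hz : z ∈ T ↔ ∃ i, r i = z := by
      conv_lhs => rw [← hr]
      simp
    simp [Fin.exists_fin_succ, hz, eq_comm]
  have tr : ∀ x y, x < y → x ∉ T → y ∉ T → (IsPositiveOn b κ u (insert x (insert y T)) ↔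
      0 < κ * signedDet b u (Fin.cons x (Fin.cons y r))) := by
    intro x y hxy hx hy
    refine ⟨fun h => h _ (inj x y hxy hx hy) (img x y), fun h => ?_⟩
    rw [← img]
    exact IsPositiveOn.of_enumeration (inj x y hxy hx hy) h
  rw [tr _ _ (by omega) (by assumption) (by assumption)] at h1 h2 h3 h4
  rw [tr _ _ (by omega) (by assumption) (by assumption),
    tr _ _ (by omega) (by assumption) (by assumption)]
  have h := signedDet_plucker_pos b κ u r hac hce hef h1 h2 h3 h4
  exact ⟨fun h' => (pos_iff_pos_of_mul_pos h).1 h', fun h' => (pos_iff_pos_of_mul_pos h).2 h'⟩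

end Plucker

/-! ### Propagation of positivity -/

section Propagation

/-- A family of `d`-element sets of natural numbers that is closed under solving the three-term
Plücker relation for a factor of its middle term. -/
def PluckerClosed (d : ℕ) (P : Finset ℕ → Prop) : Prop :=
  ∀ (T : Finset ℕ) (a c e f : ℕ), T.card + 2 = d → a < c → c < e → e < f →
    a ∉ T → c ∉ T → e ∉ T → f ∉ T →
    P (insert a (insert c T)) → P (insert e (insert f T)) → P (insert a (insert f T)) →
    P (insert c (insert e T)) → (P (insert a (insert e T)) ↔ P (insert c (insert f T)))

variable {d : ℕ} {P : Finset ℕ → Prop}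

/-- Induction on `i`, then on the length of a window containing all gaps of `S` in `[d, 2d)`.
Trading an element of `S` between two extreme gaps for one of these gaps shrinks the window; all
other terms of the Plücker relation only contain `range i`. -/
theorem PluckerClosed.of_range_union (hP : PluckerClosed d P)
    (h2 : ∀ i k l, i + k + l = d →
      P (Finset.range i ∪ (Finset.Ico d (d + k) ∪ Finset.Ico (2 * d - l) (2 * d)))) :
    ∀ i ≤ d, ∀ S ⊆ Finset.Ico d (2 * d), S.card + i = d → P (Finset.range i ∪ S) := by
  intro i
  induction i with
  | zero =>
    intro _ S hS hc
    have : S = Finset.Ico d (d + d) ∪ Finset.Ico (2 * d - 0) (2 * d) := by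
      rw [Finset.eq_of_subset_of_card_le hS (by simp; omega)]
      ext x; simp; omega
    rw [this]
    exact h2 0 d 0 (by omega)
  | succ i ih =>
    intro hi
    -- The window `[lo, lo + N)` contains all gaps. It cannot be empty, as `S` has fewer than `d`
    -- elements.
    suffices H : ∀ N lo : ℕ, ∀ S ⊆ Finset.Ico d (2 * d), S.card + (i + 1) = d →
        (∀ x ∈ Finset.Ico d (2 * d), x ∉ S → lo ≤ x ∧ x < lo + N) →
        P (Finset.range (i + 1) ∪ S) by
      intro S hS hc
      refine H (2 * d) 0 S hS hc fun x hx _ => ?_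
      simp at hx; omega
    intro N
    induction N with
    | zero =>
      intro lo S hS hc h
      have : Finset.Ico d (2 * d) ⊆ S := fun x hx => by
        by_contra hxS
        have := h x hx hxS
        omega
      have := Finset.card_le_card this
      simp at this; omega
    | succ N ihN =>
      intro lo S hS hc h
      have hS' : ∀ x ∈ S, d ≤ x ∧ x < 2 * d := fun x hx => by simpa using hS hx
      by_cases h1 : lo ∈ S ∨ lo < d ∨ 2 * d ≤ lo
      · refine ihN (lo + 1) S hS hc fun x hx hxS => ?_
        have hx' := h x hx hxS
        have : x ≠ lo := by
          rintro rfl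
          simp at hx
          rcases h1 with h1 | h1 | h1
          · exact hxS h1
          all_goals omega
        omega
      by_cases h1' : lo + N ∈ S ∨ lo + N < d ∨ 2 * d ≤ lo + N
      · refine ihN lo S hS hc fun x hx hxS => ?_
        have hx' := h x hx hxS
        have : x ≠ lo + N := by
          rintro rfl
          simp at hx
          rcases h1' with h1 | h1 | h1
          · exact hxS h1
          all_goals omega
        omega
      push Not at h1 h1'
      by_cases h3 : ∃ m, lo < m ∧ m < lo + N ∧ m ∈ S
      · obtain ⟨m, hm1, hm2, hmS⟩ := h3
        have hm := hS' m hmS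
        have hiS : ∀ x ≤ i, x ∉ S := fun x hx hxS => by
          have := hS' x hxS; omega
        set T := Finset.range i ∪ S.erase m with hT
        have hdisj : Disjoint (Finset.range i) (S.erase m) := by
          rw [Finset.disjoint_left]
          intro x hx hx'
          exact hiS x (by simp at hx; omega) (Finset.mem_of_mem_erase hx')
        have hTc : T.card + 2 = d := by
          rw [hT, Finset.card_union_of_disjoint hdisj, Finset.card_erase_of_mem hmS]
          have : 0 < S.card := Finset.card_pos.2 ⟨m, hmS⟩
          simp only [Finset.card_range]; omega
        have step : ∀ x y, x ∈ Finset.Ico d (2 * d) → y ∈ Finset.Ico d (2 * d) → x ∉ S.erase m →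
            y ∉ S.erase m → x ≠ y → P (insert x (insert y T)) := by
          intro x y hx hy hxS hyS hxy
          have e1 : insert x (insert y T) = Finset.range i ∪ insert x (insert y (S.erase m)) := by
            rw [hT]; ext z; simp
          rw [e1]
          refine ih (by omega) _ ?_ ?_
          · intro z hz
            simp only [Finset.mem_insert] at hz
            rcases hz with rfl | rfl | hz
            · exact hx
            · exact hy
            · exact hS (Finset.mem_of_mem_erase hz)
          · rw [Finset.card_insert_of_notMem (by simp [hxy]; simpa using hxS),
              Finset.card_insert_of_notMem hyS, Finset.card_erase_of_mem hmS]
            have : 0 < S.card := Finset.card_pos.2 ⟨m, hmS⟩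
            omega
        have step2 : ∀ x, x ∈ Finset.Ico d (2 * d) → x ∉ S → ∀ lo',
            (∀ z ∈ Finset.Ico d (2 * d), (z ∉ S ∨ z = m) → z ≠ x → lo' ≤ z ∧ z < lo' + N) →
            P (insert i (insert x T)) := by
          intro x hx hxS lo' hlo
          have e1 : insert i (insert x T) = Finset.range (i + 1) ∪ insert x (S.erase m) := by
            rw [hT, Finset.range_add_one]; ext z; simp; tauto
          rw [e1]
          refine ihN lo' _ ?_ ?_ ?_
          · intro z hz
            simp only [Finset.mem_insert] at hz
            rcases hz with rfl | hz
            · exact hx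
            · exact hS (Finset.mem_of_mem_erase hz)
          · rw [Finset.card_insert_of_notMem (by simp [hxS]), Finset.card_erase_of_mem hmS]
            have : 0 < S.card := Finset.card_pos.2 ⟨m, hmS⟩
            omega
          · intro z hz hz'
            simp only [Finset.mem_insert, Finset.mem_erase, not_or, not_and] at hz'
            refine hlo z hz ?_ hz'.1
            by_cases hzm : z = m
            · exact Or.inr hzm
            · exact Or.inl (hz'.2 hzm)
        have e2 : Finset.range (i + 1) ∪ S = insert i (insert m T) := by
          rw [hT]; ext z
          by_cases hz : z = m
          · subst hz; simp [hmS]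
          · rw [Finset.range_add_one]; simp [hz]
        rw [e2]
        have mlo : lo ∈ Finset.Ico d (2 * d) := by simp; omega
        have mhi : lo + N ∈ Finset.Ico d (2 * d) := by simp; omega
        have mm : m ∈ Finset.Ico d (2 * d) := by simp; omega
        have nlo : lo ∉ S.erase m := fun h => h1.1 (Finset.mem_of_mem_erase h)
        have nhi : lo + N ∉ S.erase m := fun h => h1'.1 (Finset.mem_of_mem_erase h)
        have nm : m ∉ S.erase m := by simp
        have hTm : ∀ x ∈ Finset.Ico d (2 * d), x ∉ S.erase m → x ∉ T := by
          intro x hx hx'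
          rw [hT, Finset.mem_union]
          simp at hx
          rintro (h | h)
          · simp at h; omega
          · exact hx' h
        -- Plücker with `i < lo < m < lo + N`: the pair (i, m) is the wanted set, (i, lo) and (i, lo
        -- + N) have a shorter window, and the three pairs without `i` fall under the induction on
        -- `i`.
        refine (hP T i lo m (lo + N) hTc (by simp at mlo; omega) hm1 hm2 ?_ (hTm _ mlo nlo)
          (hTm _ mm nm) (hTm _ mhi nhi) ?_ ?_ ?_ ?_).2 ?_
        · rw [hT, Finset.mem_union]
          rintro (h | h)
          · simp at h
          · exact hiS i le_rfl (Finset.mem_of_mem_erase h)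
        · refine step2 lo mlo h1.1 (lo + 1) fun z hz hz' hne => ?_
          rcases hz' with hz' | rfl
          · have := h z hz hz'; omega
          · omega
        · exact step m (lo + N) mm mhi nm nhi (by omega)
        · refine step2 (lo + N) mhi h1'.1 lo fun z hz hz' hne => ?_
          rcases hz' with hz' | rfl
          · have := h z hz hz'; omega
          · omega
        · exact step lo m mlo mm nlo nm (by omega)
        · exact step lo (lo + N) mlo mhi nlo nhi (by omega)
      · push Not at h3
        -- No element of `S` lies between the extreme gaps, so the gaps form an interval and `S` is
        -- an initial block together with a final block.
        have hSeq : S = Finset.Ico d (d + (lo - d)) ∪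
            Finset.Ico (2 * d - (2 * d - (lo + N + 1))) (2 * d) := by
          ext x
          simp only [Finset.mem_union, Finset.mem_Ico]
          constructor
          · intro hx
            have := hS' x hx
            by_contra hcon
            have hx1 : x ≠ lo := fun e => h1.1 (e ▸ hx)
            have hx2 : x ≠ lo + N := fun e => h1'.1 (e ▸ hx)
            exact h3 x (by omega) (by omega) hx
          · intro hx
            by_contra hxS
            have := h x (by simp; omega) hxS
            omega
        have hcard : S.card = (lo - d) + (2 * d - (lo + N + 1)) := by
          rw [hSeq, Finset.card_union_of_disjoint]
          · simp; omega
          · rw [Finset.disjoint_left]; intro x; simp; omega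
        rw [hSeq]
        exact h2 (i + 1) (lo - d) (2 * d - (lo + N + 1)) (by omega)

/-- Induction on the number `q = d - p` of elements outside an initial run `range p` of `S`, then on
the length of a window containing these elements. If they form an interval, `S` is one of the given
sets or is covered by `of_range_union`; otherwise the missing index `p` and an inner gap serve as
the two auxiliary indices of a Plücker relation. -/
theorem PluckerClosed.forall_subset (hP : PluckerClosed d P)
    (h1 : ∀ i j, i ≤ j → j ≤ d → P (Finset.range i ∪ Finset.Ico j (j + (d - i))))
    (h2 : ∀ i k l, i + k + l = d →
      P (Finset.range i ∪ (Finset.Ico d (d + k) ∪ Finset.Ico (2 * d - l) (2 * d)))) :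
    ∀ S ⊆ Finset.range (2 * d), S.card = d → P S := by
  suffices H : ∀ q p : ℕ, p + q = d → ∀ S ⊆ Finset.range (2 * d), S.card = d →
      Finset.range p ⊆ S → P S by
    intro S hS hc
    exact H d 0 (by omega) S hS hc (by simp)
  intro q
  induction q with
  | zero =>
    intro p hp S hS hc hpS
    have : S = Finset.range d ∪ Finset.Ico d (d + (d - d)) := by
      have e : p = d := by omega
      subst e
      rw [← Finset.eq_of_subset_of_card_le hpS (by simp [hc])]
      simp
    rw [this]
    exact h1 d d le_rfl le_rfl
  | succ q ih =>
    intro p hp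
    suffices H : ∀ N lo : ℕ, ∀ S ⊆ Finset.range (2 * d), S.card = d → Finset.range p ⊆ S →
        (∀ x ∈ S, p ≤ x → lo ≤ x ∧ x < lo + N) → P S by
      intro S hS hc hpS
      refine H (2 * d) 0 S hS hc hpS fun x hx _ => ?_
      have := hS hx
      simp at this; omega
    have hle : ∀ S : Finset ℕ, S.card = d → ∃ x ∈ S, p ≤ x := by
      intro S hc
      by_contra hcon
      push Not at hcon
      have : S ⊆ Finset.range p := fun x hx => by simpa using hcon x hx
      have := Finset.card_le_card this
      simp at this; omega
    intro N
    induction N with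
    | zero =>
      intro lo S hS hc hpS h
      obtain ⟨x, hx, hpx⟩ := hle S hc
      have := h x hx hpx
      omega
    | succ N ihN =>
      intro lo S hS hc hpS h
      have hS' : ∀ x ∈ S, x < 2 * d := fun x hx => by simpa using hS hx
      by_cases hpp : p ∈ S
      · refine ih (p + 1) (by omega) S hS hc fun x hx => ?_
        simp at hx
        rcases Nat.lt_or_ge x p with h' | h'
        · exact hpS (by simpa using h')
        · have : x = p := by omega
          exact this ▸ hpp
      by_cases ha : lo ∈ S ∧ p ≤ lo
      swap
      · refine ihN (lo + 1) S hS hc hpS fun x hx hpx => ?_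
        have := h x hx hpx
        have : x ≠ lo := by rintro rfl; exact ha ⟨hx, hpx⟩
        omega
      by_cases hb : lo + N ∈ S
      swap
      · refine ihN lo S hS hc hpS fun x hx hpx => ?_
        have := h x hx hpx
        have : x ≠ lo + N := by rintro rfl; exact hb hx
        omega
      obtain ⟨ha, hplo⟩ := ha
      have hplo' : p < lo := lt_of_le_of_ne hplo fun e => hpp (e ▸ ha)
      by_cases h3 : ∃ m, lo < m ∧ m < lo + N ∧ m ∉ S
      · obtain ⟨m, hm1, hm2, hmS⟩ := h3
        set T := (S.erase (lo + N)).erase lo with hT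
        have hlo' : lo ∈ S.erase (lo + N) := Finset.mem_erase.2 ⟨by omega, ha⟩
        have hTc : T.card + 2 = d := by
          rw [hT, Finset.card_erase_of_mem hlo', Finset.card_erase_of_mem hb]
          have : 1 < S.card := Finset.one_lt_card.2 ⟨lo, ha, lo + N, hb, by omega⟩
          omega
        have hmT : ∀ x, x ∈ T ↔ x ≠ lo ∧ x ≠ lo + N ∧ x ∈ S := by
          intro x; rw [hT]; simp
        have hpT : p ∉ T := by simp [hmT, hpp]
        have hmT' : m ∉ T := by simp [hmT, hmS]
        have hloT : lo ∉ T := by simp [hmT]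
        have hhiT : lo + N ∉ T := by simp [hmT]
        have hm2d : lo + N < 2 * d := hS' _ hb
        have hcard : ∀ x y, x ∉ T → y ∉ T → x ≠ y → (insert x (insert y T)).card = d := by
          intro x y hx hy hxy
          rw [Finset.card_insert_of_notMem (by simp [hxy, hx]), Finset.card_insert_of_notMem hy]
          omega
        have hsub : ∀ x y, x < 2 * d → y < 2 * d →
            insert x (insert y T) ⊆ Finset.range (2 * d) := by
          intro x y hx hy z hz
          simp only [Finset.mem_insert, hmT] at hz
          rcases hz with rfl | rfl | hz
          · simpa using hx
          · simpa using hy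
          · exact hS hz.2.2
        have hpsub : ∀ x y, Finset.range p ⊆ insert x (insert y T) := by
          intro x y z hz
          have hzS := hpS hz
          simp at hz
          simp only [Finset.mem_insert, hmT]
          exact Or.inr (Or.inr ⟨by omega, by omega, hzS⟩)
        have step : ∀ x, x < 2 * d → x ∉ T → p ≠ x → P (insert p (insert x T)) := by
          intro x hx hxT hpx
          refine ih (p + 1) (by omega) _ (hsub _ _ (by omega) hx) (hcard _ _ hpT hxT hpx) ?_
          rw [Finset.range_add_one]
          intro z hz
          rcases Finset.mem_insert.1 hz with rfl | hz
          · simp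
          · exact hpsub _ _ hz
        have hSe : S = insert lo (insert (lo + N) T) := by
          ext z
          simp only [Finset.mem_insert, hmT]
          constructor
          · intro hz; tauto
          · rintro (rfl | rfl | hz)
            · exact ha
            · exact hb
            · exact hz.2.2
        rw [hSe]
        -- Plücker with `p < lo < m < lo + N`: the pair (lo, lo + N) is `S`, pairs with `p` extend
        -- the initial run, and (m, lo + N), (lo, m) have a shorter window.
        refine (hP T p lo m (lo + N) hTc hplo' hm1 hm2 hpT hloT hmT' hhiT
          (step _ (by omega) hloT (by omega)) ?_ (step _ hm2d hhiT (by omega)) ?_).1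
          (step _ (by omega) hmT' (by omega))
        · refine ihN (lo + 1) _ (hsub _ _ (by omega) hm2d) (hcard _ _ hmT' hhiT (by omega))
            (hpsub _ _) fun z hz hpz => ?_
          simp only [Finset.mem_insert, hmT] at hz
          rcases hz with rfl | rfl | hz
          · omega
          · omega
          · have := h z hz.2.2 hpz; omega
        · refine ihN lo _ (hsub _ _ (by omega) (by omega)) (hcard _ _ hloT hmT' (by omega))
            (hpsub _ _) fun z hz hpz => ?_
          simp only [Finset.mem_insert, hmT] at hz
          rcases hz with rfl | rfl | hz
          · omega
          · omega
          · have := h z hz.2.2 hpz; omega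
      · push Not at h3
        have hSeq : S = Finset.range p ∪ Finset.Ico lo (lo + N + 1) := by
          ext x
          simp only [Finset.mem_union, Finset.mem_Ico, Finset.mem_range]
          constructor
          · intro hx
            by_cases hxp : x < p
            · exact Or.inl hxp
            · have := h x hx (by omega); omega
          · rintro (hx | hx)
            · exact hpS (by simpa using hx)
            · by_cases e1 : x = lo
              · exact e1 ▸ ha
              by_cases e2 : x = lo + N
              · exact e2 ▸ hb
              exact h3 x (by omega) (by omega)
        have hcard : p + (N + 1) = d := by
          rw [← hc, hSeq, Finset.card_union_of_disjoint]
          · simp; omega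
          · rw [Finset.disjoint_left]; intro x; simp; omega
        rw [hSeq]
        have eN : lo + N + 1 = lo + (d - p) := by omega
        rw [eN]
        rcases Nat.le_total lo d with hd | hd
        · exact h1 p lo hplo hd
        · refine hP.of_range_union h2 p (by omega) _ ?_ (by simp; omega)
          intro x hx
          have := hS' _ hb
          simp at hx ⊢; omega

end Propagation

/-! ### Determinants of concatenated frames -/

section Frames

variable {V : Type*} [AddCommGroup V] [Module ℝ V] {d : ℕ}

/-- The first `i` terms of `p`, then the first `j` terms of `q`, then the terms of `r`. -/
def cat3 {α : Type*} (i j : ℕ) (p q r : ℕ → α) : ℕ → α := fun t =>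
  if t < i then p t else if t < i + j then q (t - i) else r (t - i - j)

/-- The span of the first `i` terms of a sequence. -/
def initSpan (w : ℕ → V) (i : ℕ) : Submodule ℝ V := Submodule.span ℝ (Set.range fun l : Fin i => w l)

theorem mem_initSpan {w : ℕ → V} {l i : ℕ} (h : l < i) : w l ∈ initSpan w i :=
  Submodule.subset_span ⟨⟨l, h⟩, rfl⟩

theorem initSpan_mono (w : ℕ → V) {i j : ℕ} (h : i ≤ j) : initSpan w i ≤ initSpan w j := by
  refine Submodule.span_le.2 ?_
  rintro _ ⟨l, rfl⟩
  exact mem_initSpan (by omega)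

theorem mem_initSpan_iff {w : ℕ → V} {i : ℕ} {x : V} :
    x ∈ initSpan w i ↔ ∃ c : Fin i → ℝ, ∑ l, c l • w l = x :=
  Submodule.mem_span_range_iff_exists_fun ℝ

/-- An alternating map evaluated at linear combinations of the vectors `w l`. -/
theorem AlternatingMap.map_sum_smul {r : ℕ} (F : V [⋀^Fin r]→ₗ[ℝ] ℝ) (w : Fin r → V)
    (C : Matrix (Fin r) (Fin r) ℝ) : F (fun m => ∑ l, C m l • w l) = C.det * F w := by
  let φ : (Fin r → ℝ) →ₗ[ℝ] V := Fintype.linearCombination ℝ w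
  have h := (F.compLinearMap φ).eq_smul_basis_det (Pi.basisFun ℝ (Fin r))
  have h2 : (F.compLinearMap φ) (fun m => C m) =
      ((F.compLinearMap φ) (Pi.basisFun ℝ (Fin r)) • (Pi.basisFun ℝ (Fin r)).det) (fun m => C m) :=
    congrArg (fun G : (Fin r → ℝ) [⋀^Fin r]→ₗ[ℝ] ℝ => G fun m => C m) h
  have h3 : (Pi.basisFun ℝ (Fin r)).det (fun m => C m) = C.det := by
    rw [Module.Basis.det_apply, ← Matrix.det_transpose]
    rfl
  have h4 : (F.compLinearMap φ) (Pi.basisFun ℝ (Fin r)) = F w := by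
    rw [AlternatingMap.compLinearMap_apply]
    congr 1
    ext i
    simp [φ, Fintype.linearCombination_apply, Pi.single_apply]
  rw [AlternatingMap.smul_apply, h3, h4, smul_eq_mul, mul_comm] at h2
  exact h2

/-- The determinant as an alternating function of a block of its arguments. -/
def blockDet (b : Module.Basis (Fin d) ℝ V) (X : ℕ → V) (i r : ℕ) (h : i + r ≤ d) :
    V [⋀^Fin r]→ₗ[ℝ] ℝ :=
  have key : ∀ [DecidableEq (Fin r)] (v : Fin r → V) (m : Fin r) (x : V),
      (fun t : Fin d => if ht : i ≤ t ∧ t < i + r then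
        Function.update v m x ⟨t - i, by omega⟩ else X t) =
      Function.update (fun t : Fin d => if ht : i ≤ t ∧ t < i + r then
        v ⟨t - i, by omega⟩ else X t) ⟨i + m, by omega⟩ x := by
    intro _ v m x
    ext t
    by_cases h1 : t = ⟨i + m, by omega⟩
    · subst h1
      simp
    · rw [Function.update_of_ne h1]
      split_ifs with ht
      · rw [Function.update_of_ne]
        rintro rfl
        apply h1
        ext
        simp; omega
      · rfl
  { toFun := fun v => b.det fun t : Fin d =>
      if ht : i ≤ t ∧ t < i + r then v ⟨t - i, by omega⟩ else X t
    map_update_add' := fun v m x y => by simp only [key, AlternatingMap.map_update_add]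
    map_update_smul' := fun v m c x => by simp only [key, AlternatingMap.map_update_smul]
    map_eq_zero_of_eq' := fun v m m' hv hm => by
      refine b.det.map_eq_zero_of_eq _ (i := ⟨i + m, by omega⟩) (j := ⟨i + m', by omega⟩) ?_ ?_
      · simpa using hv
      · intro h; apply hm; ext; simpa using h }

theorem blockDet_apply (b : Module.Basis (Fin d) ℝ V) (X : ℕ → V) (i r : ℕ) (h : i + r ≤ d)
    (v : Fin r → V) : blockDet b X i r h v = b.det fun t : Fin d =>
      if ht : i ≤ t ∧ t < i + r then v ⟨t - i, by omega⟩ else X t := rfl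

variable (b : Module.Basis (Fin d) ℝ V)

theorem det_cat3_fst {i j : ℕ} (hij : i + j ≤ d) {p p' : ℕ → V} (q r : ℕ → V)
    (C : Matrix (Fin i) (Fin i) ℝ) (hC : ∀ m : Fin i, p m = ∑ l, C m l • p' l) :
    b.det (fun t : Fin d => cat3 i j p q r t) =
      C.det * b.det (fun t : Fin d => cat3 i j p' q r t) := by
  have h := (blockDet b (cat3 i j p q r) 0 i (by omega)).map_sum_smul (fun l => p' l) C
  simp only [← hC, blockDet_apply] at h
  convert h using 3
  · rename_i t
    simp only [cat3]
    split_ifs <;> first | rfl | omega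
  · ext t
    simp only [cat3]
    split_ifs <;> first | rfl | omega

theorem det_cat3_snd {i j : ℕ} (hij : i + j ≤ d) (p : ℕ → V) {q q' : ℕ → V} (r : ℕ → V)
    (C : Matrix (Fin j) (Fin j) ℝ) (hC : ∀ m : Fin j, q m = ∑ l, C m l • q' l) :
    b.det (fun t : Fin d => cat3 i j p q r t) =
      C.det * b.det (fun t : Fin d => cat3 i j p q' r t) := by
  have h := (blockDet b (cat3 i j p q r) i j (by omega)).map_sum_smul (fun l => q' l) C
  simp only [← hC, blockDet_apply] at h
  convert h using 3
  · rename_i t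
    simp only [cat3]
    split_ifs <;> first | rfl | omega
  · ext t
    simp only [cat3]
    split_ifs <;> first | rfl | omega

theorem det_cat3_thd {i j k : ℕ} (hij : i + j + k = d) (p q : ℕ → V) {r r' : ℕ → V}
    (C : Matrix (Fin k) (Fin k) ℝ) (hC : ∀ m : Fin k, r m = ∑ l, C m l • r' l) :
    b.det (fun t : Fin d => cat3 i j p q r t) =
      C.det * b.det (fun t : Fin d => cat3 i j p q r' t) := by
  have h := (blockDet b (cat3 i j p q r) (i + j) k (by omega)).map_sum_smul (fun l => r' l) C
  simp only [← hC, blockDet_apply] at h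
  convert h using 3
  · rename_i t
    simp only [cat3, Nat.sub_sub]
    split_ifs <;> first | rfl | omega
  · ext t
    simp only [cat3, Nat.sub_sub]
    split_ifs <;> first | rfl | omega

/-- Each term of `p` is congruent to the same term of `p'`, modulo the earlier terms of `p'`. -/
def UnitriangularTo (n : ℕ) (p p' : ℕ → V) : Prop := ∀ m < n, p m - p' m ∈ initSpan p' m

theorem UnitriangularTo.refl (n : ℕ) (p : ℕ → V) : UnitriangularTo n p p := fun m _ => by
  simp

theorem UnitriangularTo.exists_matrix {n : ℕ} {p p' : ℕ → V} (h : UnitriangularTo n p p') :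
    ∃ C : Matrix (Fin n) (Fin n) ℝ, C.det = 1 ∧ ∀ m : Fin n, p m = ∑ l, C m l • p' l := by
  have h' : ∀ m : Fin n, ∃ c : Fin m → ℝ, ∑ l, c l • p' l = p m - p' m := fun m =>
    mem_initSpan_iff.1 (h m m.2)
  choose c hc using h'
  refine ⟨Matrix.of fun m l => if hl : l < m then c m ⟨l, hl⟩ else if l = m then 1 else 0, ?_, fun m => ?_⟩
  · rw [Matrix.det_of_isLowerTriangular]
    · simp
    · intro i j hij
      have hij' : i < j := hij
      simp [hij'.le, hij'.ne']
  · have h1 : p m = p' m + ∑ l, c m l • p' l := by rw [hc]; abel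
    rw [h1]
    simp only [Matrix.of_apply]
    have h2 : ∀ l : Fin n, (if hl : l < m then c m ⟨l, hl⟩ else if l = m then (1 : ℝ) else 0) • p' l
        = (if l = m then p' l else 0) + (if hl : l < m then c m ⟨l, hl⟩ • p' l else 0) := by
      intro l
      by_cases h3 : l < m
      · simp [h3, h3.ne]
      · by_cases h4 : l = m <;> simp [h3, h4]
    simp only [h2, Finset.sum_add_distrib]
    congr 1
    · simp
    · have h5 : ∑ l : Fin n, (if hl : l < m then c m ⟨l, hl⟩ • p' l else 0) =
          ∑ l ∈ Finset.range n, (if hl : l < m then c m ⟨l, hl⟩ • p' l else 0) :=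
        (Finset.sum_range fun l => if hl : l < (m : ℕ) then c m ⟨l, hl⟩ • p' l else 0).symm
      have h6 : ∑ l : Fin m, c m l • p' l =
          ∑ l ∈ Finset.range m, (if hl : l < m then c m ⟨l, hl⟩ • p' l else 0) := by
        rw [Finset.sum_range]
        simp
      rw [h5, h6]
      refine Finset.sum_subset (by simp) fun l _ hl => ?_
      rw [dif_neg]
      simpa using hl

theorem exists_matrix_of_mem_initSpan {n : ℕ} {p p' : ℕ → V} (h : ∀ m < n, p m ∈ initSpan p' n) :
    ∃ C : Matrix (Fin n) (Fin n) ℝ, ∀ m : Fin n, p m = ∑ l, C m l • p' l := by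
  have h' : ∀ m : Fin n, ∃ c : Fin n → ℝ, ∑ l, c l • p' l = p m := fun m =>
    mem_initSpan_iff.1 (h m m.2)
  choose c hc using h'
  exact ⟨c, fun m => (hc m).symm⟩

theorem det_cat3_congr {i j k : ℕ} (hij : i + j + k = d) {p p' q q' r r' : ℕ → V}
    (hp : UnitriangularTo i p p') (hq : UnitriangularTo j q q') (hr : UnitriangularTo k r r') :
    b.det (fun t : Fin d => cat3 i j p q r t) = b.det (fun t : Fin d => cat3 i j p' q' r' t) := by
  obtain ⟨C, hC1, hC⟩ := hp.exists_matrix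
  obtain ⟨E, hE1, hE⟩ := hq.exists_matrix
  obtain ⟨G, hG1, hG⟩ := hr.exists_matrix
  rw [det_cat3_fst b (by omega) q r C hC, det_cat3_snd b (by omega) p' r E hE,
    det_cat3_thd b hij p' q' G hG, hC1, hE1, hG1]
  simp

variable {b}

theorem exists_sub_mem_of_det_ne_zero {j : ℕ} {p q : ℕ → V} (hj : j ≤ d) {r : ℕ → V}
    (h : b.det (fun t : Fin d => cat3 j (d - j) p q r t) ≠ 0) (x : V) :
    ∃ y, y ∈ initSpan q (d - j) ∧ y - x ∈ initSpan p j := by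
  have hb : Submodule.span ℝ (Set.range fun t : Fin d => cat3 j (d - j) p q r t) = ⊤ :=
    ((b.is_basis_iff_det).2 (isUnit_iff_ne_zero.2 h)).2
  have hle : (⊤ : Submodule ℝ V) ≤ initSpan p j ⊔ initSpan q (d - j) := by
    rw [← hb, Submodule.span_le]
    rintro _ ⟨t, rfl⟩
    simp only [cat3]
    split_ifs with h1 h2
    · exact Submodule.mem_sup_left (mem_initSpan h1)
    · exact Submodule.mem_sup_right (mem_initSpan (by omega))
    · omega
  obtain ⟨a, ha, y, hy, hxy⟩ := Submodule.mem_sup.1 (hle (Submodule.mem_top (x := x)))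
  refine ⟨y, hy, ?_⟩
  rw [← hxy, sub_add_cancel_right]
  exact Submodule.neg_mem _ ha

theorem isPositiveOn_of_strictMono {κ : ℝ} {u : ℕ → V} {p : Fin d → ℕ} (hp : StrictMono p)
    (h : 0 < κ * b.det fun t => u (p t)) : IsPositiveOn b κ u (Finset.univ.image p) := by
  refine IsPositiveOn.of_enumeration hp.injective ?_
  rw [signedDet, ← mul_assoc]
  exact mul_pos h (det_vandermonde_pos hp)

theorem pluckerClosed_isPositiveOn (b : Module.Basis (Fin d) ℝ V) (κ : ℝ) (u : ℕ → V) :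
    PluckerClosed d (IsPositiveOn b κ u) :=
  fun _ _ _ _ _ hT hac hce hef ha hc he hf h1 h2 h3 h4 =>
    IsPositiveOn.plucker hT hac hce hef ha hc he hf h1 h2 h3 h4

/-- Let `u j` and `u (d + j)`, for `j < d`, be vectors on the lines given by the pairs of flags
with frames `p, q` and `r, s`. If the triples `p, q, r` and `p, r, s` are positive, then all
determinants of increasing `d`-tuples of these vectors have the same sign. -/
theorem exists_isPositiveOn {κ : ℝ} {p q r s : ℕ → V}
    (h1 : ∀ i j k, i + j + k = d → 0 < κ * b.det (fun t : Fin d => cat3 i j p q r t))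
    (h2 : ∀ i j k, i + j + k = d → 0 < κ * b.det (fun t : Fin d => cat3 i j p r s t)) :
    ∃ u : ℕ → V, (∀ j < d, u j ∈ initSpan p (j + 1) ∧ u j ∈ initSpan q (d - j)) ∧
      (∀ j < d, u (d + j) ∈ initSpan r (j + 1) ∧ u (d + j) ∈ initSpan s (d - j)) ∧
      ∀ S ⊆ Finset.range (2 * d), S.card = d → IsPositiveOn b κ u S := by
  have a1 : ∀ j, ∃ y, j < d → y ∈ initSpan q (d - j) ∧ y - p j ∈ initSpan p j := by
    intro j
    by_cases hj : j < d
    · obtain ⟨y, hy⟩ := exists_sub_mem_of_det_ne_zero hj.le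
        (right_ne_zero_of_mul (h1 j (d - j) 0 (by omega)).ne') (p j)
      exact ⟨y, fun _ => hy⟩
    · exact ⟨0, fun h => absurd h hj⟩
  have a2 : ∀ j, ∃ y, j < d → y ∈ initSpan s (d - j) ∧ y - r j ∈ initSpan r j := by
    intro j
    by_cases hj : j < d
    · have h := right_ne_zero_of_mul (h2 0 j (d - j) (by omega)).ne'
      have e : (fun t : Fin d => cat3 0 j p r s t) = fun t : Fin d => cat3 j (d - j) r s s t := by
        ext t
        simp only [cat3]
        split_ifs <;> first | rfl | omega
      rw [e] at h
      obtain ⟨y, hy⟩ := exists_sub_mem_of_det_ne_zero hj.le h (r j)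
      exact ⟨y, fun _ => hy⟩
    · exact ⟨0, fun h => absurd h hj⟩
  choose f hf using a1
  choose g hg using a2
  let u : ℕ → V := fun j => if j < d then f j else g (j - d)
  have uf : ∀ j < d, u j = f j := fun j hj => by simp [u, hj]
  have ug : ∀ j, u (d + j) = g j := fun j => by simp [u]
  have aux : ∀ (w : ℕ → V) (j : ℕ) (y : V), y - w j ∈ initSpan w j → y ∈ initSpan w (j + 1) := by
    intro w j y h
    rw [← sub_add_cancel y (w j)]
    exact Submodule.add_mem _ (initSpan_mono w j.le_succ h) (mem_initSpan j.lt_succ_self)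
  have tu : UnitriangularTo d u p := fun m hm => by rw [uf m hm]; exact (hf m hm).2
  have tv : UnitriangularTo d (fun m => u (d + m)) r := fun m hm => by
    simp only [ug]; exact (hg m hm).2
  have tmono : ∀ {n n' : ℕ} {w w' : ℕ → V}, n' ≤ n → UnitriangularTo n w w' →
      UnitriangularTo n' w w' := fun h h' m hm => h' m (by omega)
  refine ⟨u, fun j hj => ?_, fun j hj => ?_, ?_⟩
  · rw [uf j hj]; exact ⟨aux _ _ _ (hf j hj).2, (hf j hj).1⟩
  · rw [ug j]; exact ⟨aux _ _ _ (hg j hj).2, (hg j hj).1⟩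
  refine (pluckerClosed_isPositiveOn b κ u).forall_subset ?_ ?_
  · intro i j hij hj
    -- The vectors `u j, …, u (d - 1)` lie in the span of the first `d - j` vectors of `q`, and are
    -- as many. Replacing them by those multiplies determinants by `det C`.
    have hmem : ∀ m < d - j, u (j + m) ∈ initSpan q (d - j) := by
      intro m hm
      rw [uf _ (by omega)]
      exact initSpan_mono q (by omega) (hf (j + m) (by omega)).1
    obtain ⟨C, hC⟩ := exists_matrix_of_mem_initSpan (p := fun m => u (j + m)) hmem
    -- Computing the determinant of `u 0, …, u (d - 1)` in two ways gives `det(p) = det C * det(p,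
    -- q)`, with `j` vectors of `p` and `d - j` of `q` on the right; both determinants have the sign
    -- of `κ`.
    have c1 : 0 < C.det := by
      have e1 := det_cat3_snd b (i := j) (j := d - j) (by omega) p
        (q := fun m => u (j + m)) r C hC
      have e2 : b.det (fun t : Fin d => cat3 j (d - j) p (fun m => u (j + m)) r t) =
          b.det (fun t : Fin d => cat3 d 0 p q r t) := by
        rw [← det_cat3_congr b (i := j) (j := d - j) (k := 0) (by omega)
          (tmono hj tu) (.refl _ _) (.refl _ _),
          ← det_cat3_congr b (i := d) (j := 0) (k := 0) (by omega) tu (.refl _ _) (.refl _ _)]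
        congr 1
        ext t
        simp only [cat3]
        split_ifs <;> first | rfl | (congr 1; omega)
      have e3 := h1 d 0 0 (by omega)
      rw [← e2, e1] at e3
      have e4 := h1 j (d - j) 0 (by omega)
      have e5 : κ * (C.det * b.det (fun t : Fin d => cat3 j (d - j) p q r t)) =
        C.det * (κ * b.det (fun t : Fin d => cat3 j (d - j) p q r t)) := by ring
      rw [e5] at e3
      exact pos_of_mul_pos_left e3 e4.le
    let e : Fin d → ℕ := fun t => if (t : ℕ) < i then t else t - i + j
    have he : StrictMono e := by
      intro t t' ht
      have : (t : ℕ) < t' := ht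
      simp only [e]
      split_ifs <;> omega
    have him : Finset.univ.image e = Finset.range i ∪ Finset.Ico j (j + (d - i)) := by
      ext x
      simp only [Finset.mem_image, Finset.mem_univ, true_and, Finset.mem_union, Finset.mem_range,
        Finset.mem_Ico]
      constructor
      · rintro ⟨t, rfl⟩
        simp only [e]
        split_ifs <;> omega
      · rintro (h | h)
        · exact ⟨⟨x, by omega⟩, by simp [e, h]⟩
        · refine ⟨⟨x - j + i, by omega⟩, ?_⟩
          simp only [e]
          split_ifs <;> omega
    rw [← him]
    refine isPositiveOn_of_strictMono he ?_
    have e1 : (fun t => u (e t)) = fun t : Fin d =>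
        cat3 i (d - j) u (fun m => u (j + m)) (fun m => u (d + m)) t := by
      ext t
      simp only [cat3, e]
      split_ifs <;> first | rfl | (congr 1; omega)
    rw [e1, det_cat3_congr b (k := j - i) (by omega) (tmono (by omega) tu) (.refl _ _)
      (tmono (by omega) tv), det_cat3_snd b (by omega) p (q := fun m => u (j + m)) r C hC]
    have := mul_pos c1 (h1 i (d - j) (j - i) (by omega))
    linarith
  · intro i k l hikl
    -- The same device for the last `l` vectors of the second half, which lie in the span of the
    -- first `l` vectors of `s`.
    have hmem : ∀ m < l, u (d + (d - l) + m) ∈ initSpan s l := by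
      intro m hm
      rw [add_assoc, ug]
      exact initSpan_mono s (by omega) (hg (d - l + m) (by omega)).1
    obtain ⟨C, hC⟩ := exists_matrix_of_mem_initSpan (p := fun m => u (d + (d - l) + m)) hmem
    have c1 : 0 < C.det := by
      have e1 := det_cat3_thd b (i := 0) (j := d - l) (by omega) p r
        (r := fun m => u (d + (d - l) + m)) C hC
      have e2 : b.det (fun t : Fin d => cat3 0 (d - l) p r (fun m => u (d + (d - l) + m)) t) =
          b.det (fun t : Fin d => cat3 0 d p r s t) := by
        rw [← det_cat3_congr b (i := 0) (j := d - l) (k := l) (by omega) (.refl _ _)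
          (tmono (by omega) tv) (.refl _ _),
          ← det_cat3_congr b (i := 0) (j := d) (k := 0) (by omega) (.refl _ _) tv (.refl _ _)]
        congr 1
        ext t
        simp only [cat3]
        split_ifs <;> first | rfl | (congr 1; omega)
      have e3 := h2 0 d 0 (by omega)
      rw [← e2, e1] at e3
      have e4 := h2 0 (d - l) l (by omega)
      have e5 : κ * (C.det * b.det (fun t : Fin d => cat3 0 (d - l) p r s t)) =
        C.det * (κ * b.det (fun t : Fin d => cat3 0 (d - l) p r s t)) := by ring
      rw [e5] at e3
      exact pos_of_mul_pos_left e3 e4.le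
    let e : Fin d → ℕ := fun t => if (t : ℕ) < i then t else if (t : ℕ) < i + k then d + (t - i)
      else d + (d - l) + (t - i - k)
    have he : StrictMono e := by
      intro t t' ht
      have : (t : ℕ) < t' := ht
      simp only [e]
      split_ifs <;> omega
    have him : Finset.univ.image e =
        Finset.range i ∪ (Finset.Ico d (d + k) ∪ Finset.Ico (2 * d - l) (2 * d)) := by
      ext x
      simp only [Finset.mem_image, Finset.mem_univ, true_and, Finset.mem_union, Finset.mem_range,
        Finset.mem_Ico]
      constructor
      · rintro ⟨t, rfl⟩
        simp only [e]
        split_ifs <;> omega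
      · rintro (h | h | h)
        · exact ⟨⟨x, by omega⟩, by simp [e, h]⟩
        · refine ⟨⟨x - d + i, by omega⟩, ?_⟩
          simp only [e]
          split_ifs <;> omega
        · refine ⟨⟨x - (2 * d - l) + i + k, by omega⟩, ?_⟩
          simp only [e]
          split_ifs <;> omega
    rw [← him]
    refine isPositiveOn_of_strictMono he ?_
    have e1 : (fun t => u (e t)) = fun t : Fin d =>
        cat3 i k u (fun m => u (d + m)) (fun m => u (d + (d - l) + m)) t := by
      ext t
      simp only [cat3, e]
      split_ifs <;> first | rfl
    rw [e1, det_cat3_congr b hikl (tmono (by omega) tu) (tmono (by omega) tv) (.refl _ _),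
      det_cat3_thd b hikl p r (r := fun m => u (d + (d - l) + m)) C hC]
    have := mul_pos c1 (h2 i k l hikl)
    linarith

end Frames

/-! ### Minors as signed determinants -/

section Minors

variable {V : Type*} [AddCommGroup V] [Module ℝ V] {d : ℕ}

/-- The columns outside the range of `I` are basis vectors, so the matrix is block triangular with
an identity block and the minor as its diagonal blocks. -/
theorem Module.Basis.det_extend (e : Module.Basis (Fin d) ℝ V) {k : ℕ} (I : Fin k ↪o Fin d)
    (g : Fin k → V) : e.det (Function.extend I g e) =
      (Matrix.of fun m l => e.repr (g l) (I m)).det := by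
  classical
  rw [Module.Basis.det_apply,
    Matrix.twoBlockTriangular_det _ (fun i => i ∉ Set.range I) (fun i hi j hj => ?_)]
  · have h1 : (e.toMatrix (Function.extend I g e)).toSquareBlockProp (fun i => i ∉ Set.range I) =
        1 := by
      ext i j
      rw [Matrix.toSquareBlockProp_def, Matrix.of_apply, Module.Basis.toMatrix_apply,
        Function.extend_apply' _ _ _ (by simpa using j.2), Module.Basis.repr_self,
        Finsupp.single_apply, Matrix.one_apply]
      simp only [Subtype.ext_iff, eq_comm]
    rw [h1, Matrix.det_one, one_mul]
    let σ : Fin k ≃ {i : Fin d // ¬ i ∉ Set.range I} :=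
      (Equiv.ofInjective I I.injective).trans (Equiv.subtypeEquivRight fun i => by simp)
    have hσ : ∀ m, (σ m : Fin d) = I m := fun m => rfl
    rw [← Matrix.det_submatrix_equiv_self σ]
    congr 1
    ext m l
    simp [Matrix.toSquareBlockProp_def, Module.Basis.toMatrix_apply, hσ, I.injective.extend_apply]
  · rw [Module.Basis.toMatrix_apply, Function.extend_apply' _ _ _ (by simpa using hj),
      Module.Basis.repr_self, Finsupp.single_apply, if_neg]
    rintro rfl
    exact hi hj

/-- The positions in the sequence `e 0, …, e (d - 1), f (d - 1), …, f 0` that give the minor with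
rows `I` and columns `J`. -/
def minorIndex {k : ℕ} (I J : Fin k ↪o Fin d) : Fin d → ℕ :=
  Function.extend I (fun m => d + (J m).rev) (fun i => (i : ℕ))

theorem minorIndex_apply {k : ℕ} (I J : Fin k ↪o Fin d) (m : Fin k) :
    minorIndex I J (I m) = d + (J m).rev := I.injective.extend_apply _ _ _

theorem minorIndex_of_notMem {k : ℕ} (I J : Fin k ↪o Fin d) {i : Fin d}
    (h : i ∉ Set.range I) : minorIndex I J i = i := Function.extend_apply' _ _ _ h

theorem minorIndex_lt {k : ℕ} (I J : Fin k ↪o Fin d) {i j : Fin d} (h : i ∉ Set.range I)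
    (hij : i < j) : minorIndex I J i < minorIndex I J j := by
  rw [minorIndex_of_notMem I J h]
  by_cases hj : j ∈ Set.range I
  · obtain ⟨m, rfl⟩ := hj
    rw [minorIndex_apply]; omega
  · rw [minorIndex_of_notMem I J hj]; exact hij

theorem minorIndex_gt {k : ℕ} (I J : Fin k ↪o Fin d) {i j : Fin d} (h : i ∈ Set.range I)
    (hij : i < j) : minorIndex I J j < minorIndex I J i := by
  obtain ⟨m, rfl⟩ := h
  rw [minorIndex_apply]
  by_cases hj : j ∈ Set.range I
  · obtain ⟨l, rfl⟩ := hj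
    rw [minorIndex_apply]
    have : J m < J l := J.strictMono (I.lt_iff_lt.1 hij)
    have : (J l).rev < (J m).rev := Fin.rev_lt_rev.2 this
    omega
  · rw [minorIndex_of_notMem I J hj]; omega

theorem minorIndex_injective {k : ℕ} (I J : Fin k ↪o Fin d) :
    Function.Injective (minorIndex I J) := by
  refine fun i j h => by_contra fun hne => ?_
  wlog hij : i < j generalizing i j
  · exact this j i h.symm (Ne.symm hne) (lt_of_le_of_ne (not_lt.1 hij) (Ne.symm hne))
  by_cases hi : i ∈ Set.range I
  · exact (minorIndex_gt I J hi hij).ne h.symm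
  · exact (minorIndex_lt I J hi hij).ne h

/-- A position in the range of `I` carries a value larger than the values at all `d - 1 - i` later
positions, so each of these differences is negative; from the other positions all differences are
positive. -/
theorem det_vandermonde_minorIndex {k : ℕ} (I J : Fin k ↪o Fin d) [DecidablePred (· ∈ Set.range I)] :
    0 < (∏ i, if i ∈ Set.range I then (-1 : ℝ) ^ (d - 1 - (i : ℕ)) else 1) *
      (Matrix.vandermonde fun i => (minorIndex I J i : ℝ)).det := by
  rw [Matrix.det_vandermonde, ← Finset.prod_mul_distrib]
  refine Finset.prod_pos fun i _ => ?_
  split_ifs with hi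
  · rw [← Fin.card_Ioi, ← Finset.prod_const, ← Finset.prod_mul_distrib]
    refine Finset.prod_pos fun j hj => ?_
    have : ((minorIndex I J j : ℕ) : ℝ) < minorIndex I J i :=
      Nat.cast_lt.2 (minorIndex_gt I J hi (Finset.mem_Ioi.1 hj))
    linarith
  · rw [one_mul]
    refine Finset.prod_pos fun j hj => ?_
    rw [sub_pos, Nat.cast_lt]
    exact minorIndex_lt I J hi (Finset.mem_Ioi.1 hj)

/-- The product of the signs that relate minors to determinants. -/
def minorSign (d : ℕ) : ℝ := ∏ i : Fin d, (-1 : ℝ) ^ (d - 1 - (i : ℕ))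

theorem minorSign_mul_self (d : ℕ) : minorSign d * minorSign d = 1 := by
  rw [minorSign, ← Finset.prod_mul_distrib]
  refine Finset.prod_eq_one fun i _ => ?_
  rw [← mul_pow]; simp

/-- Sorting contributes the signs `(-1) ^ (d - 1 - i)` for `i` in the range of `I`, and the
normalisation of `u i` contributes those for the other `i`. Together they give the full product
`minorSign d`, independent of `I` and `J`. -/
theorem exists_signedDet_minorIndex (e : Module.Basis (Fin d) ℝ V) {u : ℕ → V} {f : Fin d → V}
    (hu : ∀ i : Fin d, u i = (-1 : ℝ) ^ (d - 1 - (i : ℕ)) • e i) (hf : ∀ j : Fin d, f j = u (d + j.rev))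
    {k : ℕ} (I J : Fin k ↪o Fin d) :
    ∃ c > 0, minorSign d * signedDet e u (minorIndex I J) =
      c * ((e.toMatrix f).submatrix I J).det := by
  classical
  let c : Fin d → ℝ := fun i => if i ∈ Set.range I then 1 else (-1 : ℝ) ^ (d - 1 - (i : ℕ))
  have h1 : (fun i => u (minorIndex I J i)) =
      fun i => c i • Function.extend I (fun m => f (J m)) e i := by
    ext i
    by_cases hi : i ∈ Set.range I
    · obtain ⟨m, rfl⟩ := hi
      rw [minorIndex_apply, I.injective.extend_apply, hf]
      simp [c]
    · rw [minorIndex_of_notMem I J hi, Function.extend_apply' _ _ _ hi, hu]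
      simp only [c, if_neg hi]
  have h2 : (Matrix.of fun m l => e.repr (f (J l)) (I m)) = (e.toMatrix f).submatrix I J := by
    ext m l; simp [Module.Basis.toMatrix_apply]
  have h3 : minorSign d * ∏ i, c i =
      ∏ i, if i ∈ Set.range I then (-1 : ℝ) ^ (d - 1 - (i : ℕ)) else 1 := by
    rw [minorSign, ← Finset.prod_mul_distrib]
    refine Finset.prod_congr rfl fun i _ => ?_
    simp only [c]
    split_ifs
    · simp
    · rw [← mul_pow]; simp
  have h4 : e.det (fun i => c i • Function.extend I (fun m => f (J m)) e i) =
      (∏ i, c i) • e.det (Function.extend I (fun m => f (J m)) e) :=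
    e.det.toMultilinearMap.map_smul_univ c _
  rw [signedDet, h1, h4, e.det_extend, h2, smul_eq_mul]
  have h5 := det_vandermonde_minorIndex I J
  rw [← h3] at h5
  have h6 : minorSign d * ((∏ i, c i) * ((e.toMatrix f).submatrix I J).det *
      (Matrix.vandermonde fun i => (minorIndex I J i : ℝ)).det) =
      (minorSign d * (∏ i, c i) * (Matrix.vandermonde fun i => (minorIndex I J i : ℝ)).det) *
        ((e.toMatrix f).submatrix I J).det := by ring
  exact ⟨_, h5, h6⟩

theorem minor_pos_iff (e : Module.Basis (Fin d) ℝ V) {u : ℕ → V} {f : Fin d → V}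
    (hu : ∀ i : Fin d, u i = (-1 : ℝ) ^ (d - 1 - (i : ℕ)) • e i) (hf : ∀ j : Fin d, f j = u (d + j.rev))
    {k : ℕ} (I J : Fin k ↪o Fin d) :
    0 < minorSign d * signedDet e u (minorIndex I J) ↔ 0 < ((e.toMatrix f).submatrix I J).det := by
  obtain ⟨c, hc, h⟩ := exists_signedDet_minorIndex e hu hf I J
  rw [h]
  exact mul_pos_iff_of_pos_left hc

theorem minorIndex_lt_two_mul {k : ℕ} (I J : Fin k ↪o Fin d) (i : Fin d) :
    minorIndex I J i < 2 * d := by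
  by_cases hi : i ∈ Set.range I
  · obtain ⟨m, rfl⟩ := hi
    rw [minorIndex_apply]; omega
  · rw [minorIndex_of_notMem I J hi]; omega

theorem exists_isTotallyPositive_toMatrix {b : Module.Basis (Fin d) ℝ V} {κ : ℝ} {u : ℕ → V}
    (h : ∀ S ⊆ Finset.range (2 * d), S.card = d → IsPositiveOn b κ u S) :
    ∃ e f : Module.Basis (Fin d) ℝ V, (∀ i : Fin d, e i = (-1 : ℝ) ^ (d - 1 - (i : ℕ)) • u i) ∧
      (∀ j : Fin d, f j = u (d + j.rev)) ∧ (e.toMatrix f).IsTotallyPositive := by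
  have key : ∀ p : Fin d → ℕ, Function.Injective p → (∀ i, p i < 2 * d) →
      0 < κ * signedDet b u p := by
    intro p hp hp2
    refine h (Finset.univ.image p) ?_ ?_ p hp rfl
    · intro x hx
      simp only [Finset.mem_image, Finset.mem_univ, true_and] at hx
      obtain ⟨i, rfl⟩ := hx
      simpa using hp2 i
    · rw [Finset.card_image_of_injective _ hp]; simp
  have mk : ∀ w : Fin d → V, b.det w ≠ 0 → ∃ e : Module.Basis (Fin d) ℝ V, ∀ i, e i = w i := by
    intro w hw
    obtain ⟨h1, h2⟩ := b.is_basis_iff_det.2 (isUnit_iff_ne_zero.2 hw)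
    exact ⟨Module.Basis.mk h1 h2.ge, fun i => Module.Basis.mk_apply h1 h2.ge i⟩
  have k1 := key (fun i => i) Fin.val_injective (fun i => by omega)
  have k1' : 0 < κ * b.det fun i : Fin d => u i := by
    rw [signedDet, ← mul_assoc] at k1
    exact pos_of_mul_pos_left k1 (det_vandermonde_pos Fin.val_strictMono).le
  have k2 := key (fun j => d + j.rev) (fun i j hij => by
    have h1 : (i.rev : ℕ) = j.rev := by simpa using hij
    exact Fin.rev_injective (Fin.ext h1)) (fun i => by omega)
  have hs : b.det (fun i : Fin d => (-1 : ℝ) ^ (d - 1 - (i : ℕ)) • u i) =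
      minorSign d * b.det fun i : Fin d => u i :=
    b.det.toMultilinearMap.map_smul_univ _ _
  have hms : minorSign d ≠ 0 := fun h0 => by
    have := minorSign_mul_self d
    simp [h0] at this
  obtain ⟨e, he⟩ := mk (fun i : Fin d => (-1 : ℝ) ^ (d - 1 - (i : ℕ)) • u i) (by
    rw [hs]; exact mul_ne_zero hms (right_ne_zero_of_mul k1'.ne'))
  obtain ⟨f, hf⟩ := mk (fun j : Fin d => u (d + j.rev))
    (left_ne_zero_of_mul (right_ne_zero_of_mul k2.ne'))
  refine ⟨e, f, he, hf, fun k I J => ?_⟩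
  rw [← minor_pos_iff e (u := u) (f := f) (fun i => ?_) hf]
  · have h1 := key (minorIndex I J) (minorIndex_injective I J) (minorIndex_lt_two_mul I J)
    have h2 : b.det (fun i => u (minorIndex I J i)) =
        b.det e * e.det (fun i => u (minorIndex I J i)) :=
      congrArg (fun F : V [⋀^Fin d]→ₗ[ℝ] ℝ => F fun i => u (minorIndex I J i))
        (b.det.eq_smul_basis_det e)
    have h3 : b.det e = minorSign d * b.det fun i : Fin d => u i := by
      rw [← hs]; congr 1; ext i; exact he i
    rw [signedDet] at h1 ⊢
    rw [h2, h3] at h1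
    have h4 : κ * (minorSign d * (b.det fun i : Fin d => u i) *
        (e.det fun i => u (minorIndex I J i)) *
          (Matrix.vandermonde fun i => (minorIndex I J i : ℝ)).det) =
        (κ * (b.det fun i : Fin d => u i)) * (minorSign d * ((e.det fun i => u (minorIndex I J i)) *
          -- Passing from the basis `b` to `e` replaces `κ` by `minorSign d`, up to the factor in
          -- `k1'`, which is positive.
          (Matrix.vandermonde fun i => (minorIndex I J i : ℝ)).det)) := by ring
    rw [h4] at h1
    exact (mul_pos_iff_of_pos_left k1').1 h1
  · rw [he, smul_smul, ← mul_pow]; simp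

end Minors

/-! ### The conclusions for flags with given frames -/

namespace FullFlag

variable {d : ℕ}

/-- The first `i` terms of the sequence `w` span the `i`-th subspace of the flag `f`. -/
def HasFrame (f : FullFlag d) (w : ℕ → EuclideanSpace ℝ (Fin d)) : Prop :=
  ∀ i : Fin (d + 1), f.sub i = initSpan w i

theorem sub_eq_of_finrank_le {f : FullFlag d} {i : Fin (d + 1)}
    {W : Submodule ℝ (EuclideanSpace ℝ (Fin d))} (hW : W ≤ f.sub i)
    (h : (i : ℕ) ≤ Module.finrank ℝ W) : f.sub i = W :=
  (Submodule.eq_of_le_of_finrank_le hW (by rw [f.finrank_sub]; exact h)).symm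

theorem IsConsistent.line_eq {a b : FullFlag d}
    {e : Module.Basis (Fin d) ℝ (EuclideanSpace ℝ (Fin d))} (h : IsConsistent a b e) (i : Fin d) :
    line a b i = Submodule.span ℝ {e i} := by
  have hfr : ∀ s : Finset (Fin d), Module.finrank ℝ (Submodule.span ℝ (e '' s)) = s.card := by
    intro s
    classical
    have h1 : LinearIndependent ℝ (fun x : s => e x) :=
      e.linearIndependent.comp _ Subtype.val_injective
    have h2 := finrank_span_eq_card h1
    rw [Fintype.card_coe] at h2
    have h3 : e '' s = Set.range fun x : s => e x := by
      rw [Set.image_eq_range]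
      rfl
    rw [← h2, h3]
  have ha : a.sub i.succ = Submodule.span ℝ (e '' (Finset.Iic i : Finset (Fin d))) := by
    refine sub_eq_of_finrank_le (Submodule.span_le.2 ?_) (by rw [hfr]; simp)
    rintro _ ⟨l, hl, rfl⟩
    have hl' : l ≤ i := by simpa using hl
    exact a.mono (Fin.succ_le_succ_iff.2 hl') (h l).1
  have hb : b.sub i.rev.succ = Submodule.span ℝ (e '' (Finset.Ici i : Finset (Fin d))) := by
    refine sub_eq_of_finrank_le (Submodule.span_le.2 ?_) (by rw [hfr]; simp; omega)
    rintro _ ⟨l, hl, rfl⟩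
    have hl' : i ≤ l := by simpa using hl
    exact b.mono (Fin.succ_le_succ_iff.2 (Fin.rev_le_rev.2 hl')) (h l).2
  refine le_antisymm (fun x hx => ?_) ?_
  · rw [line, ha, hb, Submodule.mem_inf, Module.Basis.mem_span_image,
      Module.Basis.mem_span_image] at hx
    have : x ∈ Submodule.span ℝ (e '' {i}) := by
      rw [Module.Basis.mem_span_image]
      intro l hl
      have h1 := hx.1 hl
      have h2 := hx.2 hl
      simp at h1 h2
      exact le_antisymm h1 h2
    simpa using this
  · rw [Submodule.span_le]
    rintro _ rfl
    exact h i

theorem conclusions_of_isPositiveOn {a x y b : FullFlag d}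
    {β : Module.Basis (Fin d) ℝ (EuclideanSpace ℝ (Fin d))} {κ : ℝ}
    {u : ℕ → EuclideanSpace ℝ (Fin d)}
    (h1 : ∀ i : Fin d, u i ∈ line a b i) (h2 : ∀ j : Fin d, u (d + j.rev) ∈ line x y j)
    (h : ∀ S ⊆ Finset.range (2 * d), S.card = d → IsPositiveOn β κ u S) :
    LinesInGeneralPosition a x y b ∧ HasTotallyPositiveBaseChange a x y b := by
  obtain ⟨e, f, he, hf, hA⟩ := exists_isTotallyPositive_toMatrix h
  have hce : IsConsistent a b e := fun i => by
    rw [he]; exact Submodule.smul_mem _ _ (h1 i)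
  have hcf : IsConsistent x y f := fun j => by
    rw [hf]; exact h2 j
  refine ⟨fun S hS => ?_, e, f, hce, hcf, hA⟩
  let idx : Fin d ⊕ Fin d → ℕ := Sum.elim (fun i => i) (fun j => d + j.rev)
  have hidx : Function.Injective idx := by
    rintro (i | i) (j | j) hij
    · simpa [idx, Fin.ext_iff] using hij
    · simp [idx] at hij; omega
    · simp [idx] at hij; omega
    · have h1 : (i.rev : ℕ) = j.rev := by simpa [idx] using hij
      rw [Fin.rev_injective (Fin.ext h1)]
  have hline : ∀ s, Sum.elim (line a b) (line x y) s = Submodule.span ℝ {u (idx s)} := by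
    rintro (i | j)
    · have hc : IsUnit ((-1 : ℝ) ^ (d - 1 - (i : ℕ))) := (isUnit_one.neg).pow _
      simp only [Sum.elim_inl, idx]
      rw [hce.line_eq, he, Submodule.span_singleton_smul_eq hc]
    · simp only [Sum.elim_inr, idx]
      rw [hcf.line_eq, hf]
  let σ : Fin d ≃ S := (finCongr hS.symm).trans S.equivFin.symm
  have hp : Function.Injective fun i => idx (σ i) :=
    hidx.comp (Subtype.val_injective.comp σ.injective)
  have hdet : β.det (fun i => u (idx (σ i))) ≠ 0 := by
    refine left_ne_zero_of_mul (right_ne_zero_of_mul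
      (h (Finset.univ.image fun i => idx (σ i)) ?_ ?_ (fun i => idx (σ i)) hp rfl).ne')
    · intro z hz
      simp only [Finset.mem_image, Finset.mem_univ, true_and] at hz
      obtain ⟨i, rfl⟩ := hz
      rw [Finset.mem_range]
      rcases (σ i : Fin d ⊕ Fin d) with i | i
      · simp only [Sum.elim_inl, idx]; omega
      · simp only [Sum.elim_inr, idx]; omega
    · rw [Finset.card_image_of_injective _ hp]; simp
  obtain ⟨g1, g2⟩ := β.is_basis_iff_det.2 (isUnit_iff_ne_zero.2 hdet)
  have g3 : LinearIndependent ℝ fun s : S => u (idx s) :=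
    (linearIndependent_equiv σ).1 g1
  rw [DirectSum.isInternal_submodule_iff_iSupIndep_and_iSup_eq_top]
  simp only [hline]
  refine ⟨g3.iSupIndep_span_singleton, ?_⟩
  rw [← Submodule.span_range_eq_iSup, ← g2]
  congr 1
  ext z
  simp only [Set.mem_range]
  exact ⟨fun ⟨s, hs⟩ => ⟨σ.symm s, by simpa using hs⟩, fun ⟨i, hi⟩ => ⟨σ i, hi⟩⟩

/-- The triples are (a, b, y) and (a, y, x). The vector `u (d + j)` lies in y^{j+1} ∩ x^{d-j}, so
the second half of `u` runs through the lines of (x, y) backwards; hence the reversed index. -/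
theorem conclusions_of_frames {a x y b : FullFlag d}
    {β : Module.Basis (Fin d) ℝ (EuclideanSpace ℝ (Fin d))} {κ : ℝ}
    {p q r s : ℕ → EuclideanSpace ℝ (Fin d)}
    (ha : a.HasFrame p) (hb : b.HasFrame q) (hy : y.HasFrame r) (hx : x.HasFrame s)
    (h1 : ∀ i j k, i + j + k = d → 0 < κ * β.det (fun t : Fin d => cat3 i j p q r t))
    (h2 : ∀ i j k, i + j + k = d → 0 < κ * β.det (fun t : Fin d => cat3 i j p r s t)) :
    LinesInGeneralPosition a x y b ∧ HasTotallyPositiveBaseChange a x y b := by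
  obtain ⟨u, u1, u2, u3⟩ := exists_isPositiveOn h1 h2
  refine conclusions_of_isPositiveOn (fun i => ?_) (fun j => ?_) u3
  · rw [line, ha, hb]
    refine ⟨(u1 i i.2).1, ?_⟩
    have : (i.rev.succ : ℕ) = d - i := by rw [Fin.val_succ, Fin.val_rev]; omega
    rw [this]
    exact (u1 i i.2).2
  · rw [line, hx, hy]
    refine ⟨?_, (u2 j.rev j.rev.2).1⟩
    have : (j.succ : ℕ) = d - j.rev := by rw [Fin.val_succ, Fin.val_rev]; omega
    rw [this]
    exact (u2 j.rev j.rev.2).2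

end FullFlag

/-! ### Frames and transversality -/

namespace FullFlag

variable {d : ℕ}

theorem finrank_initSpan {V : Type*} [AddCommGroup V] [Module ℝ V] {w : ℕ → V}
    (hw : LinearIndependent ℝ fun t : Fin d => w t) {i : ℕ} (hi : i ≤ d) :
    Module.finrank ℝ (initSpan w i) = i := by
  have h : LinearIndependent ℝ fun l : Fin i => w l :=
    hw.comp (Fin.castLE hi) (Fin.castLE_injective hi)
  rw [initSpan, finrank_span_eq_card h, Fintype.card_fin]

theorem hasFrame_of_linearIndependent {f : FullFlag d} {w : ℕ → EuclideanSpace ℝ (Fin d)}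
    (hw : LinearIndependent ℝ fun t : Fin d => w t) (h : ∀ t : Fin d, w t ∈ f.sub t.succ) :
    f.HasFrame w := by
  intro i
  refine sub_eq_of_finrank_le (Submodule.span_le.2 ?_) (by
    rw [finrank_initSpan hw (Nat.lt_succ_iff.1 i.2)])
  rintro _ ⟨l, rfl⟩
  have hl : (l : ℕ) < d := by omega
  exact f.mono (show (⟨l, hl⟩ : Fin d).succ ≤ i by
    rw [Fin.le_def, Fin.val_succ]; exact l.2) (h ⟨l, hl⟩)

theorem HasFrame.map {f g : FullFlag d} {w : ℕ → EuclideanSpace ℝ (Fin d)} (h : f.HasFrame w)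
    {T : EuclideanSpace ℝ (Fin d) →ₗ[ℝ] EuclideanSpace ℝ (Fin d)} (hT : IsImage T f g) :
    g.HasFrame fun m => T (w m) := by
  intro i
  rw [hT, h, initSpan, initSpan, Submodule.map_span, ← Set.range_comp]
  rfl

theorem IsTransverse.det_ne_zero {n : ℕ} {F : Fin n → FullFlag d} (hF : IsTransverse F)
    {w : Fin n → ℕ → EuclideanSpace ℝ (Fin d)} (hw : ∀ l, (F l).HasFrame (w l))
    (m : Fin n → ℕ) (hm : ∑ l, m l = d)
    (β : Module.Basis (Fin d) ℝ (EuclideanSpace ℝ (Fin d))) {v : Fin d → EuclideanSpace ℝ (Fin d)}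
    (hv : ∀ l, ∀ t < m l, w l t ∈ Set.range v) : β.det v ≠ 0 := by
  have hle : ∀ l, m l < d + 1 := fun l => by
    have := Finset.single_le_sum (f := m) (fun _ _ => Nat.zero_le _) (Finset.mem_univ l)
    omega
  have h1 := (hF (fun l => ⟨m l, hle l⟩) hm).submodule_iSup_eq_top
  have h2 : ⊤ ≤ Submodule.span ℝ (Set.range v) := by
    rw [← h1]
    refine iSup_le fun l => ?_
    rw [hw l]
    refine Submodule.span_le.2 ?_
    rintro _ ⟨t, rfl⟩
    exact Submodule.subset_span (hv l t t.2)
  have h3 := linearIndependent_of_top_le_span_of_card_eq_finrank h2 (by simp)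
  exact (β.is_basis_iff_det.1 ⟨h3, top_le_iff.1 h2⟩).ne_zero

end FullFlag

/-! ### Positive quadruples -/

section Quadruple

variable {V : Type*} [AddCommGroup V] [Module ℝ V] {d : ℕ}

/-- The order embedding of `Fin k` onto the interval `[i, i + k)` of `Fin d`. -/
def intervalEmb {i k : ℕ} (h : i + k ≤ d) : Fin k ↪o Fin d :=
  OrderEmbedding.ofStrictMono (fun m => ⟨i + m, by omega⟩) fun a b hab => by
    rw [Fin.lt_def] at hab ⊢; simpa using hab

@[simp] theorem val_intervalEmb {i k : ℕ} (h : i + k ≤ d) (m : Fin k) :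
    (intervalEmb h m : ℕ) = i + m := rfl

/-- The basis vectors as a sequence, with the signs that occur in `minor_pos_iff`. -/
def ascFrame (e : Module.Basis (Fin d) ℝ V) : ℕ → V := fun m =>
  if h : m < d then (-1 : ℝ) ^ (d - 1 - m) • e ⟨m, h⟩ else 0

/-- The basis vectors in the opposite order, as a sequence. -/
def descFrame (e : Module.Basis (Fin d) ℝ V) : ℕ → V := fun m =>
  if h : m < d then e (Fin.rev ⟨m, h⟩) else 0

theorem ascFrame_apply (e : Module.Basis (Fin d) ℝ V) (i : Fin d) :
    ascFrame e i = (-1 : ℝ) ^ (d - 1 - (i : ℕ)) • e i := by simp [ascFrame]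

theorem descFrame_rev (e : Module.Basis (Fin d) ℝ V) (i : Fin d) : descFrame e i.rev = e i := by
  rw [descFrame, dif_pos i.rev.2, Fin.eta, Fin.rev_rev]

/-- The frame vectors left out of the first two blocks are those with index in `[i, i + k)`, and the
third block holds the images of the last `k` basis vectors. This is the determinant attached to the
minor with these rows and columns. -/
theorem exists_det_cat3_eq_minor_aux (e : Module.Basis (Fin d) ℝ V) (M : Matrix (Fin d) (Fin d) ℝ)
    {i j k : ℕ} (hi : i + k ≤ d) (hk : d - k + k ≤ d) (hijk : i + j + k = d) :
    ∃ c > 0, minorSign d * e.det (fun t : Fin d => cat3 i j (ascFrame e)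
      (fun m => ascFrame e (i + k + m)) (fun m => Matrix.toLin e e M (descFrame e m)) t) =
      c * (M.submatrix (intervalEmb hi) (intervalEmb hk)).det := by
  let u : ℕ → V := fun m => if m < d then ascFrame e m else Matrix.toLin e e M (descFrame e (m - d))
  have hu : ∀ l : Fin d, u l = (-1 : ℝ) ^ (d - 1 - (l : ℕ)) • e l := fun l => by
    simp [u, ascFrame_apply]
  have hf : ∀ l : Fin d, Matrix.toLin e e M (e l) = u (d + l.rev) := fun l => by
    simp only [u, if_neg (show ¬ d + (l.rev : ℕ) < d by omega), Nat.add_sub_cancel_left,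
      descFrame_rev]
  obtain ⟨c, hc, h⟩ := exists_signedDet_minorIndex e (f := fun l => Matrix.toLin e e M (e l)) hu hf
    (intervalEmb hi) (intervalEmb hk)
  have hM : e.toMatrix (fun l => Matrix.toLin e e M (e l)) = M := by
    ext r l
    rw [Module.Basis.toMatrix_apply, Matrix.toLin_self]
    simp [Finsupp.single_apply]
  rw [hM] at h
  -- `p` enumerates in increasing order the positions that `minorIndex` lists in another order.
  let p : Fin d → ℕ := fun t => if (t : ℕ) < i then t else if (t : ℕ) < i + j then t + k
    else d + (t - i - j)
  have hp : StrictMono p := by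
    intro t t' ht
    have : (t : ℕ) < t' := ht
    simp only [p]
    split_ifs <;> omega
  have him : Finset.univ.image p =
      Finset.univ.image (minorIndex (intervalEmb hi) (intervalEmb hk)) := by
    refine Finset.eq_of_subset_of_card_le ?_ ?_
    · intro x hx
      simp only [Finset.mem_image, Finset.mem_univ, true_and] at hx ⊢
      obtain ⟨t, rfl⟩ := hx
      simp only [p]
      split_ifs with h1 h2
      · refine ⟨t, minorIndex_of_notMem _ _ ?_⟩
        rintro ⟨m, hm⟩
        have := congrArg Fin.val hm
        simp at this; omega
      · refine ⟨⟨t + k, by omega⟩, minorIndex_of_notMem _ _ ?_⟩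
        rintro ⟨m, hm⟩
        have := congrArg Fin.val hm
        simp at this; omega
      · refine ⟨intervalEmb hi ⟨k - 1 - (t - i - j), by omega⟩, ?_⟩
        rw [minorIndex_apply, Fin.val_rev, val_intervalEmb]
        simp only
        omega
    · rw [Finset.card_image_of_injective _ hp.injective,
        Finset.card_image_of_injective _ (minorIndex_injective _ _)]
  rw [← signedDet_eq_of_image_eq e u (minorIndex_injective _ _) hp.injective him, signedDet] at h
  have h3 : (fun t => u (p t)) = fun t : Fin d => cat3 i j (ascFrame e)
      (fun m => ascFrame e (i + k + m)) (fun m => Matrix.toLin e e M (descFrame e m)) t := by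
    ext t
    simp only [u, p, cat3]
    split_ifs <;> first | rfl | omega | (congr 1; omega) | (congr 2; omega)
  rw [h3] at h
  have hv := det_vandermonde_pos hp
  refine ⟨c / (Matrix.vandermonde fun t => (p t : ℝ)).det, div_pos hc hv, ?_⟩
  rw [div_mul_eq_mul_div, ← h]
  field_simp

theorem exists_det_cat3_eq_minor (e : Module.Basis (Fin d) ℝ V) (M : Matrix (Fin d) (Fin d) ℝ)
    {i j k : ℕ} (hi : i + k ≤ d) (hk : d - k + k ≤ d) (hijk : i + j + k = d) :
    ∃ c > 0, minorSign d * e.det (fun t : Fin d => cat3 i j (ascFrame e) (descFrame e)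
      (fun m => Matrix.toLin e e M (descFrame e m)) t) =
      c * (M.submatrix (intervalEmb hi) (intervalEmb hk)).det := by
  have hmem : ∀ m < j, ascFrame e (d - j + m) ∈ initSpan (descFrame e) j := by
    intro m hm
    have h1 := ascFrame_apply e ⟨d - j + m, by omega⟩
    rw [← descFrame_rev] at h1
    simp only at h1
    rw [h1]
    exact Submodule.smul_mem _ _ (mem_initSpan (by rw [Fin.val_rev]; simp only; omega))
  obtain ⟨C, hC⟩ := exists_matrix_of_mem_initSpan (p := fun m => ascFrame e (d - j + m)) hmem
  -- Replacing the last `j` vectors of the ascending frame by the first `j` of the descending one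
  -- must not change the sign. The case `M = 1`, whose minor is `1`, gives `det C * c = minorSign d
  -- ^ 2 = 1` with `c > 0`.
  have hC0 : 0 < C.det := by
    have h1 := det_cat3_snd e (i := d - j) (j := j) (by omega) (ascFrame e)
      (q := fun m => ascFrame e (d - j + m)) (descFrame e) C hC
    have h2 : (fun t : Fin d => cat3 (d - j) j (ascFrame e) (fun m => ascFrame e (d - j + m))
        (descFrame e) t) = fun t : Fin d => (-1 : ℝ) ^ (d - 1 - (t : ℕ)) • e t := by
      ext1 t
      rw [← ascFrame_apply]
      simp only [cat3]
      split_ifs <;> first | rfl | omega | (congr 1; omega)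
    have h3 : e.det (fun t : Fin d => (-1 : ℝ) ^ (d - 1 - (t : ℕ)) • e t) = minorSign d := by
      have : e.det (fun t : Fin d => (-1 : ℝ) ^ (d - 1 - (t : ℕ)) • e t) =
          (∏ t : Fin d, (-1 : ℝ) ^ (d - 1 - (t : ℕ))) • e.det e :=
        e.det.toMultilinearMap.map_smul_univ _ _
      rw [this, e.det_self, smul_eq_mul, mul_one, minorSign]
    obtain ⟨c, hc, h4⟩ := exists_det_cat3_eq_minor_aux e 1 (i := d - j) (j := 0) (k := j)
      (by omega) (by omega) (by omega)
    have h5 : ((1 : Matrix (Fin d) (Fin d) ℝ).submatrix (intervalEmb (show d - j + j ≤ d by omega))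
        (intervalEmb (show d - j + j ≤ d by omega))).det = 1 := by
      rw [Matrix.submatrix_one _ (RelEmbedding.injective _), Matrix.det_one]
    have h6 : (fun t : Fin d => cat3 (d - j) 0 (ascFrame e) (fun m => ascFrame e (d - j + j + m))
        (fun m => Matrix.toLin e e 1 (descFrame e m)) t) =
        fun t : Fin d => cat3 (d - j) j (ascFrame e) (descFrame e) (descFrame e) t := by
      ext1 t
      simp only [cat3, Matrix.toLin_one, LinearMap.id_apply]
      split_ifs <;> first | rfl | omega
    rw [h5, h6, mul_one] at h4
    rw [h2, h3] at h1
    have h7 : C.det * c = 1 := by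
      have h8 := minorSign_mul_self d
      rw [← h4, ← h8]
      nth_rw 3 [h1]
      ring
    exact pos_of_mul_pos_left (by rw [h7]; exact one_pos) hc.le
  obtain ⟨c, hc, h⟩ := exists_det_cat3_eq_minor_aux e M hi hk hijk
  have e1 : i + k = d - j := by omega
  rw [det_cat3_snd e (i := i) (j := j) (by omega) (ascFrame e)
      (q := fun m => ascFrame e (i + k + m)) _ C (by simpa only [e1] using hC)] at h
  refine ⟨c / C.det, div_pos hc hC0, ?_⟩
  rw [div_mul_eq_mul_div, ← h]
  field_simp

/-- The triple (a, b, y) is governed by minors of `M₁`. The triple (a, y, x) is the image under `u₁`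
of (a, b, u₂(b)), hence governed by minors of `M₂`. Non-negativity of the minors and transversality
of the flags give strict signs. -/
theorem IsPositiveQuadruple.conclusions {a x y b : FullFlag d} (h : IsPositiveQuadruple a x y b) :
    LinesInGeneralPosition a x y b ∧ HasTotallyPositiveBaseChange a x y b := by
  obtain ⟨htr, e, hce, M₁, hM₁, M₂, hM₂, hy, hx⟩ := h
  set L₁ := Matrix.toLin e e M₁ with hL₁
  set L₂ := Matrix.toLin e e M₂ with hL₂
  have hneg : ∀ i : Fin d, IsUnit ((-1 : ℝ) ^ (d - 1 - (i : ℕ))) := fun i =>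
    (isUnit_one.neg).pow _
  have fa : a.HasFrame (ascFrame e) := by
    refine FullFlag.hasFrame_of_linearIndependent ?_ fun t => ?_
    · simp only [ascFrame_apply]
      exact e.linearIndependent.units_smul fun i => (hneg i).unit
    · rw [ascFrame_apply]
      exact Submodule.smul_mem _ _ (hce t).1
  have fb : b.HasFrame (descFrame e) := by
    have hd : ∀ t : Fin d, descFrame e t = e t.rev := fun t => by
      rw [← descFrame_rev e t.rev, Fin.rev_rev]
    refine FullFlag.hasFrame_of_linearIndependent ?_ fun t => ?_
    · simp only [hd]
      exact e.linearIndependent.comp _ Fin.rev_injective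
    · rw [hd]
      have := (hce t.rev).2
      rwa [Fin.rev_rev] at this
  have fy := fb.map hy
  have fx := fb.map hx
  have hF : ∀ l, (![a, x, y, b] l).HasFrame (![ascFrame e, fun m => (L₁ ∘ₗ L₂) (descFrame e m),
      fun m => L₁ (descFrame e m), descFrame e] l) := by
    intro l
    fin_cases l
    · exact fa
    · exact fx
    · exact fy
    · exact fb
  have hpos : ∀ (M : Matrix (Fin d) (Fin d) ℝ), M.IsTotallyNonneg → ∀ i j k, i + j + k = d →
      e.det (fun t : Fin d => cat3 i j (ascFrame e) (descFrame e)
        (fun m => Matrix.toLin e e M (descFrame e m)) t) ≠ 0 →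
      0 < minorSign d * e.det (fun t : Fin d => cat3 i j (ascFrame e) (descFrame e)
        (fun m => Matrix.toLin e e M (descFrame e m)) t) := by
    intro M hM i j k hijk hne
    obtain ⟨c, hc, h⟩ := exists_det_cat3_eq_minor e M (i := i) (j := j) (k := k)
      (by omega) (by omega) hijk
    refine lt_of_le_of_ne (h ▸ mul_nonneg hc.le (hM _ _ _)) (Ne.symm (mul_ne_zero ?_ hne))
    intro h0
    have := minorSign_mul_self d
    simp [h0] at this
  refine FullFlag.conclusions_of_frames (β := e) (κ := minorSign d) fa fb fy fx ?_ ?_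
  · intro i j k hijk
    refine hpos M₁ hM₁.1.2.2 i j k hijk (htr.det_ne_zero hF ![i, 0, k, j] ?_ e ?_)
    · simp [Fin.sum_univ_four]; omega
    · intro l t ht
      fin_cases l
      · refine ⟨⟨t, by simp at ht; omega⟩, ?_⟩
        simp only [cat3]
        rw [if_pos (by simpa using ht)]
        rfl
      · simp at ht
      · simp at ht
        refine ⟨⟨i + j + t, by omega⟩, ?_⟩
        simp only [cat3]
        rw [if_neg (by omega), if_neg (by omega)]
        have : i + j + t - i - j = t := by omega
        rw [this]
        rfl
      · simp at ht
        refine ⟨⟨i + t, by omega⟩, ?_⟩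
        simp only [cat3]
        rw [if_neg (by omega), if_pos (by omega)]
        have : i + t - i = t := by omega
        rw [this]
        rfl
  · intro i j k hijk
    have h0 : e.det (fun t : Fin d => cat3 i j (ascFrame e) (fun m => L₁ (descFrame e m))
        (fun m => (L₁ ∘ₗ L₂) (descFrame e m)) t) ≠ 0 := by
      refine htr.det_ne_zero hF ![i, k, j, 0] ?_ e ?_
      · simp [Fin.sum_univ_four]; omega
      · intro l t ht
        fin_cases l
        · refine ⟨⟨t, by simp at ht; omega⟩, ?_⟩
          simp only [cat3]
          rw [if_pos (by simpa using ht)]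
          rfl
        · simp at ht
          refine ⟨⟨i + j + t, by omega⟩, ?_⟩
          simp only [cat3]
          rw [if_neg (by omega), if_neg (by omega)]
          have : i + j + t - i - j = t := by omega
          rw [this]
          rfl
        · simp at ht
          refine ⟨⟨i + t, by omega⟩, ?_⟩
          simp only [cat3]
          rw [if_neg (by omega), if_pos (by omega)]
          have : i + t - i = t := by omega
          rw [this]
          rfl
        · simp at ht
    -- As `M₁` is unipotent upper triangular, `L₁` moves each vector of the frame of `a` only by
    -- earlier ones. With `det L₁ = 1`, it can be removed from the determinant.
    have htri : UnitriangularTo i (fun m => L₁ (ascFrame e m)) (ascFrame e) := by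
      intro m hm
      have hmd : m < d := by omega
      have h1 : ascFrame e m = (-1 : ℝ) ^ (d - 1 - m) • e ⟨m, hmd⟩ := ascFrame_apply e ⟨m, hmd⟩
      simp only
      rw [h1, map_smul, ← smul_sub, hL₁, Matrix.toLin_self]
      refine Submodule.smul_mem _ _ ?_
      rw [← Finset.add_sum_erase _ _ (Finset.mem_univ (⟨m, hmd⟩ : Fin d)), hM₁.1.1, one_smul,
        add_sub_cancel_left]
      refine Submodule.sum_mem _ fun l hl => ?_
      have hne : l ≠ ⟨m, hmd⟩ := (Finset.mem_erase.1 hl).1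
      rcases lt_or_gt_of_ne hne with hlt | hgt
      · refine Submodule.smul_mem _ _ ?_
        have h2 : e l = (-1 : ℝ) ^ (d - 1 - (l : ℕ)) • ascFrame e l := by
          rw [ascFrame_apply, smul_smul, ← mul_pow]; simp
        rw [h2]
        exact Submodule.smul_mem _ _ (mem_initSpan hlt)
      · rw [hM₁.1.2.1 _ _ hgt, zero_smul]
        exact Submodule.zero_mem _
    have hdet : M₁.det = 1 := by
      rw [Matrix.det_of_isUpperTriangular fun i j hij => hM₁.1.2.1 i j hij]
      exact Finset.prod_eq_one fun i _ => hM₁.1.1 i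
    have hcomp : e.det (fun t : Fin d => cat3 i j (ascFrame e) (fun m => L₁ (descFrame e m))
        (fun m => (L₁ ∘ₗ L₂) (descFrame e m)) t) =
        e.det (fun t : Fin d => cat3 i j (ascFrame e) (descFrame e)
          (fun m => L₂ (descFrame e m)) t) := by
      rw [← det_cat3_congr e hijk htri (.refl _ _) (.refl _ _)]
      have h1 := e.det_comp L₁ (fun t : Fin d => cat3 i j (ascFrame e) (descFrame e)
          (fun m => L₂ (descFrame e m)) t)
      rw [hL₁, LinearMap.det_toLin, hdet, one_mul] at h1
      rw [← h1]
      congr 1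
      ext1 t
      simp only [cat3, Function.comp_apply, LinearMap.comp_apply, hL₁]
      split_ifs <;> rfl
    rw [hcomp] at h0 ⊢
    exact hpos M₂ hM₂.1.2.2 i j k hijk h0

end Quadruple

/-! ### Hyperbolic elements -/

section Hyperbolic

/-- Two elements of `sl(2, ℝ)` with non-negative determinant whose commutator has non-negative
determinant are proportional. -/
theorem sl_two_proportional {p q r p' q' r' : ℝ} (h : p ^ 2 + q * r ≤ 0)
    (h' : p' ^ 2 + q' * r' ≤ 0)
    (hK : 0 ≤ -(q * r' - r * q') ^ 2 - 4 * (p * q' - q * p') * (r * p' - p * r')) :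
    q * r' = r * q' ∧ p * q' = q * p' ∧ r * p' = p * r' := by
  by_cases hq : q = 0
  · subst hq
    have hp : p = 0 := by nlinarith
    subst hp
    by_cases hr : r = 0
    · subst hr; simp
    · have h1 : r * q' = 0 := by nlinarith
      have hq' : q' = 0 := (mul_eq_zero.1 h1).resolve_left hr
      subst hq'
      have hp' : p' = 0 := by nlinarith
      subst hp'; simp
  -- Subtracting `l` times the first element from the second removes the `q`-coordinate and leaves
  -- the commutator unchanged; it remains to see that the differences `v` and `w` vanish.
  · obtain ⟨l, rfl⟩ : ∃ l, q' = l * q := ⟨q' / q, by field_simp⟩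
    obtain ⟨v, rfl⟩ : ∃ v, p' = l * p + v := ⟨p' - l * p, by ring⟩
    obtain ⟨w, rfl⟩ : ∃ w, r' = l * r + w := ⟨r' - l * r, by ring⟩
    have e1 : -(q * (l * r + w) - r * (l * q)) ^ 2 -
        4 * (p * (l * q) - q * (l * p + v)) * (r * (l * p + v) - p * (l * r + w)) =
        -(q * w + 2 * p * v) ^ 2 + 4 * (v ^ 2 * (p ^ 2 + q * r)) := by ring
    rw [e1] at hK
    have h1 : v ^ 2 * (p ^ 2 + q * r) ≤ 0 := mul_nonpos_of_nonneg_of_nonpos (sq_nonneg v) h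
    have h2 : q * w + 2 * p * v = 0 := by
      have : (q * w + 2 * p * v) ^ 2 ≤ 0 := by linarith
      exact pow_eq_zero_iff two_ne_zero |>.1 (le_antisymm this (sq_nonneg _))
    have h3 : v ^ 2 * (p ^ 2 + q * r) = 0 := by
      rw [h2] at hK; linarith
    have hv : v = 0 := by
      rcases mul_eq_zero.1 h3 with h4 | h4
      · exact pow_eq_zero_iff two_ne_zero |>.1 h4
      · have e2 : (l * p + v) ^ 2 + l * q * (l * r + w) =
            l ^ 2 * (p ^ 2 + q * r) + l * (q * w + 2 * p * v) + v ^ 2 := by ring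
        rw [e2, h4, h2] at h'
        nlinarith
    subst hv
    have hw : w = 0 := by
      have : q * w = 0 := by linarith
      exact (mul_eq_zero.1 this).resolve_left hq
    subst hw
    refine ⟨by ring, by ring, by ring⟩

/-- For K = AB - BA one has det K = 2 - tr(ABA⁻¹B⁻¹), and K is also the commutator of the traceless
parts of A and B. If all three traces have modulus at most 2, then the traceless parts and K have
non-negative determinant, so the traceless parts are proportional and A, B commute. -/
theorem exists_two_lt_abs_trace {A B : SL(2, ℝ)} (hAB : A * B ≠ B * A) :
    2 < |(A : Matrix (Fin 2) (Fin 2) ℝ).trace| ∨ 2 < |(B : Matrix (Fin 2) (Fin 2) ℝ).trace| ∨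
      2 < |((A * B * A⁻¹ * B⁻¹ : SL(2, ℝ)) : Matrix (Fin 2) (Fin 2) ℝ).trace| := by
  by_contra hcon
  push Not at hcon
  obtain ⟨hA, hB, hC⟩ := hcon
  have dA := A.det_coe
  have dB := B.det_coe
  rw [Matrix.det_fin_two] at dA dB
  simp only [Matrix.SpecialLinearGroup.coe_mul, Matrix.SpecialLinearGroup.coe_inv,
    Matrix.trace_fin_two, Matrix.mul_apply, Fin.sum_univ_two, Matrix.adjugate_fin_two,
    Matrix.of_apply, Matrix.cons_val', Matrix.cons_val_zero, Matrix.cons_val_one,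
    Matrix.cons_val_fin_one] at hA hB hC
  apply hAB
  set a := (A : Matrix (Fin 2) (Fin 2) ℝ) 0 0 with ha
  set b := (A : Matrix (Fin 2) (Fin 2) ℝ) 0 1 with hb
  set c := (A : Matrix (Fin 2) (Fin 2) ℝ) 1 0 with hc
  set e := (A : Matrix (Fin 2) (Fin 2) ℝ) 1 1 with he
  set a' := (B : Matrix (Fin 2) (Fin 2) ℝ) 0 0 with ha'
  set b' := (B : Matrix (Fin 2) (Fin 2) ℝ) 0 1 with hb'
  set c' := (B : Matrix (Fin 2) (Fin 2) ℝ) 1 0 with hc'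
  set e' := (B : Matrix (Fin 2) (Fin 2) ℝ) 1 1 with he'
  have hA2 : (a + e) ^ 2 ≤ 4 := by
    have := sq_le_sq' (neg_le_of_abs_le hA) (le_of_abs_le hA); linarith
  have hB2 : (a' + e') ^ 2 ≤ 4 := by
    have := sq_le_sq' (neg_le_of_abs_le hB) (le_of_abs_le hB); linarith
  have hC2 := le_of_abs_le hC
  obtain ⟨k1, k2, k3⟩ := sl_two_proportional (p := (a - e) / 2) (q := b) (r := c)
    (p' := (a' - e') / 2) (q' := b') (r' := c') (by nlinarith) (by nlinarith) (by
      have : -(b * c' - c * b') ^ 2 - 4 * ((a - e) / 2 * b' - b * ((a' - e') / 2)) *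
          (c * ((a' - e') / 2) - (a - e) / 2 * c') = 2 * ((a * e - b * c) * (a' * e' - b' * c')) -
          (((a * a' + b * c') * e + (a * b' + b * e') * -c) * e' +
            ((a * a' + b * c') * -b + (a * b' + b * e') * a) * -c' +
          (((c * a' + e * c') * e + (c * b' + e * e') * -c) * -b' +
            ((c * a' + e * c') * -b + (c * b' + e * e') * a) * a')) := by ring
      rw [this, dA, dB]
      linarith)
  ext i j
  rw [Matrix.SpecialLinearGroup.coe_mul, Matrix.SpecialLinearGroup.coe_mul, Matrix.mul_apply,
    Matrix.mul_apply, Fin.sum_univ_two, Fin.sum_univ_two]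
  fin_cases i <;> fin_cases j <;>
    simp only [Fin.zero_eta, Fin.mk_one, ← ha, ← hb, ← hc, ← he, ← ha', ← hb', ← hc', ← he'] <;>
    linarith

theorem SurfaceGroup.exists_not_commute {g : ℕ} (hg : 2 ≤ g) :
    ∃ x y : SurfaceGroup g, x * y ≠ y * x := by
  -- Sending every b_i to `1` kills each commutator of the relator, so the a_i may go to arbitrary
  -- permutations, in particular to two that do not commute.
  let f : Fin g × Bool → Equiv.Perm (Fin 3) := fun i =>
    if i.2 then 1 else if (i.1 : ℕ) = 0 then Equiv.swap 0 1 else Equiv.swap 1 2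
  have hf : ∀ r ∈ ({(List.ofFn fun i : Fin g =>
      FreeGroup.of (i, false) * FreeGroup.of (i, true) *
        (FreeGroup.of (i, false))⁻¹ * (FreeGroup.of (i, true))⁻¹).prod} :
          Set (FreeGroup (Fin g × Bool))), FreeGroup.lift f r = 1 := by
    rintro _ rfl
    rw [map_list_prod, List.map_ofFn]
    refine List.prod_eq_one fun x hx => ?_
    obtain ⟨i, rfl⟩ := List.mem_ofFn.1 hx
    simp [f]
  let φ := PresentedGroup.toGroup hf
  refine ⟨PresentedGroup.of (⟨0, by omega⟩, false), PresentedGroup.of (⟨1, by omega⟩, false),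
    fun h => ?_⟩
  have h2 := congrArg φ h
  simp only [map_mul, φ, PresentedGroup.toGroup.of, f] at h2
  revert h2
  simp
  decide

/-- Lifts of the images of non-commuting elements do not commute, by injectivity of `j`; so one of
the lifts or their commutator is hyperbolic. -/
theorem IsFuchsian.exists_hyperbolic {g : ℕ} (hg : 2 ≤ g) {j : SurfaceGroup g →* PSL(2, ℝ)}
    (hj : IsFuchsian j) : ∃ (γ : SurfaceGroup g) (A : SL(2, ℝ)), γ ≠ 1 ∧
      (QuotientGroup.mk A : PSL(2, ℝ)) = j γ ∧ 2 < |(A : Matrix (Fin 2) (Fin 2) ℝ).trace| := by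
  obtain ⟨x, y, hxy⟩ := SurfaceGroup.exists_not_commute hg
  obtain ⟨A, hA⟩ := QuotientGroup.mk_surjective (j x)
  obtain ⟨B, hB⟩ := QuotientGroup.mk_surjective (j y)
  have hAB : A * B ≠ B * A := fun h => by
    apply hxy
    apply hj.1
    rw [map_mul, map_mul, ← hA, ← hB, ← QuotientGroup.mk_mul, ← QuotientGroup.mk_mul, h]
  rcases exists_two_lt_abs_trace hAB with h | h | h
  · exact ⟨x, A, fun h1 => hxy (by simp [h1]), hA, h⟩
  · exact ⟨y, B, fun h1 => hxy (by simp [h1]), hB, h⟩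
  · refine ⟨x * y * x⁻¹ * y⁻¹, A * B * A⁻¹ * B⁻¹, fun h1 => hxy ?_, ?_, h⟩
    · rwa [mul_inv_eq_one, mul_inv_eq_iff_eq_mul] at h1
    · rw [map_mul, map_mul, map_mul, map_inv, map_inv, ← hA, ← hB]
      rfl

end Hyperbolic

/-! ### The action on the projective line -/

section Projective

open OnePoint Filter

theorem continuous_smul_onePoint (g : GL (Fin 2) ℝ) :
    Continuous fun z : OnePoint ℝ => g • z := by
  have hdet : g 0 0 * g 1 1 - g 0 1 * g 1 0 ≠ 0 := by
    have := g.det_ne_zero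
    rwa [Matrix.det_fin_two] at this
  have hco : Filter.coclosedCompact ℝ = Bornology.cobounded ℝ := by
    rw [Filter.coclosedCompact_eq_cocompact, Metric.cobounded_eq_cocompact]
  have hinf : Tendsto ((↑) : ℝ → OnePoint ℝ) (Bornology.cobounded ℝ) (𝓝 ∞) := by
    rw [← hco]; exact OnePoint.tendsto_coe_infty
  rw [continuous_iff_continuousAt]
  intro z
  induction z using OnePoint.rec with
  | infty =>
    rw [OnePoint.continuousAt_infty', hco, smul_infty_eq_ite]
    by_cases hc : g 1 0 = 0
    · rw [if_pos hc]
      have h11 : g 1 1 ≠ 0 := fun h => hdet (by rw [hc, h]; ring)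
      have h00 : g 0 0 ≠ 0 := fun h => hdet (by rw [hc, h]; ring)
      have e : ((fun z : OnePoint ℝ => g • z) ∘ ((↑) : ℝ → OnePoint ℝ)) =
          fun t : ℝ => (((g 0 0 * t + g 0 1) / g 1 1 : ℝ) : OnePoint ℝ) := by
        ext1 t
        simp [smul_some_eq_ite, hc, h11]
      rw [e]
      refine hinf.comp ?_
      rw [← tendsto_norm_atTop_iff_cobounded]
      have h1 : Tendsto (fun t : ℝ => |g 0 0| / |g 1 1| * ‖t‖ - |g 0 1| / |g 1 1|)
          (Bornology.cobounded ℝ) atTop :=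
        tendsto_atTop_add_const_right _ _
          (Tendsto.const_mul_atTop (by positivity) tendsto_norm_cobounded_atTop)
      refine tendsto_atTop_mono (fun t => ?_) h1
      rw [Real.norm_eq_abs, Real.norm_eq_abs, abs_div, div_mul_eq_mul_div, ← sub_div]
      gcongr
      have := abs_sub_abs_le_abs_sub (g 0 0 * t) (-g 0 1)
      rwa [abs_mul, abs_neg, sub_neg_eq_add] at this
    · rw [if_neg hc]
      have h1 : Tendsto (fun t : ℝ => g 1 0 * t + g 1 1) (Bornology.cobounded ℝ)
          (Bornology.cobounded ℝ) := by
        rw [← tendsto_norm_atTop_iff_cobounded]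
        have h1 : Tendsto (fun t : ℝ => |g 1 0| * ‖t‖ - |g 1 1|)
            (Bornology.cobounded ℝ) atTop :=
          tendsto_atTop_add_const_right _ _
            (Tendsto.const_mul_atTop (by positivity) tendsto_norm_cobounded_atTop)
        refine tendsto_atTop_mono (fun t => ?_) h1
        have := abs_sub_abs_le_abs_sub (g 1 0 * t) (-g 1 1)
        rwa [abs_mul, abs_neg, sub_neg_eq_add] at this
      have h2 : Tendsto (fun t : ℝ => g 0 0 / g 1 0 +
          (g 0 1 - g 0 0 * g 1 1 / g 1 0) * (g 1 0 * t + g 1 1)⁻¹) (Bornology.cobounded ℝ)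
          (𝓝 (g 0 0 / g 1 0)) := by
        have := ((tendsto_inv₀_cobounded.comp h1).const_mul
          (g 0 1 - g 0 0 * g 1 1 / g 1 0)).const_add (g 0 0 / g 1 0)
        simpa using this
      have h3 : ∀ᶠ t : ℝ in Bornology.cobounded ℝ, g 1 0 * t + g 1 1 ≠ 0 :=
        h1.eventually_ne_cobounded 0
      refine ((continuous_coe.tendsto _).comp h2).congr' ?_
      filter_upwards [h3] with t ht
      simp only [Function.comp_apply, smul_some_eq_ite, if_neg ht]
      congr 1
      field_simp
      ring
  | coe x =>
    rw [OnePoint.continuousAt_coe]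
    by_cases hx : g 1 0 * x + g 1 1 = 0
    · have hval : g • (x : OnePoint ℝ) = ∞ := by rw [smul_some_eq_ite, if_pos hx]
      rw [ContinuousAt, Function.comp_apply, hval, ← nhdsNE_sup_pure, tendsto_sup]
      constructor
      · have hc : g 1 0 ≠ 0 := fun h => by
          apply hdet
          rw [h] at hx ⊢
          have : g 1 1 = 0 := by linarith
          rw [this]; ring
        have hnum : g 0 0 * x + g 0 1 ≠ 0 := fun h => by
          apply hdet
          have e1 : g 1 1 = - (g 1 0 * x) := by linarith
          have e2 : g 0 1 = - (g 0 0 * x) := by linarith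
          rw [e1, e2]; ring
        have h1 : Tendsto (fun t : ℝ => |g 0 0 * t + g 0 1|) (𝓝[≠] x)
            (𝓝 |g 0 0 * x + g 0 1|) :=
          Tendsto.mono_left (Continuous.tendsto (by fun_prop) x) nhdsWithin_le_nhds
        have hden : ∀ t, g 1 0 * t + g 1 1 = g 1 0 * (t - x) := fun t => by linarith
        have h2 : Tendsto (fun t : ℝ => g 1 0 * t + g 1 1) (𝓝[≠] x) (𝓝[≠] 0) := by
          refine tendsto_nhdsWithin_iff.2 ⟨?_, ?_⟩
          · have : Tendsto (fun t : ℝ => g 1 0 * t + g 1 1) (𝓝 x) (𝓝 (g 1 0 * x + g 1 1)) :=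
              Continuous.tendsto (by fun_prop) x
            rw [hx] at this
            exact this.mono_left nhdsWithin_le_nhds
          · filter_upwards [self_mem_nhdsWithin] with t ht
            rw [hden]
            exact mul_ne_zero hc (sub_ne_zero.2 ht)
        have h3 := tendsto_norm_cobounded_atTop.comp (tendsto_inv₀_nhdsNE_zero.comp h2)
        have h4 := h1.pos_mul_atTop (abs_pos.2 hnum) h3
        have h5 : Tendsto (fun t : ℝ => (g 0 0 * t + g 0 1) / (g 1 0 * t + g 1 1)) (𝓝[≠] x)
            (Bornology.cobounded ℝ) := by
          rw [← tendsto_norm_atTop_iff_cobounded]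
          refine h4.congr fun t => ?_
          simp [div_eq_mul_inv]
        refine (hinf.comp h5).congr' ?_
        filter_upwards [self_mem_nhdsWithin] with t ht
        have : g 1 0 * t + g 1 1 ≠ 0 := by
          rw [hden]; exact mul_ne_zero hc (sub_ne_zero.2 ht)
        simp only [Function.comp_apply, smul_some_eq_ite, if_neg this]
      · rw [tendsto_pure_left]
        intro s hs
        simp only [Function.comp_apply, hval]
        exact mem_of_mem_nhds hs
    · have h1 : Tendsto (fun t : ℝ => (g 0 0 * t + g 0 1) / (g 1 0 * t + g 1 1)) (𝓝 x)
          (𝓝 ((g 0 0 * x + g 0 1) / (g 1 0 * x + g 1 1))) :=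
        Tendsto.div (Continuous.tendsto (by fun_prop) x) (Continuous.tendsto (by fun_prop) x) hx
      have h2 : ∀ᶠ t in 𝓝 x, g 1 0 * t + g 1 1 ≠ 0 :=
        (Continuous.tendsto (by fun_prop) x : Tendsto (fun t : ℝ => g 1 0 * t + g 1 1) (𝓝 x)
          (𝓝 (g 1 0 * x + g 1 1))).eventually_ne hx
      rw [ContinuousAt, Function.comp_apply, smul_some_eq_ite, if_neg hx]
      refine ((continuous_coe.tendsto _).comp h1).congr' ?_
      filter_upwards [h2] with t ht
      simp only [Function.comp_apply, smul_some_eq_ite, if_neg ht]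

end Projective

/-! ### Charts adapted to a hyperbolic element -/

section Chart

open OnePoint Filter

theorem IsCyclicallyOrdered.exists_chart {z : Fin 4 → OnePoint ℝ} (hz : IsCyclicallyOrdered z) :
    ∃ (H : GL (Fin 2) ℝ) (t : Fin 4 → ℝ), t 0 < t 3 ∧ t 3 < t 2 ∧ t 2 < t 1 ∧
      ∀ k, H • z k = (t k : OnePoint ℝ) := by
  obtain ⟨h, t, ht, hzt⟩ := hz
  have h01 : t 0 < t 1 := ht (by decide)
  have h12 : t 1 < t 2 := ht (by decide)
  have h23 : t 2 < t 3 := ht (by decide)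
  -- The map `t ↦ 1 / (t - c)` has its pole between `t 0` and `t 1`: it makes the first point
  -- negative, the others positive, and reverses the order of the others. The resulting order is
  -- that of the flags a, b, y, x.
  set c := (t 0 + t 1) / 2 with hc
  let w : GL (Fin 2) ℝ := Matrix.GeneralLinearGroup.mkOfDetNeZero !![0, 1; 1, -c] (by
    simp [Matrix.det_fin_two])
  have hne : ∀ k, t k - c ≠ 0 := by
    intro k
    fin_cases k <;> simp only [Fin.zero_eta, Fin.mk_one, Fin.reduceFinMk] <;>
      intro h <;> linarith
  refine ⟨w * h, fun k => 1 / (t k - c), ?_, ?_, ?_, fun k => ?_⟩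
  · exact (div_neg_of_pos_of_neg one_pos (by linarith)).trans (div_pos one_pos (by linarith))
  · exact one_div_lt_one_div_of_lt (by linarith) (by linarith)
  · exact one_div_lt_one_div_of_lt (by linarith) (by linarith)
  · rw [mul_smul, hzt, smul_some_eq_ite]
    have e0 : w 0 0 = 0 := rfl
    have e1 : w 0 1 = 1 := rfl
    have e2 : w 1 0 = 1 := rfl
    have e3 : w 1 1 = -c := rfl
    rw [e0, e1, e2, e3, if_neg (by rw [one_mul]; exact hne k)]
    congr 1
    ring

/-- `H` conjugates `A` to a lower triangular matrix whose second eigenvalue is the larger one. -/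
def IsAttractingChart (H : GL (Fin 2) ℝ) (A : SL(2, ℝ)) : Prop :=
  ∃ G : GL (Fin 2) ℝ, H * (A : GL (Fin 2) ℝ) * H⁻¹ = G ∧ G 0 1 = 0 ∧ G 0 0 * G 1 1 = 1 ∧
    |G 0 0| < |G 1 1|

/-- The translation `t ↦ t - p` of the projective line. -/
def translationGL (p : ℝ) : GL (Fin 2) ℝ :=
  Matrix.GeneralLinearGroup.mkOfDetNeZero !![1, -p; 0, 1] (by simp [Matrix.det_fin_two])

theorem translationGL_smul (p t : ℝ) :
    translationGL p • (t : OnePoint ℝ) = ((t - p : ℝ) : OnePoint ℝ) := by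
  have e0 : translationGL p 0 0 = 1 := rfl
  have e1 : translationGL p 0 1 = -p := rfl
  have e2 : translationGL p 1 0 = 0 := rfl
  have e3 : translationGL p 1 1 = 1 := rfl
  rw [smul_some_eq_ite, e0, e1, e2, e3, if_neg (by simp)]
  congr 1
  ring

/-- The quadratic equation says that `p` is fixed by `M`; the translation moves this fixed point to
`0`. -/
theorem translationGL_conj {M : GL (Fin 2) ℝ} {p : ℝ}
    (hp : M 1 0 * p ^ 2 + (M 1 1 - M 0 0) * p - M 0 1 = 0) (hdet : M 0 0 * M 1 1 - M 0 1 * M 1 0 = 1) :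
    ∃ G : GL (Fin 2) ℝ, translationGL p * M * (translationGL p)⁻¹ = G ∧ G 0 1 = 0 ∧
      G 0 0 * G 1 1 = 1 ∧ G 0 0 = M 0 0 - p * M 1 0 ∧ G 1 1 = M 1 1 + p * M 1 0 := by
  let G : GL (Fin 2) ℝ := Matrix.GeneralLinearGroup.mkOfDetNeZero
    !![M 0 0 - p * M 1 0, 0; M 1 0, M 1 1 + p * M 1 0] (by
      rw [Matrix.det_fin_two]
      simp only [Matrix.of_apply, Matrix.cons_val', Matrix.cons_val_zero, Matrix.cons_val_one,
        Matrix.cons_val_fin_one]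
      intro h
      have : (0 : ℝ) = 1 := by
        rw [← hdet, ← h]
        linear_combination (-M 1 0) * hp
      exact zero_ne_one this)
  have g0 : G 0 0 = M 0 0 - p * M 1 0 := rfl
  have g1 : G 0 1 = 0 := rfl
  have g2 : G 1 0 = M 1 0 := rfl
  have g3 : G 1 1 = M 1 1 + p * M 1 0 := rfl
  have e0 : translationGL p 0 0 = 1 := rfl
  have e1 : translationGL p 0 1 = -p := rfl
  have e2 : translationGL p 1 0 = 0 := rfl
  have e3 : translationGL p 1 1 = 1 := rfl
  refine ⟨G, ?_, g1, ?_, g0, g3⟩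
  · rw [mul_inv_eq_iff_eq_mul]
    ext i k
    rw [Units.val_mul, Units.val_mul, Matrix.mul_apply, Matrix.mul_apply, Fin.sum_univ_two,
      Fin.sum_univ_two]
    fin_cases i <;> fin_cases k <;>
      simp only [Fin.zero_eta, Fin.mk_one, g0, g1, g2, g3, e0, e1, e2, e3] <;>
      linarith
  · rw [g0, g3]
    linear_combination hdet - M 1 0 * hp

/-- In the chart `H`, finite fixed points of `A` are roots of a quadratic (or linear) equation of
discriminant tr² - 4 > 0. The eigenvalues have product 1 and a sum of modulus greater than 2, so
their moduli differ and the fixed point attracts for `A` or for its inverse. -/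
theorem exists_isAttractingChart (H : GL (Fin 2) ℝ) {A : SL(2, ℝ)}
    (hA : 2 < |(A : Matrix (Fin 2) (Fin 2) ℝ).trace|) :
    ∃ p : ℝ, IsAttractingChart (translationGL p * H) A ∨
      IsAttractingChart (translationGL p * H) A⁻¹ := by
  set M : GL (Fin 2) ℝ := H * (A : GL (Fin 2) ℝ) * H⁻¹ with hM
  have hMval : (M : Matrix (Fin 2) (Fin 2) ℝ) =
      (H : Matrix (Fin 2) (Fin 2) ℝ) * A * ((H⁻¹ : GL (Fin 2) ℝ) : Matrix (Fin 2) (Fin 2) ℝ) := rfl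
  have hdet : M 0 0 * M 1 1 - M 0 1 * M 1 0 = 1 := by
    rw [← Matrix.det_fin_two, hMval, Matrix.det_mul_right_comm, ← Units.val_mul, mul_inv_cancel,
      Units.val_one, one_mul]
    exact A.det_coe
  have htr : M 0 0 + M 1 1 = (A : Matrix (Fin 2) (Fin 2) ℝ).trace := by
    rw [← Matrix.trace_fin_two, hMval, Matrix.trace_mul_cycle, ← Units.val_mul, inv_mul_cancel,
      Units.val_one, one_mul]
  have htr2 : 4 < (M 0 0 + M 1 1) ^ 2 := by
    rw [htr]
    have := sq_lt_sq' (by linarith) hA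
    rw [sq_abs] at this; linarith
  have hroot : ∃ p : ℝ, M 1 0 * p ^ 2 + (M 1 1 - M 0 0) * p - M 0 1 = 0 := by
    by_cases hc : M 1 0 = 0
    · have hne : M 1 1 - M 0 0 ≠ 0 := fun h => by
        rw [hc] at hdet
        have : M 1 1 = M 0 0 := by linarith
        rw [this] at hdet htr2
        nlinarith
      refine ⟨M 0 1 / (M 1 1 - M 0 0), ?_⟩
      rw [hc]; field_simp; ring
    · have hd : 0 ≤ (M 0 0 + M 1 1) ^ 2 - 4 := by linarith
      refine ⟨(M 0 0 - M 1 1 + Real.sqrt ((M 0 0 + M 1 1) ^ 2 - 4)) / (2 * M 1 0), ?_⟩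
      have hs := Real.sq_sqrt hd
      field_simp
      linear_combination hs + 4 * hdet
  obtain ⟨p, hp⟩ := hroot
  refine ⟨p, ?_⟩
  obtain ⟨G, hG, hG01, hGdet, hG0, hG1⟩ := translationGL_conj hp hdet
  have hne : |G 0 0| ≠ |G 1 1| := by
    intro h
    have h1 : G 0 0 + G 1 1 = M 0 0 + M 1 1 := by rw [hG0, hG1]; ring
    rw [← h1] at htr2
    rcases abs_eq_abs.1 h with h2 | h2 <;> rw [h2] at hGdet htr2 <;> nlinarith
  rcases lt_or_gt_of_ne hne with hlt | hgt
  · left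
    refine ⟨G, ?_, hG01, hGdet, hlt⟩
    rw [← hG, hM]; group
  · right
    have hinv : M⁻¹ = H * ((A⁻¹ : SL(2, ℝ)) : GL (Fin 2) ℝ) * H⁻¹ := by
      rw [hM, map_inv]; group
    have hMi : ((M⁻¹ : GL (Fin 2) ℝ) : Matrix (Fin 2) (Fin 2) ℝ) =
        !![M 1 1, -M 0 1; -M 1 0, M 0 0] := by
      rw [Matrix.coe_units_inv, Matrix.inv_def, Matrix.det_fin_two, hdet, Matrix.adjugate_fin_two]
      simp
    have i0 : (M⁻¹ : GL (Fin 2) ℝ) 0 0 = M 1 1 := by rw [hMi]; rfl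
    have i1 : (M⁻¹ : GL (Fin 2) ℝ) 0 1 = -M 0 1 := by rw [hMi]; rfl
    have i2 : (M⁻¹ : GL (Fin 2) ℝ) 1 0 = -M 1 0 := by rw [hMi]; rfl
    have i3 : (M⁻¹ : GL (Fin 2) ℝ) 1 1 = M 0 0 := by rw [hMi]; rfl
    obtain ⟨G', hG', hG01', hGdet', hG0', hG1'⟩ := translationGL_conj (M := M⁻¹) (p := p)
      (by rw [i0, i1, i2, i3]; linarith) (by rw [i0, i1, i2, i3]; linarith)
    refine ⟨G', ?_, hG01', hGdet', ?_⟩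
    · rw [← hG', hinv]; group
    · rw [hG0', hG1', i0, i2, i3, mul_neg, sub_neg_eq_add, ← sub_eq_add_neg, ← hG0, ← hG1]
      exact hgt

theorem exists_contraction {G : GL (Fin 2) ℝ} (h01 : G 0 1 = 0) (hdet : G 0 0 * G 1 1 = 1)
    (hlt : |G 0 0| < |G 1 1|) : ∃ η > 0, ∃ c : ℝ, 0 ≤ c ∧ c < 1 ∧ ∀ t : ℝ, |t| ≤ η → ∀ n : ℕ,
      ∃ s : ℝ, G ^ n • (t : OnePoint ℝ) = s ∧ |s| ≤ c ^ n * |t| ∧ (0 < t → 0 < s) := by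
  set α := G 0 0 with hα
  set δ := G 1 1 with hδ
  set β := G 1 0 with hβ
  -- For `|t| ≤ η` the denominator of `t ↦ α * t / (β * t + δ)` has modulus at least the mean `m` of
  -- `|α|` and `|δ|`, whence the contraction ratio `|α| / m < 1`.
  set m := (|δ| + |α|) / 2 with hm
  have hα0 : 0 ≤ |α| := abs_nonneg α
  have hm0 : 0 < m := by rw [hm]; linarith
  set η := (|δ| - |α|) / (2 * (|β| + 1)) with hη
  have hη0 : 0 < η := div_pos (by linarith) (by positivity)
  have hβη : |β| * η ≤ (|δ| - |α|) / 2 := by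
    rw [hη, mul_div_assoc', div_le_div_iff₀ (by positivity) two_pos]
    nlinarith [abs_nonneg β]
  have step : ∀ t : ℝ, |t| ≤ η → ∃ s : ℝ, G • (t : OnePoint ℝ) = s ∧ |s| ≤ |α| / m * |t| ∧
      (0 < t → 0 < s) := by
    intro t ht
    have h1 : |β * t| ≤ (|δ| - |α|) / 2 := by
      rw [abs_mul]
      exact (mul_le_mul_of_nonneg_left ht (abs_nonneg β)).trans hβη
    have h2 : m ≤ |β * t + δ| := by
      have := abs_sub_abs_le_abs_sub δ (-(β * t))
      rw [abs_neg, sub_neg_eq_add, add_comm δ] at this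
      rw [hm]; linarith
    have hne : β * t + δ ≠ 0 := fun h => by
      rw [h, abs_zero] at h2; linarith
    refine ⟨α * t / (β * t + δ), ?_, ?_, fun h0 => ?_⟩
    · rw [smul_some_eq_ite, if_neg hne, h01, add_zero]
    · rw [abs_div, abs_mul, div_mul_eq_mul_div]
      gcongr
    -- Since `α * δ = 1`, the multiplier at `0` is positive, and the choice of `η` keeps the
    -- perturbation `α * β * t` below `1` in modulus. So an orbit starting at a positive parameter
    -- stays positive.
    · have hαδ : 0 < α * (β * t + δ) := by
        have h3 : |α * (β * t)| < 1 := by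
          rw [abs_mul]
          have h4 : |α| * |δ| = 1 := by rw [← abs_mul, hdet, abs_one]
          have hαpos : 0 < |α| := by
            rcases hα0.lt_or_eq with h | h
            · exact h
            · rw [← h] at h4; simp at h4
          nlinarith
        have := (abs_lt.1 h3).1
        have e : α * (β * t + δ) = α * (β * t) + α * δ := by ring
        rw [e, hdet]; linarith
      have e : α * t / (β * t + δ) = t * (α * (β * t + δ)) / (β * t + δ) ^ 2 := by
        field_simp
      rw [e]
      positivity
  have hc1 : |α| / m < 1 := by
    rw [div_lt_one hm0, hm]; linarith
  have hc0 : 0 ≤ |α| / m := by positivity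
  refine ⟨η, hη0, |α| / m, hc0, hc1, fun t ht n => ?_⟩
  induction n with
  | zero => exact ⟨t, by simp, by simp, fun h => h⟩
  | succ n ih =>
    obtain ⟨s, hs1, hs2, hs3⟩ := ih
    have hs : |s| ≤ η := by
      refine (hs2.trans ?_).trans ht
      exact mul_le_of_le_one_left (abs_nonneg t) (pow_le_one₀ hc0 hc1.le)
    obtain ⟨s', h1, h2, h3⟩ := step s hs
    refine ⟨s', ?_, ?_, fun h => h3 (hs3 h)⟩
    · rw [pow_succ', mul_smul, hs1, h1]
    · calc |s'| ≤ |α| / m * |s| := h2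
        _ ≤ |α| / m * ((|α| / m) ^ n * |t|) := mul_le_mul_of_nonneg_left hs2 hc0
        _ = (|α| / m) ^ (n + 1) * |t| := by ring

theorem IsAttractingChart.dynamics {H : GL (Fin 2) ℝ} {A : SL(2, ℝ)} (h : IsAttractingChart H A) :
    IsAttractingFixedPoint (A : GL (Fin 2) ℝ) (H⁻¹ • ((0 : ℝ) : OnePoint ℝ)) ∧
      ∃ η > 0, ∀ t : ℝ, 0 < t → t ≤ η → ∃ s : ℕ → ℝ, (∀ n, 0 < s n) ∧ Tendsto s atTop (𝓝 0) ∧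
        ∀ n, H⁻¹ • (s n : OnePoint ℝ) = ((A ^ n : SL(2, ℝ)) : GL (Fin 2) ℝ) • (H⁻¹ • (t : OnePoint ℝ)) := by
  obtain ⟨G, hG, h01, hdet, hlt⟩ := h
  obtain ⟨η, hη, c, hc0, hc1, hs⟩ := exists_contraction h01 hdet hlt
  have hA : ∀ n : ℕ, (A : GL (Fin 2) ℝ) ^ n = H⁻¹ * G ^ n * H := by
    intro n
    have h1 : (A : GL (Fin 2) ℝ) = H⁻¹ * G * (H⁻¹)⁻¹ := by rw [← hG]; group
    rw [h1, conj_pow, inv_inv]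
  have hA' : ∀ (n : ℕ) (w : OnePoint ℝ), (A : GL (Fin 2) ℝ) ^ n • (H⁻¹ • w) = H⁻¹ • (G ^ n • w) := by
    intro n w
    rw [hA, mul_smul, mul_smul, smul_inv_smul]
  have hlim : ∀ (t : ℝ), |t| ≤ η → ∀ s : ℕ → ℝ, (∀ n, |s n| ≤ c ^ n * |t|) →
      Tendsto s atTop (𝓝 0) := by
    intro t _ s h1
    refine squeeze_zero_norm (a := fun n => c ^ n * |t|) (fun n => by simpa using h1 n) ?_
    simpa using (tendsto_pow_atTop_nhds_zero_of_lt_one hc0 hc1).mul_const |t|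
  refine ⟨⟨?_, ?_⟩, η, hη, fun t ht0 htη => ?_⟩
  · have := hA' 1 ((0 : ℝ) : OnePoint ℝ)
    rw [pow_one] at this
    rw [this]
    obtain ⟨s, h1, h2, -⟩ := hs 0 (by simpa using hη.le) 1
    have : s = 0 := by simpa using h2
    rw [h1, this]
  · have hopen : ((↑) : ℝ → OnePoint ℝ) '' Set.Ioo (-η) η ∈ 𝓝 ((0 : ℝ) : OnePoint ℝ) :=
      OnePoint.isOpenEmbedding_coe.image_mem_nhds.2 (Ioo_mem_nhds (by linarith) hη)
    have hcont := (continuous_smul_onePoint H).tendsto (H⁻¹ • ((0 : ℝ) : OnePoint ℝ))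
    simp only [smul_inv_smul] at hcont
    filter_upwards [hcont hopen] with w hw
    obtain ⟨t, ht, htw⟩ := hw
    have hw' : w = H⁻¹ • (t : OnePoint ℝ) := by
      rw [htw, inv_smul_smul]
    have htη : |t| ≤ η := abs_le.2 ⟨ht.1.le, ht.2.le⟩
    choose s h1 h2 _ using hs t htη
    have h3 := ((continuous_smul_onePoint H⁻¹).tendsto ((0 : ℝ) : OnePoint ℝ)).comp
      ((continuous_coe.tendsto (0 : ℝ)).comp (hlim t htη s h2))
    refine h3.congr fun n => ?_
    rw [hw', hA', h1]
    rfl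
  · have htη' : |t| ≤ η := by rwa [abs_of_pos ht0]
    choose s h1 h2 h3 using hs t htη'
    refine ⟨s, fun n => h3 n ht0, hlim t htη' s h2, fun n => ?_⟩
    rw [map_pow, hA', h1]

end Chart

/-! ### Signs of determinants along a curve of flags -/

section Signs

variable {V : Type*} [NormedAddCommGroup V] [NormedSpace ℝ V] {d : ℕ}

/-- The first `i`, `j` and `k` vectors of the frame `w` at the parameters `τ 0`, `τ 1` and `τ 2`,
followed by its first vectors at the parameters `τ 3`, `τ 4`, …. -/
def confluent (w : ℕ → ℝ → V) (i j k : ℕ) (τ : ℕ → ℝ) : ℕ → V := fun t =>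
  if t < i then w t (τ 0) else if t < i + j then w (t - i) (τ 1) else
    if t < i + j + k then w (t - i - j) (τ 2) else w 0 (τ (3 + (t - i - j - k)))

theorem continuous_basis_det [FiniteDimensional ℝ V] (b : Module.Basis (Fin d) ℝ V) {X : Type*}
    [TopologicalSpace X] {f : X → Fin d → V} (hf : ∀ t, Continuous fun x => f x t) :
    Continuous fun x => b.det (f x) := by
  simp only [Module.Basis.det_apply]
  refine Continuous.matrix_det (continuous_matrix fun i t => ?_)
  have h : Continuous (b.coord i) := LinearMap.continuous_of_finiteDimensional _
  exact h.comp (hf t)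

theorem convex_setOf_strictMono : Convex ℝ {τ : ℕ → ℝ | StrictMono τ} := by
  intro τ hτ σ hσ a b ha hb hab m n hmn
  have h1 := hτ hmn
  have h2 := hσ hmn
  simp only [Pi.add_apply, Pi.smul_apply, smul_eq_mul]
  rcases ha.lt_or_eq with h | h
  · nlinarith
  · subst h
    have : b = 1 := by linarith
    subst this; linarith

variable [FiniteDimensional ℝ V] (b : Module.Basis (Fin d) ℝ V)

/-- The increasing sequences form a convex, hence connected, set, on which the determinant is
continuous without zeros. -/
theorem det_confluent_mul_pos {w : ℕ → ℝ → V} (hw : ∀ m, Continuous (w m)) {i j k : ℕ}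
    (hne : ∀ τ : ℕ → ℝ, StrictMono τ → b.det (fun t : Fin d => confluent w i j k τ t) ≠ 0)
    {τ σ : ℕ → ℝ} (hτ : StrictMono τ) (hσ : StrictMono σ)
    {κ : ℝ} (h : 0 < κ * b.det (fun t : Fin d => confluent w i j k τ t)) :
    0 < κ * b.det (fun t : Fin d => confluent w i j k σ t) := by
  have hκ : κ ≠ 0 := fun h0 => by simp [h0] at h
  have hc : Continuous fun τ : ℕ → ℝ => κ * b.det (fun t : Fin d => confluent w i j k τ t) := by
    refine continuous_const.mul (continuous_basis_det b fun t => ?_)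
    simp only [confluent]
    split_ifs <;> exact (hw _).comp (continuous_apply _)
  by_contra hcon
  push Not at hcon
  have hpre : IsPreconnected {τ : ℕ → ℝ | StrictMono τ} := convex_setOf_strictMono.isPreconnected
  obtain ⟨ρ, hρ, h0⟩ := hpre.intermediate_value (a := σ) (b := τ) hσ hτ hc.continuousOn
    (show (0 : ℝ) ∈ Set.Icc _ _ from ⟨hcon, h.le⟩)
  exact mul_ne_zero hκ (hne ρ hρ) h0

/-- If the frame `w` varies continuously, if all determinants formed from it are non-zero, and if
its first vector at small positive parameters approximates the flag at `0`, then all determinants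
of triples have the same sign. -/
theorem exists_forall_det_cat3_pos {w : ℕ → ℝ → V} (hw : ∀ m, Continuous (w m))
    (hne : ∀ i j k, i + j + k ≤ d → ∀ τ : ℕ → ℝ, StrictMono τ →
      b.det (fun t : Fin d => confluent w i j k τ t) ≠ 0)
    (hfr : ∀ k < d, ∀ F : V →ₗ[ℝ] ℝ, (∀ l < k, F (w l 0) = 0) → F (w k 0) ≠ 0 → ∀ η > 0,
      ∃ s, 0 < s ∧ s < η ∧ 0 < F (w 0 s) * F (w k 0)) :
    ∃ κ : ℝ, ∀ i j k, i + j + k = d → ∀ t₀ t₁ t₂ : ℝ, t₀ < t₁ → t₁ < t₂ →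
      0 < κ * b.det (fun t : Fin d =>
        cat3 i j (fun m => w m t₀) (fun m => w m t₁) (fun m => w m t₂) t) := by
  -- The shift by `2` puts the third block, the one to be lengthened, at the parameter `0`, where
  -- the flag is approximated.
  let τ₀ : ℕ → ℝ := fun m => (m : ℝ) - 2
  have hτ₀ : StrictMono τ₀ := fun m n h => by
    have : (m : ℝ) < n := Nat.cast_lt.2 h
    simp only [τ₀]; linarith
  let κ := b.det (fun t : Fin d => confluent w 0 0 0 τ₀ t)
  let P : ℕ → ℕ → ℕ → Prop := fun i j k => ∀ τ : ℕ → ℝ, StrictMono τ →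
    0 < κ * b.det (fun t : Fin d => confluent w i j k τ t)
  have h000 : P 0 0 0 := fun τ hτ =>
    det_confluent_mul_pos b hw (hne 0 0 0 (by omega)) hτ₀ hτ
      (mul_self_pos.2 (hne 0 0 0 (by omega) τ₀ hτ₀))
  -- An empty block may sit at any parameter: insert an unused one to the left of `τ 0`, in place of
  -- the unused `τ 2`.
  have hshift : ∀ i j, P 0 i j → P i j 0 := by
    intro i j h τ hτ
    let σ : ℕ → ℝ := fun m => if m = 0 then τ 0 - 1 else if m = 1 then τ 0 else
      if m = 2 then τ 1 else τ m
    have h01 : τ 0 < τ 1 := hτ (by norm_num)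
    have h12 : τ 1 < τ 2 := hτ (by norm_num)
    have h23 : τ 2 < τ 3 := hτ (by norm_num)
    have hσ : StrictMono σ := by
      refine strictMono_nat_of_lt_succ fun n => ?_
      rcases n with _ | _ | _ | n
      · simp [σ]
      · simp [σ]; linarith
      · simp [σ]; linarith
      · simp only [σ]
        rw [if_neg (by omega), if_neg (by omega), if_neg (by omega), if_neg (by omega),
          if_neg (by omega), if_neg (by omega)]
        exact hτ (by omega)
    have e : (fun t : Fin d => confluent w i j 0 τ t) = fun t : Fin d => confluent w 0 i j σ t := by
      ext1 t
      have hσ3 : ∀ m, σ (3 + m) = τ (3 + m) := fun m => by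
        simp only [σ]
        rw [if_neg (by omega), if_neg (by omega), if_neg (by omega)]
      have h1 : σ 1 = τ 0 := by simp [σ]
      have h2 : σ 2 = τ 1 := by simp [σ]
      simp only [confluent, hσ3, h1, h2, Nat.not_lt_zero, if_false, Nat.zero_add, Nat.sub_zero,
        Nat.add_zero]
      split_ifs <;> rfl
    rw [e]
    exact h σ hσ
  -- As a linear form `F` of the vector in slot `i + j + k`, the determinant vanishes on the first
  -- `k` vectors of the frame at `0`. By `hfr`, the vector `w k 0` in this slot gives the same sign
  -- as `w 0 s` for some small `s`, and the latter is a determinant of type (i, j, k).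
  have hstep : ∀ i j k, i + j + k < d → P i j k → P i j (k + 1) := by
    intro i j k hd h τ hτ
    refine det_confluent_mul_pos b hw (hne i j (k + 1) (by omega)) hτ₀ hτ ?_
    have hlt : i + j + k < d := hd
    let v : Fin d → V := fun t => confluent w i j (k + 1) τ₀ t
    let F : V →ₗ[ℝ] ℝ := b.det.toMultilinearMap.toLinearMap v ⟨i + j + k, hlt⟩
    have hF : ∀ x, F x = b.det (Function.update v ⟨i + j + k, hlt⟩ x) := fun x => rfl
    have hτ2 : τ₀ 2 = 0 := by simp [τ₀]
    have hv : ∀ l (hl : l < k + 1), v ⟨i + j + l, by omega⟩ = w l 0 := by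
      intro l hl
      simp only [v, confluent]
      rw [if_neg (by omega), if_neg (by omega), if_pos (by omega), hτ2]
      congr 1; omega
    have hFk : F (w k 0) = b.det v := by
      rw [hF, ← hv k (by omega), Function.update_eq_self]
    have hFl : ∀ l < k, F (w l 0) = 0 := by
      intro l hl
      rw [hF, ← hv l (by omega)]
      refine b.det.map_update_self v ?_
      intro heq
      have := congrArg Fin.val heq
      simp at this; omega
    have hFne : F (w k 0) ≠ 0 := by
      rw [hFk]
      exact hne i j (k + 1) (by omega) τ₀ hτ₀
    obtain ⟨s, hs0, hs1, hs⟩ := hfr k (by omega) F hFl hFne 1 one_pos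
    -- The parameter `s` is inserted between `τ₀ 2 = 0` and `τ₀ 3 = 1`, and the later parameters
    -- move up by one index.
    let σ : ℕ → ℝ := fun m => if m < 3 then τ₀ m else if m = 3 then s else τ₀ (m - 1)
    have hσ : StrictMono σ := by
      refine strictMono_nat_of_lt_succ fun n => ?_
      rcases n with _ | _ | _ | _ | n
      · simp [σ, τ₀]
      · simp [σ, τ₀]
      · simp [σ, τ₀]; exact hs0
      · simp [σ, τ₀]; linarith
      · simp only [σ]
        rw [if_neg (by omega), if_neg (by omega), if_neg (by omega), if_neg (by omega)]
        exact hτ₀ (by omega)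
    have e : (fun t : Fin d => confluent w i j k σ t) =
        Function.update v ⟨i + j + k, hlt⟩ (w 0 s) := by
      ext1 t
      by_cases ht : t = ⟨i + j + k, hlt⟩
      · subst ht
        rw [Function.update_self]
        simp only [confluent]
        rw [if_neg (by omega), if_neg (by omega), if_neg (by omega)]
        have : 3 + (i + j + k - i - j - k) = 3 := by omega
        rw [this]
        simp [σ]
      · rw [Function.update_of_ne ht]
        have ht' : (t : ℕ) ≠ i + j + k := fun h => ht (Fin.ext h)
        have s0 : σ 0 = τ₀ 0 := by simp [σ]
        have s1 : σ 1 = τ₀ 1 := by simp [σ]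
        have s2 : σ 2 = τ₀ 2 := by simp [σ]
        simp only [v, confluent, s0, s1, s2]
        split_ifs with c1 c2 c3 c4 c5
        · rfl
        · rfl
        · rfl
        · omega
        · omega
        · congr 1
          simp only [σ]
          rw [if_neg (by omega), if_neg (by omega)]
          congr 1
          omega
    have h1 := h σ hσ
    rw [e, ← hF] at h1
    have h2 : 0 < (κ * F (w 0 s)) * (F (w 0 s) * F (w k 0)) := mul_pos h1 hs
    have h3 : (κ * F (w 0 s)) * (F (w 0 s) * F (w k 0)) =
        (κ * F (w k 0)) * (F (w 0 s)) ^ 2 := by ring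
    rw [h3, hFk] at h2
    exact pos_of_mul_pos_left h2 (sq_nonneg _)
  have hall : ∀ i j, P i j 0 → ∀ k, i + j + k ≤ d → P i j k := by
    intro i j h k
    induction k with
    | zero => exact fun _ => h
    | succ k ih => exact fun hk => hstep i j k (by omega) (ih (by omega))
  -- Only the third block can be lengthened, so each block is built there and then shifted to the
  -- left to make room for the next.
  have h00 : ∀ k ≤ d, P 0 0 k := fun k hk => hall 0 0 h000 k (by omega)
  have h0 : ∀ j k, j + k ≤ d → P 0 j k := fun j k hjk =>
    hall 0 j (hshift 0 j (h00 j (by omega))) k (by omega)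
  refine ⟨κ, fun i j k hijk t₀ t₁ t₂ h01 h12 => ?_⟩
  let τ : ℕ → ℝ := fun m => if m = 0 then t₀ else if m = 1 then t₁ else t₂ + (m - 2)
  have hτ : StrictMono τ := by
    refine strictMono_nat_of_lt_succ fun n => ?_
    rcases n with _ | _ | n
    · simp [τ]; exact h01
    · simp [τ]; linarith
    · simp [τ]
  have h := hall i j (hshift i j (h0 i j (by omega))) k hijk.le τ hτ
  have e : (fun t : Fin d => confluent w i j k τ t) = fun t : Fin d =>
      cat3 i j (fun m => w m t₀) (fun m => w m t₁) (fun m => w m t₂) t := by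
    ext1 t
    have a0 : τ 0 = t₀ := by simp [τ]
    have a1 : τ 1 = t₁ := by simp [τ]
    have a2 : τ 2 = t₂ := by simp [τ]
    simp only [confluent, cat3, a0, a1, a2]
    split_ifs <;> first | rfl | omega
  rw [e] at h
  exact h

end Signs

/-! ### Approximation of a flag by points along an orbit of a loxodromic map -/

section Orbit

open Filter

variable {V : Type*} [AddCommGroup V] [Module ℝ V] {d : ℕ}

/-- The terms before `k` vanish, and those after `k` belong to eigenvalues of smaller modulus. -/
theorem tendsto_sum_pow_mul_div {ev c f : Fin d → ℝ} (hev : StrictAnti fun i => |ev i|) {k : Fin d}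
    (hk : ev k ≠ 0) (hf : ∀ l < k, f l = 0) :
    Tendsto (fun n : ℕ => (∑ l, ev l ^ n * c l * f l) / ev k ^ n) atTop (𝓝 (c k * f k)) := by
  classical
  have h1 : ∀ n : ℕ, (∑ l, ev l ^ n * c l * f l) / ev k ^ n =
      ∑ l, (ev l / ev k) ^ n * (c l * f l) := by
    intro n
    rw [Finset.sum_div]
    refine Finset.sum_congr rfl fun l _ => ?_
    rw [div_pow]; ring
  have h2 : Tendsto (fun n : ℕ => ∑ l, (ev l / ev k) ^ n * (c l * f l)) atTop
      (𝓝 (∑ l, if l = k then c l * f l else 0)) := by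
    refine tendsto_finsetSum _ fun l _ => ?_
    rcases lt_trichotomy l k with h | h | h
    · rw [if_neg h.ne, hf l h]; simp
    · subst h; simp [div_self hk]
    · rw [if_neg h.ne']
      have : |ev l / ev k| < 1 := by
        rw [abs_div, div_lt_one (abs_pos.2 hk)]
        exact hev h
      simpa using (tendsto_pow_atTop_nhds_zero_of_abs_lt_one this).mul_const (c l * f l)
  simp only [h1]
  simpa using h2

/-- Let `x n` be points on the lines spanned by `T ^ n v` that converge to `0` in a parameter
`s n`. For a suitable sign `ε`, a linear form that vanishes on the first `k` vectors of a frame of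
the attracting flag of `T` takes infinitely often values on `x n` whose sign agrees with that of
its value at the next vector of the frame, up to `ε`. -/
theorem exists_sign_of_orbit {T : V →ₗ[ℝ] V} {ev : Fin d → ℝ} {e : Module.Basis (Fin d) ℝ V}
    (hev : StrictAnti fun i => |ev i|) (hev0 : ∀ i, ev i ≠ 0) (hT : ∀ i, T (e i) = ev i • e i)
    {w : ℕ → V} (hw : ∀ i ≤ d, initSpan w i = Submodule.span ℝ (e '' {l | (l : ℕ) < i}))
    (hlin : LinearIndependent ℝ fun t : Fin d => w t)
    {k : Fin d} {v : V} (hv : e.repr v k ≠ 0) {x : ℕ → V} {μ : ℕ → ℝ} (hμ : ∀ n, μ n ≠ 0)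
    (hx : ∀ n, x n = μ n • (T ^ n) v) {s : ℕ → ℝ}
    (hs : Tendsto s atTop (𝓝 0)) :
    ∃ ε : ℝ, (ε = 1 ∨ ε = -1) ∧ ∀ F : V →ₗ[ℝ] ℝ, (∀ l < (k : ℕ), F (w l) = 0) → F (w k) ≠ 0 →
      ∀ η > 0, ∃ n, s n < η ∧ 0 < ε * (F (x n) * F (w k)) := by
  have hTn : ∀ n i, (T ^ n) (e i) = ev i ^ n • e i := by
    intro n i
    induction n with
    | zero => simp
    | succ n ih => rw [pow_succ', Module.End.mul_apply, ih, map_smul, hT, smul_smul, pow_succ]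
  set c : Fin d → ℝ := fun i => e.repr v i with hc
  have hFx : ∀ (F : V →ₗ[ℝ] ℝ) n, F (x n) = μ n * ∑ l, ev l ^ n * c l * F (e l) := by
    intro F n
    rw [hx, map_smul, smul_eq_mul]
    congr 1
    conv_lhs => rw [← e.sum_repr v]
    simp only [map_sum, map_smul, hTn, smul_eq_mul, hc]
    exact Finset.sum_congr rfl fun l _ => by ring
  set α := e.repr (w k) k with hα
  have hwk : w k ∈ Submodule.span ℝ (e '' {l | (l : ℕ) < k + 1}) := by
    rw [← hw _ k.2]; exact mem_initSpan (Nat.lt_succ_self _)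
  have hα0 : α ≠ 0 := by
    intro h0
    have h1 : w k ∈ Submodule.span ℝ (e '' {l | (l : ℕ) < k}) := by
      rw [Module.Basis.mem_span_image] at hwk ⊢
      intro l hl
      have h2 := hwk hl
      simp only [Set.mem_ofPred_eq] at h2 ⊢
      refine lt_of_le_of_ne (by omega) fun heq => ?_
      have : l = k := Fin.ext heq
      subst this
      exact Finsupp.mem_support_iff.1 hl h0
    rw [← hw _ k.2.le] at h1
    obtain ⟨g, hg⟩ := mem_initSpan_iff.1 h1
    have h3 := hlin.notMem_span_image (s := {l | l < k}) (x := k) (by simp)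
    apply h3
    rw [← hg]
    refine Submodule.sum_mem _ fun l _ => Submodule.smul_mem _ _ (Submodule.subset_span ?_)
    exact ⟨⟨l, by omega⟩, Fin.lt_def.2 l.2, rfl⟩
  have hFe : ∀ F : V →ₗ[ℝ] ℝ, (∀ l < (k : ℕ), F (w l) = 0) →
      (∀ l < k, F (e l) = 0) ∧ F (w k) = α * F (e k) := by
    intro F hF
    have h1 : ∀ l < k, F (e l) = 0 := by
      intro l hl
      have h2 : e l ∈ initSpan w k := by
        rw [hw _ k.2.le]
        exact Submodule.subset_span ⟨l, hl, rfl⟩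
      have h3 : initSpan w k ≤ LinearMap.ker F := by
        refine Submodule.span_le.2 ?_
        rintro _ ⟨m, rfl⟩
        exact hF m m.2
      exact h3 h2
    refine ⟨h1, ?_⟩
    conv_lhs => rw [← e.sum_repr (w k)]
    rw [map_sum, Finset.sum_eq_single k]
    · rw [map_smul, smul_eq_mul]
    · intro l _ hl
      rw [map_smul, smul_eq_mul]
      rcases lt_or_gt_of_ne hl with h | h
      · rw [h1 l h, mul_zero]
      · have : e.repr (w k) l = 0 := by
          by_contra hne
          have := (Module.Basis.mem_span_image _).1 hwk (Finsupp.mem_support_iff.2 hne)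
          simp only [Set.mem_ofPred_eq] at this
          have : (k : ℕ) < l := h
          omega
        rw [this, zero_mul]
    · simp
  -- For large `n`, `F (x n) * F (w k)` has the sign of `a n`, the remaining factor tending to `F (e
  -- k) ^ 2`. As `a n` does not involve `F`, one sign `ε` serves all `F`; it may alternate with `n`,
  -- so it is only asked to occur infinitely often.
  set a : ℕ → ℝ := fun n => μ n * ev k ^ n * c k * α with ha
  have ha0 : ∀ n, a n ≠ 0 := fun n =>
    mul_ne_zero (mul_ne_zero (mul_ne_zero (hμ n) (pow_ne_zero _ (hev0 k))) hv) hα0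
  have hfreq : ∃ ε : ℝ, (ε = 1 ∨ ε = -1) ∧ ∃ᶠ n in atTop, 0 < ε * a n := by
    by_cases h : ∃ᶠ n in atTop, 0 < a n
    · exact ⟨1, Or.inl rfl, by simpa using h⟩
    · refine ⟨-1, Or.inr rfl, Eventually.frequently ?_⟩
      rw [not_frequently] at h
      filter_upwards [h] with n hn
      have := lt_of_le_of_ne (not_lt.1 hn) (ha0 n)
      linarith
  obtain ⟨ε, hε, hfr⟩ := hfreq
  refine ⟨ε, hε, fun F hF hne η hη => ?_⟩
  obtain ⟨h1, h2⟩ := hFe F hF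
  have hek : F (e k) ≠ 0 := fun h0 => hne (by rw [h2, h0, mul_zero])
  have hlim := (tendsto_sum_pow_mul_div (c := c) (f := fun l => F (e l)) hev (hev0 k) h1).mul_const
    (F (e k) / c k)
  have hlim' : c k * F (e k) * (F (e k) / c k) = F (e k) ^ 2 := by
    field_simp [show c k ≠ 0 from hv]
  rw [hlim'] at hlim
  have hpos : ∀ᶠ n in atTop, 0 < (∑ l, ev l ^ n * c l * F (e l)) / ev k ^ n * (F (e k) / c k) :=
    hlim.eventually (lt_mem_nhds (by positivity))
  obtain ⟨n, hn1, hn2, hn3⟩ := (hfr.and_eventually (hpos.and (hs.eventually_lt_const hη))).exists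
  refine ⟨n, hn3, ?_⟩
  have key : ε * (F (x n) * F (w k)) =
      (ε * a n) * ((∑ l, ev l ^ n * c l * F (e l)) / ev k ^ n * (F (e k) / c k)) := by
    rw [hFx, h2, ha]
    have := pow_ne_zero n (hev0 k)
    have hck : c k ≠ 0 := hv
    field_simp
  rw [key]
  exact mul_pos hn1 hn2

end Orbit

/-! ### Continuous frames along a curve of flags -/

section ContinuousFrames

open Filter

/-- If the complement `U t` of `W` varies continuously, so does the projection of a vector to
`U t` along `W`. -/
theorem exists_continuous_proj {E X : Type*} [NormedAddCommGroup E] [InnerProductSpace ℝ E]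
    [FiniteDimensional ℝ E] [TopologicalSpace X] {U : X → Submodule ℝ E} {W : Submodule ℝ E}
    (hU : Continuous fun t => (U t).starProjection) (hUW : ∀ t, IsCompl (U t) W) (g : E) :
    ∃ v : X → E, Continuous v ∧ ∀ t, v t ∈ U t ∧ g - v t ∈ W := by
  have hex : ∀ t, ∃ v ∈ U t, g - v ∈ W := by
    intro t
    obtain ⟨u, hu, w, hw, h⟩ := Submodule.mem_sup.1
      (show g ∈ U t ⊔ W by rw [(hUW t).sup_eq_top]; trivial)
    exact ⟨u, hu, by rwa [← h, add_sub_cancel_left]⟩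
  choose v hvU hvW using hex
  refine ⟨v, ?_, fun t => ⟨hvU t, hvW t⟩⟩
  -- The kernel of `K t` is the intersection of `U t` and `W`, so `K t` is invertible. The wanted
  -- vector satisfies `K t (v t) = Wᗮ.starProjection g`, and continuity of inversion gives that of
  -- `v`.
  let K : X → E →L[ℝ] E := fun t => (U t)ᗮ.starProjection + Wᗮ.starProjection
  have hK : Continuous K := by
    refine Continuous.add ?_ continuous_const
    simp only [Submodule.starProjection_orthogonal]
    exact continuous_const.sub hU
  have hinj : ∀ t, Function.Injective (K t) := by
    intro t
    rw [injective_iff_map_eq_zero]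
    intro x hx
    have h1 : inner ℝ ((U t)ᗮ.starProjection x) x + inner ℝ (Wᗮ.starProjection x) x = 0 := by
      rw [← inner_add_left]
      change inner ℝ (K t x) x = 0
      rw [hx, inner_zero_left]
    have hn : ∀ S : Submodule ℝ E, inner ℝ (S.starProjection x) x = ‖S.starProjection x‖ ^ 2 :=
      fun S => by
        conv_lhs => rw [← S.starProjection_eq_self_iff.2 (S.starProjection_apply_mem x),
          Submodule.inner_starProjection_left_eq_right, real_inner_self_eq_norm_sq]
    rw [hn, hn] at h1
    have h2 : (U t)ᗮ.starProjection x = 0 := norm_eq_zero.1 (by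
      nlinarith [sq_nonneg ‖(U t)ᗮ.starProjection x‖, sq_nonneg ‖Wᗮ.starProjection x‖])
    have h3 : Wᗮ.starProjection x = 0 := norm_eq_zero.1 (by
      nlinarith [sq_nonneg ‖(U t)ᗮ.starProjection x‖, sq_nonneg ‖Wᗮ.starProjection x‖])
    rw [Submodule.starProjection_apply_eq_zero_iff, Submodule.orthogonal_orthogonal] at h2 h3
    exact (Submodule.mem_bot ℝ).1 ((hUW t).inf_eq_bot ▸ Submodule.mem_inf.2 ⟨h2, h3⟩)
  have hunit : ∀ t, IsUnit (K t) := fun t =>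
    ContinuousLinearMap.isUnit_iff_bijective.2
      ⟨hinj t, LinearMap.surjective_of_injective (f := (K t : E →ₗ[ℝ] E)) (hinj t)⟩
  have hKv : ∀ t, K t (v t) = Wᗮ.starProjection g := by
    intro t
    have h1 : (U t)ᗮ.starProjection (v t) = 0 := by
      rw [Submodule.starProjection_apply_eq_zero_iff, Submodule.orthogonal_orthogonal]
      exact hvU t
    have h2 : Wᗮ.starProjection (g - v t) = 0 := by
      rw [Submodule.starProjection_apply_eq_zero_iff, Submodule.orthogonal_orthogonal]
      exact hvW t
    rw [map_sub, sub_eq_zero] at h2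
    rw [show K t (v t) = (U t)ᗮ.starProjection (v t) + Wᗮ.starProjection (v t) from rfl, h1, h2,
      zero_add]
  have hv : v = fun t => Ring.inverse (K t) (Wᗮ.starProjection g) := by
    funext t
    rw [← hKv t, ← mul_apply_eq_comp, Ring.inverse_mul_cancel _ (hunit t)]
    rfl
  rw [hv]
  refine Continuous.clm_apply ?_ continuous_const
  refine continuous_iff_continuousAt.2 fun t => ?_
  obtain ⟨u, hu⟩ := hunit t
  exact ContinuousAt.comp (g := Ring.inverse) (hu ▸ NormedRing.inverse_continuousAt u)
    hK.continuousAt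

theorem linearIndependent_of_mem_notMem {K V : Type*} [DivisionRing K] [AddCommGroup V] [Module K V]
    (S : ℕ → Submodule K V) (hS : Monotone S) (w : ℕ → V) :
    ∀ n, (∀ m < n, w m ∈ S (m + 1) ∧ w m ∉ S m) → LinearIndependent K fun t : Fin n => w t
  | 0, _ => linearIndependent_empty_type
  | n + 1, h => by
    rw [linearIndependent_finSucc']
    refine ⟨linearIndependent_of_mem_notMem S hS w n fun m hm => h m (by omega), fun hmem => ?_⟩
    refine (h n (by omega)).2 (Submodule.span_le.2 ?_ hmem)
    rintro _ ⟨l, rfl⟩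
    exact hS (show (l : ℕ) + 1 ≤ n from l.2) (h l (by omega)).1

namespace FullFlag

variable {d : ℕ}

theorem continuous_starProjection_sub (i : Fin (d + 1)) :
    Continuous fun f : FullFlag d => (f.sub i).starProjection := by
  have h : Continuous fun (f : FullFlag d) (i : Fin (d + 1)) => (f.sub i).starProjection :=
    continuous_induced_dom
  exact continuous_pi_iff.1 h i

theorem HasFrame.linearIndependent {f : FullFlag d} {w : ℕ → EuclideanSpace ℝ (Fin d)}
    (h : f.HasFrame w) : LinearIndependent ℝ fun t : Fin d => w t := by
  refine linearIndependent_of_top_le_span_of_card_eq_finrank ?_ (by simp)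
  have h1 : f.sub (Fin.last d) = ⊤ := Submodule.eq_top_of_finrank_eq (by
    rw [f.finrank_sub, finrank_euclideanSpace, Fintype.card_fin, Fin.val_last])
  rw [← h1, h]
  rfl

/-- Take a vector of b^{d-m} outside b^{d-m-1} and project it to f^{m+1} along b^{d-m-1}. The
projection stays in b^{d-m}, which meets f^m trivially; were it in f^m, it would vanish and the
vector would lie in b^{d-m-1}. -/
theorem exists_continuous_mem_notMem {X : Type*} [TopologicalSpace X] {f : X → FullFlag d}
    (hf : Continuous f) {b : FullFlag d}
    (hb : ∀ t, ∀ i k : Fin (d + 1), (i : ℕ) + k = d → IsCompl ((f t).sub i) (b.sub k))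
    (m : Fin d) : ∃ w : X → EuclideanSpace ℝ (Fin d), Continuous w ∧
      ∀ t, w t ∈ (f t).sub m.succ ∧ w t ∉ (f t).sub m.castSucc := by
  have hlt : b.sub m.rev.castSucc < b.sub m.rev.succ := by
    refine lt_of_le_of_ne (b.mono (Fin.castSucc_le_succ _)) fun h => ?_
    have h1 := b.finrank_sub m.rev.castSucc
    rw [h, b.finrank_sub, Fin.val_succ, Fin.val_castSucc] at h1
    omega
  obtain ⟨g, hg, hg'⟩ := SetLike.exists_of_lt hlt
  have h1 : ∀ t, IsCompl ((f t).sub m.succ) (b.sub m.rev.castSucc) := fun t =>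
    hb t _ _ (by rw [Fin.val_succ, Fin.val_castSucc, Fin.val_rev]; omega)
  have h2 : ∀ t, (f t).sub m.castSucc ⊓ b.sub m.rev.succ = ⊥ := fun t =>
    (hb t _ _ (by rw [Fin.val_succ, Fin.val_castSucc, Fin.val_rev]; omega)).inf_eq_bot
  obtain ⟨w, hw, hwm⟩ :=
    exists_continuous_proj ((continuous_starProjection_sub m.succ).comp hf) h1 g
  refine ⟨w, hw, fun t => ⟨(hwm t).1, fun hmem => ?_⟩⟩
  have h3 : w t ∈ b.sub m.rev.succ := by
    have := Submodule.sub_mem _ hg (hlt.le (hwm t).2)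
    rwa [sub_sub_cancel] at this
  have h4 : w t ∈ (f t).sub m.castSucc ⊓ b.sub m.rev.succ := ⟨hmem, h3⟩
  rw [h2, Submodule.mem_bot] at h4
  have h5 := (hwm t).2
  rw [h4, sub_zero] at h5
  exact hg' h5

/-- A curve of flags transverse to a fixed flag has a continuous frame. -/
theorem exists_continuous_frame {X : Type*} [TopologicalSpace X] {f : X → FullFlag d}
    (hf : Continuous f) {b : FullFlag d}
    (hb : ∀ t, ∀ i k : Fin (d + 1), (i : ℕ) + k = d → IsCompl ((f t).sub i) (b.sub k)) :
    ∃ w : ℕ → X → EuclideanSpace ℝ (Fin d), (∀ m, Continuous (w m)) ∧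
      ∀ t, (f t).HasFrame fun m => w m t := by
  choose w hw hwm using exists_continuous_mem_notMem hf hb
  obtain ⟨w', hw', hw0⟩ : ∃ w' : ℕ → X → EuclideanSpace ℝ (Fin d), (∀ m : Fin d, w' m = w m) ∧
      ∀ m, Continuous (w' m) := by
    refine ⟨fun m => if h : m < d then w ⟨m, h⟩ else fun _ => 0, fun m => dif_pos m.2, fun m => ?_⟩
    by_cases h : m < d
    · simp only [dif_pos h]; exact hw _
    · simp only [dif_neg h]; exact continuous_const
  refine ⟨w', hw0, fun t => ?_⟩
  have hlin : LinearIndependent ℝ fun m : Fin d => w' m t := by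
    have hmono : Monotone fun m : ℕ => (f t).sub ⟨min m d, by omega⟩ := fun m n h =>
      (f t).mono (Fin.le_def.2 (min_le_min_right d h))
    refine linearIndependent_of_mem_notMem _ hmono (fun m => w' m t) d fun m hm => ?_
    have h := hwm ⟨m, hm⟩ t
    rw [← hw' ⟨m, hm⟩] at h
    have e1 : (⟨min (m + 1) d, by omega⟩ : Fin (d + 1)) = (⟨m, hm⟩ : Fin d).succ :=
      Fin.ext (min_eq_left hm)
    have e2 : (⟨min m d, by omega⟩ : Fin (d + 1)) = (⟨m, hm⟩ : Fin d).castSucc :=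
      Fin.ext (min_eq_left hm.le)
    rw [e1, e2]
    exact h
  refine hasFrame_of_linearIndependent hlin fun m => ?_
  rw [hw']
  exact (hwm m t).1

theorem IsTransverse.isCompl {f : Fin 2 → FullFlag d} (h : IsTransverse f) {i k : Fin (d + 1)}
    (hik : (i : ℕ) + k = d) : IsCompl ((f 0).sub i) ((f 1).sub k) := by
  have h1 := h ![i, k] (by simpa [Fin.sum_univ_two] using hik)
  exact (DirectSum.isInternal_submodule_iff_isCompl _ (i := 0) (j := 1) (by decide)
    (by ext x; fin_cases x <;> simp)).1 h1

end FullFlag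

end ContinuousFrames

/-! ### Frames along a limit map -/

namespace IsLimitMap

open Filter

variable {g d : ℕ} {j : SurfaceGroup g →* PSL(2, ℝ)} {ρ : SurfaceGroup g →* PSL(d, ℝ)}
  {ξ : OnePoint ℝ → FullFlag d}

/-- The flag at the point at infinity of the chart is transverse to all the others. -/
theorem exists_continuous_frame (hξ : IsLimitMap j ρ ξ) (H : GL (Fin 2) ℝ) :
    ∃ w : ℕ → ℝ → EuclideanSpace ℝ (Fin d), (∀ m, Continuous (w m)) ∧
      ∀ t : ℝ, (ξ (H⁻¹ • (t : OnePoint ℝ))).HasFrame fun m => w m t := by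
  refine FullFlag.exists_continuous_frame (b := ξ (H⁻¹ • (OnePoint.infty : OnePoint ℝ)))
    (hξ.continuous.comp ((continuous_smul_onePoint H⁻¹).comp OnePoint.continuous_coe)) ?_
  intro t i k hik
  have h := hξ.hyperconvex 2 ![H⁻¹ • (t : OnePoint ℝ), H⁻¹ • (OnePoint.infty : OnePoint ℝ)] (by
    have hne : H⁻¹ • (t : OnePoint ℝ) ≠ H⁻¹ • (OnePoint.infty : OnePoint ℝ) := fun h =>
      OnePoint.coe_ne_infty t (smul_left_cancel _ h)
    intro a b hab
    fin_cases a <;> fin_cases b <;> simp_all [hne.symm])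
  exact h.isCompl hik

variable {H : GL (Fin 2) ℝ} {w : ℕ → ℝ → EuclideanSpace ℝ (Fin d)}

theorem det_ne_zero_of_frame (hξ : IsLimitMap j ρ ξ)
    (hw : ∀ t : ℝ, (ξ (H⁻¹ • (t : OnePoint ℝ))).HasFrame fun m => w m t)
    (β : Module.Basis (Fin d) ℝ (EuclideanSpace ℝ (Fin d))) {n : ℕ} {τ : Fin n → ℝ}
    (hτ : Function.Injective τ) (m : Fin n → ℕ) (hm : ∑ l, m l = d)
    {v : Fin d → EuclideanSpace ℝ (Fin d)}
    (hv : ∀ l, ∀ t < m l, w t (τ l) ∈ Set.range v) : β.det v ≠ 0 := by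
  have hinj : Function.Injective fun l => H⁻¹ • (τ l : OnePoint ℝ) := fun a b hab =>
    hτ (OnePoint.coe_injective (smul_left_cancel _ hab))
  exact (hξ.hyperconvex n _ hinj).det_ne_zero (fun l => hw (τ l)) m hm β hv

theorem det_confluent_ne_zero (hξ : IsLimitMap j ρ ξ)
    (hw : ∀ t : ℝ, (ξ (H⁻¹ • (t : OnePoint ℝ))).HasFrame fun m => w m t)
    (β : Module.Basis (Fin d) ℝ (EuclideanSpace ℝ (Fin d))) {i l k : ℕ} (h : i + l + k ≤ d)
    {τ : ℕ → ℝ} (hτ : StrictMono τ) : β.det (fun t : Fin d => confluent w i l k τ t) ≠ 0 := by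
  refine hξ.det_ne_zero_of_frame hw β (n := (d - i - l - k) + 3) (τ := fun m => τ m)
    (fun a b hab => Fin.ext (hτ.injective hab))
    (Fin.cons i (Fin.cons l (Fin.cons k fun _ => 1))) ?_ ?_
  · simp [Fin.sum_univ_succ]
    omega
  · intro m
    refine Fin.cases ?_ (fun m => Fin.cases ?_ (fun m => Fin.cases ?_ (fun m => ?_) m) m) m
    · intro t ht
      simp only [Fin.cons_zero] at ht
      refine ⟨⟨t, by omega⟩, ?_⟩
      simp [confluent, ht]
    · intro t ht
      simp only [Fin.cons_succ, Fin.cons_zero] at ht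
      refine ⟨⟨i + t, by omega⟩, ?_⟩
      simp [confluent, ht]
    · intro t ht
      simp only [Fin.cons_succ, Fin.cons_zero] at ht
      refine ⟨⟨i + l + t, by omega⟩, ?_⟩
      simp only [confluent]
      rw [if_neg (by omega), if_neg (by omega), if_pos (by omega)]
      congr 1
      omega
    · intro t ht
      simp only [Fin.cons_succ, Nat.lt_one_iff] at ht
      subst ht
      refine ⟨⟨i + l + k + m, by omega⟩, ?_⟩
      simp only [confluent]
      rw [if_neg (by omega), if_neg (by omega), if_neg (by omega)]
      congr 2
      simp only [Fin.val_succ]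
      omega

theorem exists_sign (hξ : IsLimitMap j ρ ξ)
    (hw : ∀ t : ℝ, (ξ (H⁻¹ • (t : OnePoint ℝ))).HasFrame fun m => w m t)
    {γ : SurfaceGroup g} (hγ : γ ≠ 1) {A : SL(2, ℝ)} (hA : (QuotientGroup.mk A : PSL(2, ℝ)) = j γ)
    (hH : IsAttractingChart H A) (k : Fin d) :
    ∃ ε : ℝ, (ε = 1 ∨ ε = -1) ∧ ∀ F : EuclideanSpace ℝ (Fin d) →ₗ[ℝ] ℝ,
      (∀ l < (k : ℕ), F (w l 0) = 0) → F (w k 0) ≠ 0 → ∀ η > 0,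
        ∃ s, 0 < s ∧ s < η ∧ 0 < ε * (F (w 0 s) * F (w k 0)) := by
  have hd : 0 < d := k.pos
  obtain ⟨hfix, η₀, hη₀, hdyn⟩ := hH.dynamics
  obtain ⟨B, hB⟩ := QuotientGroup.mk_surjective (ρ γ)
  obtain ⟨ev, e, hev, hT, hsub⟩ := hξ.proximal γ A B hγ hA hB _ hfix
  have hev0 : ∀ i, ev i ≠ 0 := by
    intro i h0
    have h1 := hT i
    rw [h0, zero_smul] at h1
    have h2 := Matrix.eq_zero_of_mulVec_eq_zero (M := (B : Matrix (Fin d) (Fin d) ℝ))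
      (by rw [B.det_coe]; exact one_ne_zero) (v := WithLp.ofLp (e i)) (by
        rw [← Matrix.toLin'_apply, ← Matrix.ofLp_toLpLin 2 2, h1]; rfl)
    exact e.ne_zero i ((WithLp.ofLp_eq_zero 2).1 h2)
  -- By hyperconvexity the lines at `d` distinct parameters span the space, so they do not all lie
  -- in the hyperplane where the `k`-th coordinate vanishes.
  have hs₀ : ∃ s₀, 0 < s₀ ∧ s₀ ≤ η₀ ∧ e.repr (w 0 s₀) k ≠ 0 := by
    by_contra! hcon
    refine hξ.det_ne_zero_of_frame hw e (n := d) (τ := fun l => η₀ / ((l : ℝ) + 1)) ?_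
      (fun _ => 1) (by simp) (v := fun l => w 0 (η₀ / ((l : ℝ) + 1))) ?_ ?_
    · intro a b hab
      have ha : (0 : ℝ) < (a : ℝ) + 1 := by positivity
      have hb : (0 : ℝ) < (b : ℝ) + 1 := by positivity
      simp only at hab
      rw [div_eq_div_iff ha.ne' hb.ne'] at hab
      have := mul_left_cancel₀ hη₀.ne' hab
      exact Fin.ext (by exact_mod_cast (add_right_cancel this).symm)
    · intro l t ht
      obtain rfl : t = 0 := by omega
      exact ⟨l, rfl⟩
    · rw [Module.Basis.det_apply]
      refine Matrix.det_eq_zero_of_row_eq_zero k fun l => ?_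
      rw [Module.Basis.toMatrix_apply]
      refine hcon _ (by positivity) (div_le_self hη₀.le ?_)
      have : (0 : ℝ) ≤ (l : ℕ) := Nat.cast_nonneg _
      linarith
  obtain ⟨s₀, hs₀0, hs₀η, hs₀k⟩ := hs₀
  obtain ⟨s, hs0, hs, hsA⟩ := hdyn s₀ hs₀0 hs₀η
  -- By equivariance the line at `s n` is the image of the line at `s₀` under the `n`-th power of
  -- `B`.
  have hx : ∀ n, ∃ μ : ℝ, μ ≠ 0 ∧
      w 0 (s n) = μ • ((Matrix.toEuclideanLin (B : Matrix (Fin d) (Fin d) ℝ)) ^ n) (w 0 s₀) := by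
    intro n
    have h1 := hξ.equivariant (γ ^ n) (A ^ n) (B ^ n)
      (by rw [QuotientGroup.mk_pow, hA, map_pow]) (by rw [QuotientGroup.mk_pow, hB, map_pow])
      (H⁻¹ • (s₀ : OnePoint ℝ))
    rw [← hsA n] at h1
    have h2 := ((hw s₀).map h1) ⟨1, by omega⟩
    rw [hw (s n)] at h2
    have h3 : w 0 (s n) ∈ initSpan (fun m => w m (s n)) 1 :=
      mem_initSpan (w := fun m => w m (s n)) one_pos
    rw [h2] at h3
    obtain ⟨c, hc⟩ := mem_initSpan_iff.1 h3
    rw [Fin.sum_univ_one] at hc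
    have hp : Matrix.toEuclideanLin ((B ^ n : SL(d, ℝ)) : Matrix (Fin d) (Fin d) ℝ) =
        (Matrix.toEuclideanLin (B : Matrix (Fin d) (Fin d) ℝ)) ^ n := by
      rw [Matrix.SpecialLinearGroup.coe_pow]
      exact Matrix.toLpLin_pow _ _ _
    rw [hp] at hc
    refine ⟨c 0, fun h0 => ?_, hc.symm⟩
    rw [h0, zero_smul] at hc
    exact (hw (s n)).linearIndependent.ne_zero ⟨0, hd⟩ hc.symm
  choose μ hμ hμx using hx
  obtain ⟨ε, hε, h⟩ := exists_sign_of_orbit (w := fun m => w m 0) hev hev0 hT (fun i hi => by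
    rw [← hw 0 ⟨i, by omega⟩]; exact hsub ⟨i, by omega⟩) (hw 0).linearIndependent hs₀k hμ hμx hs
  refine ⟨ε, hε, fun F hF hne η hη => ?_⟩
  obtain ⟨n, hn, hpos⟩ := h F hF hne η hη
  exact ⟨s n, hs0 n, hn, hpos⟩

/-- Multiplying `w k` by its sign `ε k` removes the sign from `exists_sign`. As `w 0` also occurs at
the parameter `s`, its own sign has to be `1`, which holds by continuity at `0`. -/
theorem exists_adapted_frame (hξ : IsLimitMap j ρ ξ) {γ : SurfaceGroup g} (hγ : γ ≠ 1)
    {A : SL(2, ℝ)} (hA : (QuotientGroup.mk A : PSL(2, ℝ)) = j γ) (hH : IsAttractingChart H A) :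
    ∃ w : ℕ → ℝ → EuclideanSpace ℝ (Fin d), (∀ m, Continuous (w m)) ∧
      (∀ t : ℝ, (ξ (H⁻¹ • (t : OnePoint ℝ))).HasFrame fun m => w m t) ∧
      ∀ k < d, ∀ F : EuclideanSpace ℝ (Fin d) →ₗ[ℝ] ℝ, (∀ l < k, F (w l 0) = 0) →
        F (w k 0) ≠ 0 → ∀ η > 0, ∃ s, 0 < s ∧ s < η ∧ 0 < F (w 0 s) * F (w k 0) := by
  obtain ⟨w, hwc, hw⟩ := hξ.exists_continuous_frame H
  have key : ∀ k, ∃ ε : ℝ, (ε = 1 ∨ ε = -1) ∧ (k = 0 → ε = 1) ∧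
      (k < d → ∀ F : EuclideanSpace ℝ (Fin d) →ₗ[ℝ] ℝ,
      (∀ l < k, F (w l 0) = 0) → F (w k 0) ≠ 0 → ∀ η > 0,
        ∃ s, 0 < s ∧ s < η ∧ 0 < ε * (F (w 0 s) * F (w k 0))) := by
    intro k
    rcases Nat.eq_zero_or_pos k with rfl | hk
    · refine ⟨1, Or.inl rfl, fun _ => rfl, fun _ F _ hne η hη => ?_⟩
      have hc : Continuous fun s => F (w 0 s) * F (w 0 0) :=
        ((LinearMap.continuous_of_finiteDimensional F).comp (hwc 0)).mul continuous_const
      have h1 : ∀ᶠ s in 𝓝 (0 : ℝ), 0 < F (w 0 s) * F (w 0 0) :=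
        hc.continuousAt.eventually (lt_mem_nhds (mul_self_pos.2 hne))
      obtain ⟨s, hs, hs0, hsη⟩ := ((h1.filter_mono nhdsWithin_le_nhds).and
        (Ioo_mem_nhdsGT hη)).exists
      exact ⟨s, hs0, hsη, by rwa [one_mul]⟩
    · by_cases hkd : k < d
      · obtain ⟨ε, hε, h⟩ := hξ.exists_sign hw hγ hA hH ⟨k, hkd⟩
        exact ⟨ε, hε, fun h0 => absurd h0 hk.ne', fun _ => h⟩
      · exact ⟨1, Or.inl rfl, fun _ => rfl, fun h => absurd h hkd⟩
  choose ε hε hε0 h using key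
  have hne : ∀ m, ε m ≠ 0 := fun m => by rcases hε m with h | h <;> rw [h] <;> norm_num
  refine ⟨fun m t => ε m • w m t, fun m => by
    have := hwc m
    fun_prop, fun t => ?_, ?_⟩
  · refine FullFlag.hasFrame_of_linearIndependent ?_ fun m => Submodule.smul_mem _ _ ?_
    · exact (hw t).linearIndependent.units_smul fun m => Units.mk0 (ε m) (hne m)
    · rw [hw t]
      exact mem_initSpan (w := fun m => w m t) (by simp)
  · intro k hk F hF hFk η hη
    simp only [map_smul, smul_eq_mul, mul_ne_zero_iff, mul_eq_zero] at hF hFk ⊢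
    obtain ⟨s, hs0, hsη, hs⟩ := h k hk F (fun l hl => (hF l hl).resolve_left (hne l)) hFk.2 η hη
    refine ⟨s, hs0, hsη, ?_⟩
    rw [hε0 0 rfl]
    linarith

theorem conclusions (hg : 2 ≤ g) (hj : IsFuchsian j) (hξ : IsLimitMap j ρ ξ)
    {z : Fin 4 → OnePoint ℝ} (hz : IsCyclicallyOrdered z) :
    LinesInGeneralPosition (ξ (z 0)) (ξ (z 1)) (ξ (z 2)) (ξ (z 3)) ∧
      HasTotallyPositiveBaseChange (ξ (z 0)) (ξ (z 1)) (ξ (z 2)) (ξ (z 3)) := by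
  obtain ⟨H₀, t, h03, h32, h21, ht⟩ := hz.exists_chart
  obtain ⟨γ, A, hγ, hA, htr⟩ := hj.exists_hyperbolic hg
  obtain ⟨p, hp⟩ := exists_isAttractingChart H₀ htr
  obtain ⟨γ', A', hγ', hA', hH⟩ : ∃ (γ' : SurfaceGroup g) (A' : SL(2, ℝ)), γ' ≠ 1 ∧
      (QuotientGroup.mk A' : PSL(2, ℝ)) = j γ' ∧
      IsAttractingChart (translationGL p * H₀) A' := by
    rcases hp with hp | hp
    · exact ⟨γ, A, hγ, hA, hp⟩
    · exact ⟨γ⁻¹, A⁻¹, inv_ne_one.2 hγ, by rw [QuotientGroup.mk_inv, hA, map_inv], hp⟩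
  obtain ⟨w, hwc, hw, hfr⟩ := hξ.exists_adapted_frame hγ' hA' hH
  -- Translation by `p` keeps the order of the parameters, so the triples (a, b, y) and (a, y, x)
  -- both sit at increasing parameters and share the sign `κ`.
  have hz' : ∀ k, (ξ (z k)).HasFrame fun m => w m (t k - p) := by
    intro k
    have h := hw (t k - p)
    rwa [← translationGL_smul, ← ht, ← mul_smul (translationGL p), inv_smul_smul] at h
  let β := (EuclideanSpace.basisFun (Fin d) ℝ).toBasis
  obtain ⟨κ, hκ⟩ := exists_forall_det_cat3_pos β hwc
    (fun i l k h τ hτ => hξ.det_confluent_ne_zero hw β h hτ) hfr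
  exact FullFlag.conclusions_of_frames (hz' 0) (hz' 3) (hz' 2) (hz' 1)
    (fun i l k h => hκ i l k h _ _ _ (by linarith) (by linarith))
    (fun i l k h => hκ i l k h _ _ _ (by linarith) (by linarith))

end IsLimitMap

end

theorem theorem3p2 (d : ℕ) :
    (∀ a x y b : FullFlag d, IsPositiveQuadruple a x y b →
      LinesInGeneralPosition a x y b ∧ HasTotallyPositiveBaseChange a x y b) ∧
    (∀ (g : ℕ), 2 ≤ g → 2 ≤ d →
      ∀ (j : SurfaceGroup g →* PSL(2, ℝ)) (ρ : SurfaceGroup g →* PSL(d, ℝ))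
        (ξ : OnePoint ℝ → FullFlag d),
        IsFuchsian j → IsHitchin ρ → IsLimitMap j ρ ξ →
        ∀ z : Fin 4 → OnePoint ℝ, IsCyclicallyOrdered z →
          LinesInGeneralPosition (ξ (z 0)) (ξ (z 1)) (ξ (z 2)) (ξ (z 3)) ∧
          HasTotallyPositiveBaseChange (ξ (z 0)) (ξ (z 1)) (ξ (z 2)) (ξ (z 3))) := by
  refine ⟨fun a x y b h => h.conclusions, ?_⟩
  intro g hg _ j ρ ξ hj _ hξ z hz
  exact hξ.conclusions hg hj hz
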